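/- Let $n\ge 0$, let $f:\{0,1\}^n\to\{0,1\}$ be a symmetric Boolean function with value vector $v_f=(v_f(0),\dots,v_f(n))\in\{0,1\}^{n+1}$ (so $f(x)=v_f(|x|)$, where $|x|$ is the Hamming weight), and let $T\subseteq\{0,\dots,n\}$. A symmetric multi-linear polynomial supported on the levels $T$ is a function $$\mathsf{poly}(x)=\pi\sum_{i\in T}c_i\sum_{S\subseteq\{1,\dots,n\},\,|S|=i}\Bigl(1-2\bigoplus_{l\in S}x_l\Bigr),\qquad x\in\{0,1\}^n,$$ with real coefficients $c_i$. It computes $f$ deterministically in the $\mathrm{NMQC}_\oplus$ model if there are $k\ge1$, affine functions $L_1,\dots,L_k:\{0,1\}^n\to\{0,1\}$ over $\mathbb F_2$ and real angles $\theta_i,\phi_i$ with $\sum_{i=1}^k(\theta_i+\phi_iL_i(x))=\mathsf{poly}(x)$ for all $x$, such that measuring $M_i=\cos(\theta_i+\phi_iL_i(x))\,\sigma_x+\sin(\theta_i+\phi_iL_i(x))\,\sigma_y$ on the $i$-th qubit of the GHZ state $|\Psi\rangle=\frac1{\sqrt2}(|0\rangle^{\otimes k}+|1\rangle^{\otimes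 k})$ gives $\langle\Psi|M_1\otimes\cdots\otimes M_k|\Psi\rangle=(-1)^{f(x)}$ for all $x$. 1. The following decision problem is solvable by a (multi-stack) Turing machine in time polynomial in the length of the input: given the string of the $n+1$ pairs $(v_f(j),[j\in T])$, $0\le j\le n$, decide whether there is a symmetric multi-linear polynomial supported on the levels $T$ that computes $f$ deterministically in the $\mathrm{NMQC}_\oplus$ model. 2. Let $K_{i,j}=\sum_{k}(-1)^k\binom ik\binom{n-i}{j-k}$ for $0\le i,j\le n$ be the Krawtchouk matrix, let $E=\{0,\dots,n\}\setminus T$, and let $K_E$ be the submatrix of $K$ formed by the rows $i\in E$. Such a polynomial exists if and only if the linear Diophantine system $K_Ev_f=-2K_Eh$ has a solution $h\in\mathbb Z^{n+1}$. 3. Let $U,V$ be integer matrices that are invertible over $\mathbb Z$ and let $D=UK_EV$ be such that for some injective map $e:E\to\{0,\dots,n\}$ the entries $D_{i,j}$ with $j\ne e(i)$ vanish (as in the Smith normal form of $K_E$). Then such a polynomial exists if and only if $2D_{i,e(i)}$ divides $(UK_Ev_f)_i$ for every $i\in E$. -/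

import Mathlib

open scoped Matrix

noncomputable section

namespace NMQC

/-! ### Parities, multi-linear polynomials and symmetric Boolean functions -/

/-- The parity `⨁_{l ∈ S} x_l` of the bits of `x` selected by `S`. -/
def parity {n : ℕ} (S : Finset (Fin n)) (x : Fin n → Bool) : Bool :=
  decide (Odd (S.filter (fun l => x l = true)).card)

/-- A Boolean function is symmetric if it is invariant under permutations of its input bits. -/
def IsSymmetricFun {n : ℕ} (f : (Fin n → Bool) → Bool) : Prop :=
  ∀ (σ : Equiv.Perm (Fin n)) (x : Fin n → Bool), f (x ∘ σ) = f x

/-- The simplified value vector `v_f(0), …, v_f(n)`: the value of `f` at the string of Hamming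
weight `j` whose ones come first (for symmetric `f`, at every string of weight `j`). -/
def valueVector {n : ℕ} (f : (Fin n → Bool) → Bool) (j : Fin (n + 1)) : Bool :=
  f (fun l => decide (l.val < j.val))

/-- The multi-linear polynomial with (Fourier) coefficients `c`, as a function of bits:
`π ∑_S c_S (1 - 2 ⨁_{l ∈ S} x_l)`. -/
def polyEval {n : ℕ} (c : Finset (Fin n) → ℝ) (x : Fin n → Bool) : ℝ :=
  Real.pi * ∑ S : Finset (Fin n), c S * (1 - 2 * ((parity S x).toNat : ℝ))

/-- The polynomial is symmetric: the coefficient of `S` depends only on the level `|S|`. -/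
def IsSymmetricPoly {n : ℕ} (c : Finset (Fin n) → ℝ) : Prop :=
  ∀ S S' : Finset (Fin n), S.card = S'.card → c S = c S'

/-- Only coefficients at levels `|S| ∈ T` may be non-zero. -/
def SupportedOn {n : ℕ} (c : Finset (Fin n) → ℝ) (T : Finset (Fin (n + 1))) : Prop :=
  ∀ S : Finset (Fin n), c S ≠ 0 → ∃ i ∈ T, i.val = S.card

/-! ### The non-adaptive measurement model on GHZ states -/

/-- The Pauli operator `σ_x`. -/
def pauliX : Matrix (Fin 2) (Fin 2) ℂ := !![0, 1; 1, 0]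

/-- The Pauli operator `σ_y`. -/
def pauliY : Matrix (Fin 2) (Fin 2) ℂ := !![0, -Complex.I; Complex.I, 0]

/-- The equatorial observable `cos α σ_x + sin α σ_y`. -/
def equatorial (α : ℝ) : Matrix (Fin 2) (Fin 2) ℂ :=
  (Real.cos α : ℂ) • pauliX + (Real.sin α : ℂ) • pauliY

/-- The tensor product of `k` single-qubit operators, in the computational basis. -/
def tensorOp {k : ℕ} (M : Fin k → Matrix (Fin 2) (Fin 2) ℂ) :
    Matrix (Fin k → Fin 2) (Fin k → Fin 2) ℂ :=
  Matrix.of fun a b => ∏ i, M i (a i) (b i)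

/-- The GHZ state `(|0…0⟩ + |1…1⟩) / √2` of `k` qubits. -/
def ghz (k : ℕ) : (Fin k → Fin 2) → ℂ := fun a =>
  ((1 / Real.sqrt 2 : ℝ) : ℂ) *
    ((if a = (fun _ => 0) then 1 else 0) + (if a = (fun _ => 1) then 1 else 0))

/-- The expectation value `⟨ψ| A |ψ⟩`. -/
def expectation {k : ℕ} (ψ : (Fin k → Fin 2) → ℂ)
    (A : Matrix (Fin k → Fin 2) (Fin k → Fin 2) ℂ) : ℂ :=
  star ψ ⬝ᵥ (A *ᵥ ψ)

/-- A measurement assignment on a GHZ state of `k ≥ 1` qubits: qubit `i` carries the linear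
function `x ↦ offset i ⊕ ⨁_{l ∈ sel i} x_l` and the two angles `θ i`, `φ i`. The post-processing
is the parity of all measurement outcomes. -/
structure Assignment (n : ℕ) where
  /-- number of qubits -/
  k : ℕ
  k_pos : 0 < k
  /-- the bits read by the linear function of each qubit -/
  sel : Fin k → Finset (Fin n)
  /-- the constant of the linear function of each qubit -/
  offset : Fin k → Bool
  θ : Fin k → ℝ
  φ : Fin k → ℝ

namespace Assignment

variable {n : ℕ}

/-- The setting bit `s_i = L_i(x)` of qubit `i`. -/
def setting (A : Assignment n) (x : Fin n → Bool) (i : Fin A.k) : Bool :=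
  xor (A.offset i) (parity (A.sel i) x)

/-- The angle `θ_i + φ_i s_i` in which qubit `i` is measured. -/
def angle (A : Assignment n) (x : Fin n → Bool) (i : Fin A.k) : ℝ :=
  A.θ i + A.φ i * ((A.setting x i).toNat : ℝ)

/-- The product of the `±1` outcomes has expectation `(-1)^{f(x)}` for every input, that is, the
parity of the outcomes equals `f(x)` with probability one. -/
def Computes (A : Assignment n) (f : (Fin n → Bool) → Bool) : Prop :=
  ∀ x : Fin n → Bool,
    expectation (ghz A.k) (tensorOp fun i => equatorial (A.angle x i)) = (-1 : ℂ) ^ (f x).toNat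

end Assignment

/-- The polynomial with coefficients `c` computes `f` deterministically: it is the total angle
`∑_i (θ_i + φ_i L_i(x))` of a measurement assignment that computes `f` deterministically. -/
def PolyComputes {n : ℕ} (c : Finset (Fin n) → ℝ) (f : (Fin n → Bool) → Bool) : Prop :=
  ∃ A : Assignment n, (∀ x, ∑ i, A.angle x i = polyEval c x) ∧ A.Computes f

/-! ### The decision problem -/

/-- An instance: a symmetric Boolean function of `n` bits and a set of allowed levels. -/
structure Instance where
  /-- number of input bits -/
  n : ℕ
  /-- the Boolean function -/
  f : (Fin n → Bool) → Bool
  symm : IsSymmetricFun f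
  /-- the levels `|S|` at which the Fourier coefficients may be non-zero -/
  T : Finset (Fin (n + 1))

namespace Instance

/-- The input of the algorithm: the string of the `n + 1` pairs `(v_f(j), [j ∈ T])`. -/
def encode (I : Instance) : List (Bool × Bool) :=
  List.ofFn fun j : Fin (I.n + 1) => (valueVector I.f j, decide (j ∈ I.T))

/-- The question: is there a symmetric multi-linear polynomial with all its non-zero coefficients
at levels in `T` that computes `f` deterministically? -/
def Solvable (I : Instance) : Prop :=
  ∃ c : Finset (Fin I.n) → ℝ, IsSymmetricPoly c ∧ SupportedOn c I.T ∧ PolyComputes c I.f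

/-- The value vector of `f` as an integer vector. -/
def intVector (I : Instance) (j : Fin (I.n + 1)) : ℤ := ((valueVector I.f j).toNat : ℤ)

end Instance

/-- The entry in row `i` and column `j` of the Krawtchouk matrix of size `n + 1`:
`∑_k (-1)^k C(i, k) C(n - i, j - k)`. -/
def krawtchouk (n : ℕ) : Matrix (Fin (n + 1)) (Fin (n + 1)) ℤ :=
  Matrix.of fun i j => ∑ k ∈ Finset.range (j.val + 1),
    (-1 : ℤ) ^ k * (i.val.choose k : ℤ) * ((n - i.val).choose (j.val - k) : ℤ)

/-- The rows of the Krawtchouk matrix at the forbidden levels. -/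
def Instance.subKrawtchouk (I : Instance) :
    Matrix {i : Fin (I.n + 1) // i ∉ I.T} (Fin (I.n + 1)) ℤ :=
  (krawtchouk I.n).submatrix Subtype.val id

end NMQC

end

/-! ### Structured programs over stacks -/

/-! On a GHZ state of at least one qubit, a product of equatorial observables has expectation cos(∑
angles) (`expectation_equatorial`), and every polynomial is the total angle of an assignment with
one qubit per subset S (`exists_assignment`). Hence a polynomial computes f iff its value at each x
is π(f(x) + 2h) for some integer h. A symmetric polynomial with level coefficients d takes the value
π(Kd)_w on inputs of weight w, because the signs of the parities over all sets of size j sum up to a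
Krawtchouk number (`sum_signs`). As K² = 2^n (`krawtchouk_mul_self`), d = 2^{-n} K(v_f + 2h), and
support on T means exactly K_E(v_f + 2h) = 0. This gives the Diophantine criterion
(`Instance.solvable_iff`); the diagonal criterion follows by a unimodular change of variables
(`exists_mulVec_diagonal`).

The algorithm computes no Smith normal form over ℤ. It uses K = BW with B_{ik} = 2^k C(i,k) and W
unimodular (`krawtchouk_eq_mul`, `isUnit_det_pascalMatrix`). Replacing h by h + Kr changes K(v_f +
2h) by 2^{n+1} r, so the equation may be relaxed to a congruence modulo 2^{n+1}, and of W v_f only a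
vector u of bits congruent to it modulo 2 matters (`exists_kernel_iff`). With N = n + 1 the question
becomes whether Bu lies in the subgroup of (ℤ/2^N)^N generated by the doubled columns of B and the
vectors that vanish on E (`mem_closure_sup_irrelevant_iff`).

Membership in such a subgroup is decided by sifting along a chain of N² subgroups whose successive
factors have order at most two, one for each bit of each coordinate. A table holds at most one
vector per position. A vector to be inserted is reduced by the entries it meets; at an empty slot it
is stored, and its double is sifted further. In the end the double of every entry lies in the span
of the later ones, so every element of the subgroup sifts down to the vectors that vanish on E
(`Sift.Complete.mem_span_of_mem`). The bits u come from Pascal's rule modulo two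
(`triangleSum_succ`) and the columns of B from iterated doubled prefix sums (`sum_scaledChoose`), so
the arithmetic consists of copying and adding N-bit numbers.

For the time bound, the procedure is a `BitProg`: all loops have the range N and the memory consists
of arrays of bits, so the cost is a polynomial in N by construction. Such programs are compiled to
structured stack programs (`BitProg.runs_compile`), and these to `TM2` machines with a step-by-step
simulation (`StackProg.Exec.iterate_step`). -/

/-- Structured programs over a family of stacks with alphabets `Γ k`. -/
inductive StackProg {K : Type} (Γ : K → Type) : Type
  | skip : StackProg Γ
  | push (k : K) (a : Γ k) : StackProg Γ
  | pop (k : K) : StackProg Γ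
  | seq (P Q : StackProg Γ) : StackProg Γ
  | ite (k : K) (c : Option (Γ k) → Bool) (P Q : StackProg Γ) : StackProg Γ
  | loop (k : K) (c : Option (Γ k) → Bool) (P : StackProg Γ) : StackProg Γ

namespace StackProg

variable {K : Type} {Γ : K → Type}

/-- `Exec P s t s'`: started on the stacks `s`, the program `P` ends with the stacks `s'` after
exactly `t` elementary steps. -/
inductive Exec [DecidableEq K] :
    StackProg Γ → (∀ k, List (Γ k)) → ℕ → (∀ k, List (Γ k)) → Prop
  | skip (s) : Exec .skip s 1 s
  | push (k a s) : Exec (.push k a) s 1 (Function.update s k (a :: s k))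
  | pop (k s) : Exec (.pop k) s 1 (Function.update s k (s k).tail)
  | seq {P Q s t s' t' s''} : Exec P s t s' → Exec Q s' t' s'' → Exec (.seq P Q) s (t + t') s''
  | ite_true {k c P Q s t s'} : c (s k).head? = true → Exec P s t s' →
      Exec (.ite k c P Q) s (t + 1) s'
  | ite_false {k c P Q s t s'} : c (s k).head? = false → Exec Q s t s' →
      Exec (.ite k c P Q) s (t + 1) s'
  | loop_false {k c P s} : c (s k).head? = false → Exec (.loop k c P) s 1 s
  | loop_true {k c P s t s' t' s''} : c (s k).head? = true → Exec P s t s' →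
      Exec (.loop k c P) s' t' s'' → Exec (.loop k c P) s (t + t' + 1) s''

/-- The control points of a program. -/
def Label : StackProg Γ → Type
  | .skip => Unit
  | .push _ _ => Unit
  | .pop _ => Unit
  | .seq P Q => P.Label ⊕ Q.Label
  | .ite _ _ P Q => Option (P.Label ⊕ Q.Label)
  | .loop _ _ P => Option P.Label

noncomputable instance fintypeLabel : (P : StackProg Γ) → Fintype P.Label
  | .skip => inferInstanceAs (Fintype Unit)
  | .push _ _ => inferInstanceAs (Fintype Unit)
  | .pop _ => inferInstanceAs (Fintype Unit)
  | .seq P Q =>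
    haveI := fintypeLabel P
    haveI := fintypeLabel Q
    inferInstanceAs (Fintype (P.Label ⊕ Q.Label))
  | .ite _ _ P Q =>
    haveI := fintypeLabel P
    haveI := fintypeLabel Q
    inferInstanceAs (Fintype (Option (P.Label ⊕ Q.Label)))
  | .loop _ _ P =>
    haveI := fintypeLabel P
    inferInstanceAs (Fintype (Option P.Label))

/-- The control point at which a program starts. -/
def entry : (P : StackProg Γ) → P.Label
  | .skip => ()
  | .push _ _ => ()
  | .pop _ => ()
  | .seq P _ => Sum.inl P.entry
  | .ite _ _ _ _ => (none : Option _)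
  | .loop _ _ _ => (none : Option _)

/-- A statement that branches on the top of stack `k`. -/
def test {Λ : Type} (k : K) (c : Option (Γ k) → Bool) (l₁ l₂ : Λ) : Turing.TM2.Stmt Γ Λ Bool :=
  .peek k (fun _ o => c o) (.branch id (.load (fun _ => false) (.goto fun _ => l₁))
    (.load (fun _ => false) (.goto fun _ => l₂)))

/-- The statements of a program whose control points are embedded by `ι` and which continues at
`next`. -/
def code {Λ : Type} : (P : StackProg Γ) → (P.Label → Λ) → Λ → P.Label → Turing.TM2.Stmt Γ Λ Bool
  | .skip, _, next => fun _ => .goto fun _ => next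
  | .push k a, _, next => fun _ => .push k (fun _ => a) (.goto fun _ => next)
  | .pop k, _, next => fun _ => .pop k (fun v _ => v) (.goto fun _ => next)
  | .seq P Q, ι, next => fun l => match l with
    | .inl l => P.code (fun l => ι (Sum.inl l)) (ι (Sum.inr Q.entry)) l
    | .inr l => Q.code (fun l => ι (Sum.inr l)) next l
  | .ite k c P Q, ι, next => fun l => match l with
    | none => test k c (ι (some (Sum.inl P.entry))) (ι (some (Sum.inr Q.entry)))
    | some (.inl l) => P.code (fun l => ι (some (Sum.inl l))) next l
    | some (.inr l) => Q.code (fun l => ι (some (Sum.inr l))) next l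
  | .loop k c P, ι, next => fun l => match l with
    | none => test k c (ι (some P.entry)) next
    | some l => P.code (fun l => ι (some l)) (ι none) l

variable [DecidableEq K]

/-- A `TM2` step executes a whole statement up to its `goto`, so peeking, branching and resetting
the register cost one step. The reset makes every control point start with the internal state
`false`. -/
theorem iterate_step_test {Λ : Type} {M : Λ → Turing.TM2.Stmt Γ Λ Bool} {l l₁ l₂ : Λ} {k : K}
    {c : Option (Γ k) → Bool} (h : M l = test k c l₁ l₂) (s : ∀ k, List (Γ k)) (t : ℕ) :
    (flip bind (Turing.TM2.step M))^[t + 1] (some ⟨some l, false, s⟩) =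
      (flip bind (Turing.TM2.step M))^[t]
        (some ⟨some (if c (s k).head? = true then l₁ else l₂), false, s⟩) := by
  rw [Function.iterate_succ_apply]
  congr 1
  cases hc : c (s k).head? <;> simp [flip, Turing.TM2.step, h, test, Turing.TM2.stepAux, hc]

/-- The compiled program simulates the execution step by step. -/
theorem Exec.iterate_step {P : StackProg Γ} {s s' : ∀ k, List (Γ k)} {t : ℕ} (h : Exec P s t s') :
    ∀ {Λ : Type} (M : Λ → Turing.TM2.Stmt Γ Λ Bool) (ι : P.Label → Λ) (next : Λ),
      (∀ l, M (ι l) = P.code ι next l) →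
      (flip bind (Turing.TM2.step M))^[t] (some ⟨some (ι P.entry), false, s⟩) =
        some ⟨some next, false, s'⟩ := by
  induction h with
  | skip s | push k a s | pop k s =>
    intro Λ M ι next hM
    simp [flip, Turing.TM2.step, hM, code, Turing.TM2.stepAux]
  | seq _ _ ih₁ ih₂ =>
    intro Λ M ι next hM
    rw [Nat.add_comm, Function.iterate_add_apply]
    erw [ih₁ M (fun l => ι (Sum.inl l)) _ fun l => hM (Sum.inl l)]
    exact ih₂ M (fun l => ι (Sum.inr l)) next fun l => hM (Sum.inr l)
  | ite_true hc _ ih =>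
    intro Λ M ι next hM
    refine (iterate_step_test (hM none) _ _).trans ?_
    rw [if_pos hc]
    exact ih M (fun l => ι (some (Sum.inl l))) next fun l => hM (some (Sum.inl l))
  | ite_false hc _ ih =>
    intro Λ M ι next hM
    refine (iterate_step_test (hM none) _ _).trans ?_
    rw [if_neg (by simp [hc])]
    exact ih M (fun l => ι (some (Sum.inr l))) next fun l => hM (some (Sum.inr l))
  | loop_false hc =>
    intro Λ M ι next hM
    refine (iterate_step_test (hM none) _ 0).trans ?_
    rw [if_neg (by simp [hc])]
    rfl
  | loop_true hc _ _ ih₁ ih₂ =>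
    intro Λ M ι next hM
    refine (iterate_step_test (hM none) _ _).trans ?_
    rw [if_pos hc, Nat.add_comm, Function.iterate_add_apply]
    erw [ih₁ M (fun l => ι (some l)) (ι none) fun l => hM (some l)]
    exact ih₂ M ι next hM

/-- Time bounds space. This is what makes the final clearing of the stacks affordable. -/
theorem Exec.length_le {P : StackProg Γ} {s s' : ∀ k, List (Γ k)} {t : ℕ} (h : Exec P s t s')
    (k : K) : (s' k).length ≤ (s k).length + t := by
  induction h with
  | skip s => simp
  | push k' a s | pop k' s =>
    by_cases hk : k = k'
    · subst hk
      simp [Function.update_self] <;> omega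
    · simp [Function.update_of_ne hk]
  | _ => omega

/-- `P` leads from `s` to `s'` in at most `T` steps. -/
def Runs (P : StackProg Γ) (s s' : ∀ k, List (Γ k)) (T : ℕ) : Prop :=
  ∃ t ≤ T, Exec P s t s'

theorem Runs.mono {P : StackProg Γ} {s s' : ∀ k, List (Γ k)} {T T' : ℕ} (h : Runs P s s' T)
    (hT : T ≤ T') : Runs P s s' T' := by
  obtain ⟨t, ht, h⟩ := h
  exact ⟨t, ht.trans hT, h⟩

theorem Runs.seq {P Q : StackProg Γ} {s s' s'' : ∀ k, List (Γ k)} {T T' : ℕ}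
    (h : Runs P s s' T) (h' : Runs Q s' s'' T') : Runs (.seq P Q) s s'' (T + T') := by
  obtain ⟨t, ht, h⟩ := h
  obtain ⟨t', ht', h'⟩ := h'
  exact ⟨t + t', by omega, .seq h h'⟩

theorem runs_skip (s : ∀ k, List (Γ k)) : Runs .skip s s 1 := ⟨1, le_rfl, .skip s⟩

theorem runs_push (k : K) (a : Γ k) (s : ∀ k, List (Γ k)) :
    Runs (.push k a) s (Function.update s k (a :: s k)) 1 := ⟨1, le_rfl, .push k a s⟩

theorem runs_pop (k : K) (s : ∀ k, List (Γ k)) :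
    Runs (.pop k) s (Function.update s k (s k).tail) 1 := ⟨1, le_rfl, .pop k s⟩

theorem runs_ite {k : K} {c : Option (Γ k) → Bool} {P Q : StackProg Γ} {s s' : ∀ k, List (Γ k)}
    {T : ℕ} (h : Runs (if c (s k).head? = true then P else Q) s s' T) :
    Runs (.ite k c P Q) s s' (T + 1) := by
  obtain ⟨t, ht, h⟩ := h
  by_cases hc : c (s k).head? = true
  · rw [if_pos hc] at h
    exact ⟨t + 1, by omega, .ite_true hc h⟩
  · rw [if_neg hc] at h
    exact ⟨t + 1, by omega, .ite_false (by simpa using hc) h⟩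

/-- The invariant rule for loops that remove one symbol of stack `k` per round. -/
theorem runs_loop {k : K} {P : StackProg Γ} {T L : ℕ} (Inv : ℕ → (∀ k, List (Γ k)) → Prop)
    (hlen : ∀ i s, Inv i s → (s k).length + i = L)
    (hstep : ∀ i s, i < L → Inv i s → ∃ s', Runs P s s' T ∧ Inv (i + 1) s')
    {s : ∀ k, List (Γ k)} (h : Inv 0 s) :
    ∃ s', Runs (.loop k Option.isSome P) s s' (L * (T + 1) + 1) ∧ Inv L s' := by
  -- Induction on the number `d` of rounds still to come, since an execution of a loop is built from
  -- its first round.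
  suffices H : ∀ d i s, i + d = L → Inv i s →
      ∃ s', Runs (.loop k Option.isSome P) s s' (d * (T + 1) + 1) ∧ Inv L s' from
    H L 0 s (by omega) h
  intro d
  induction d with
  | zero =>
    intro i s hi hs
    have := hlen i s hs
    have h0 : s k = [] := List.length_eq_zero_iff.1 (by omega)
    refine ⟨s, ⟨1, by simp, .loop_false (by simp [h0])⟩, ?_⟩
    have : i = L := by omega
    exact this ▸ hs
  | succ d ih =>
    intro i s hi hs
    have hl := hlen i s hs
    obtain ⟨s₁, ⟨t, ht, h₁⟩, hs₁⟩ := hstep i s (by omega) hs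
    obtain ⟨s₂, ⟨t', ht', h₂⟩, hs₂⟩ := ih (i + 1) s₁ (by omega) hs₁
    refine ⟨s₂, ⟨t + t' + 1, ?_, .loop_true ?_ h₁ h₂⟩, hs₂⟩
    · rw [Nat.succ_mul]; omega
    · cases hk : s k with
      | nil => simp [hk] at hl; omega
      | cons a l => simp

/-- Empty the stacks of a list. -/
def clear : List K → StackProg Γ
  | [] => .skip
  | k :: ks => .seq (.loop k Option.isSome (.pop k)) (clear ks)

/-- The last conjunct carries the induction: a stack that has been emptied stays empty while the
rest of the list is cleared. -/
theorem runs_clear (ks : List K) : ∀ s : ∀ k, List (Γ k), ∃ s', Runs (clear ks) s s'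
    ((ks.map fun k => 2 * (s k).length + 1).sum + 1) ∧ (∀ k ∈ ks, s' k = []) ∧
      ∀ k, s k = [] → s' k = [] := by
  induction ks with
  | nil => exact fun s => ⟨s, (runs_skip s).mono (by simp), by simp, fun k h => h⟩
  | cons k ks ih =>
    intro s
    obtain ⟨s₁, h₁, hk, hs₁⟩ := runs_loop (k := k) (P := .pop k) (T := 1) (L := (s k).length)
      (fun i s' => (s' k).length + i = (s k).length ∧ ∀ k', k' ≠ k → s' k' = s k')
      (fun i s' h => h.1) (fun i s' hi h => ⟨_, runs_pop k s', by
        simp only [Function.update_self, List.length_tail]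
        refine ⟨by omega, fun k' hk' => ?_⟩
        rw [Function.update_of_ne hk', h.2 k' hk']⟩) (s := s) ⟨by simp, fun _ _ => rfl⟩
    have hk0 : s₁ k = [] := List.length_eq_zero_iff.1 (by omega)
    obtain ⟨s₂, h₂, hall, hs₂⟩ := ih s₁
    refine ⟨s₂, (h₁.seq h₂).mono ?_, ?_, ?_⟩
    · have : (ks.map fun k => 2 * (s₁ k).length + 1).sum ≤
          (ks.map fun k => 2 * (s k).length + 1).sum := by
        apply List.sum_le_sum
        intro k' _
        by_cases hk' : k' = k
        · subst hk'; simp [hk0]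
        · rw [hs₁ k' hk']
      simp only [List.map_cons, List.sum_cons]
      omega
    · intro k' hk'
      rcases List.mem_cons.1 hk' with rfl | hk'
      · exact hs₂ _ hk0
      · exact hall _ hk'
    · intro k' hk'
      apply hs₂
      by_cases h : k' = k
      · subst h; exact hk0
      · rw [hs₁ k' h, hk']

/-- The Turing machine that runs a program and halts. -/
noncomputable def machine [Fintype K] (P : StackProg Γ) (k₀ k₁ : K) [Fintype (Γ k₀)] :
    Turing.FinTM2 where
  K := K
  k₀ := k₀
  k₁ := k₁
  Γ := Γ
  Λ := Option P.Label
  main := some P.entry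
  σ := Bool
  initialState := false
  m := fun l => match l with
    | none => .halt
    | some l => P.code some none l

/-- A program that turns every encoded input into the encoded output within polynomial time
yields a polynomial-time Turing machine. -/
theorem exists_machine [Fintype K] (P : StackProg Γ) (k₀ k₁ : K) [Fintype (Γ k₀)]
    [hΓ : ∀ k, Finite (Γ k)] {α β : Type} (ea : α → List (Γ k₀)) (eb : β → List (Γ k₁)) (f : α → β)
    (time : Polynomial ℕ)
    (h : ∀ a, Runs P (Function.update (fun _ => []) k₀ (ea a))
      (Function.update (fun _ => []) k₁ (eb (f a))) (time.eval (ea a).length)) :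
    ∃ M : Turing.TM2ComputableInPolyTime ea eb f, ∀ k : M.tm.K, Finite (M.tm.Γ k) := by
  refine ⟨{ tm := machine P k₀ k₁, inputAlphabet := Equiv.refl _, outputAlphabet := Equiv.refl _,
            time := time + 1, outputsFun := fun a => ?_ }, hΓ⟩
  -- The initial and final configurations of `FinTM2` describe their stacks by a dependent case
  -- distinction instead of `Function.update`.
  have hu : ∀ (k : K) (l : List (Γ k)) (k' : K), Function.update (fun _ => []) k l k' =
      @dite (List (Γ k')) (k' = k) _ (fun h => by rw [h]; exact l) fun _ => [] := by
    intro k l k'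
    by_cases hk : k' = k
    · subst hk; simp
    · simp [hk]
  apply Classical.choice
  obtain ⟨t, ht, h⟩ := h a
  -- The extra step executes `halt` at the label `none`, where the compiled program continues after
  -- its end.
  refine ⟨⟨⟨t + 1, ?_⟩, by simpa using ht⟩⟩
  have := h.iterate_step (machine P k₀ k₁).m some none fun l => rfl
  have hi : Turing.initList (machine P k₀ k₁) (ea a) =
      (⟨some (some P.entry), false, Function.update (fun _ => []) k₀ (ea a)⟩ :
        Turing.TM2.Cfg Γ (Option P.Label) Bool) := by
    simp only [Turing.initList]
    congr 1
    funext k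
    exact (hu k₀ (ea a) k).symm
  have ho : Turing.haltList (machine P k₀ k₁) (eb (f a)) =
      (⟨none, false, Function.update (fun _ => []) k₁ (eb (f a))⟩ :
        Turing.TM2.Cfg Γ (Option P.Label) Bool) := by
    simp only [Turing.haltList]
    congr 1
    funext k
    exact (hu k₁ (eb (f a)) k).symm
  have e1 : List.map (Equiv.refl (Γ k₀)).invFun (ea a) = ea a := by
    simp [Equiv.refl]
  have e2 : List.map (Equiv.refl (Γ k₁)).invFun (eb (f a)) = eb (f a) := by
    simp [Equiv.refl]
  erw [e1, e2, Option.map_some, hi, ho, Nat.add_comm, Function.iterate_add_apply, this]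
  rfl

end StackProg

/-! ### Stacks of bits -/

/-- The work stacks of a program with loop variables `V` and arrays `A`. -/
inductive WorkStack (V A : Type) : Type
  | size | addr | aux | swap | out
  | var (v : V)
  | mem (a : A)
  deriving DecidableEq, Fintype

/-- The alphabet of the input stack `none` consists of pairs of bits, that of the others of bits. -/
abbrev WorkStack.Cell {V A : Type} : Option (WorkStack V A) → Type
  | none => Bool × Bool
  | some _ => Bool

namespace StackProg

open WorkStack

variable {V A : Type} [DecidableEq V] [DecidableEq A]

/-- Push the top of stack `a`, or `false` if `a` is empty, on stack `b`. -/
def peekTo (a b : WorkStack V A) : StackProg (Cell (V := V) (A := A)) :=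
  .ite (some a) (fun o => o == some true) (.push (some b) true) (.push (some b) false)

theorem runs_peekTo (a b : WorkStack V A) (s : ∀ k, List (Cell (V := V) (A := A) k)) :
    Runs (peekTo a b) s
      (Function.update s (some b) ((s (some a)).headD false :: s (some b))) 2 := by
  apply runs_ite
  cases h : s (some a) with
  | nil => simpa using runs_push (some b) false s
  | cons x l => cases x <;> simpa using runs_push (some b) _ s

/-- Move the contents of stack `a` to stack `b`, reversing it. -/
def move (a b : WorkStack V A) : StackProg (Cell (V := V) (A := A)) :=
  .loop (some a) Option.isSome (.seq (peekTo a b) (.pop (some a)))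

/-- The invariant splits the original stack into the part `l` already moved and the part still in
place. A round costs four steps: the loop test, two for `peekTo` and one for `pop`. -/
theorem runs_move {a b : WorkStack V A} (hab : a ≠ b)
    (s : ∀ k, List (Cell (V := V) (A := A) k)) :
    Runs (move a b) s (Function.update (Function.update s (some a) []) (some b)
      ((s (some a)).reverse ++ s (some b))) (4 * (s (some a)).length + 1) := by
  obtain ⟨s₁, h₁, l, hl, hL, hb, hs⟩ := runs_loop (k := some a)
    (P := .seq (peekTo a b) (.pop (some a))) (T := 3) (L := (s (some a)).length)
    (fun i s' => ∃ l, s (some a) = l ++ s' (some a) ∧ l.length = i ∧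
      s' (some b) = l.reverse ++ s (some b) ∧ ∀ k, k ≠ some a → k ≠ some b → s' k = s k)
    (fun i s' ⟨l, h, hi, _⟩ => by rw [h, List.length_append]; omega)
    (fun i s' hi ⟨l, h, hil, hb, hs⟩ => by
      refine ⟨_, (runs_peekTo a b s').seq (runs_pop (some a) _), ?_⟩
      rcases hc : s' (some a) with _ | ⟨x, r⟩
      · rw [h, hc] at hi; simp at hi; omega
      · refine ⟨l ++ [x], ?_, by simp [hil], ?_, fun k hka hkb => ?_⟩
        · simp [h, hc, hab]
        · simp [hb, hab.symm]
        · simp [hka, hkb, hs k hka hkb]) (s := s) ⟨[], by simp⟩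
  have hl' : s₁ (some a) = [] := by
    have := congrArg List.length hl
    rw [List.length_append] at this
    exact List.length_eq_zero_iff.1 (by omega)
  have : s₁ = Function.update (Function.update s (some a) []) (some b)
      ((s (some a)).reverse ++ s (some b)) := by
    funext k
    by_cases hkb : k = some b
    · subst hkb
      rw [hb, hl, hl']
      simp
    · by_cases hka : k = some a
      · subst hka
        simp [hkb, hl']
      · simp [hka, hkb, hs k hka hkb]
  exact this ▸ h₁.mono (by omega)

/-- Put a copy of stack `a` on top of stack `b`. -/
def copy (a b : WorkStack V A) : StackProg (Cell (V := V) (A := A)) :=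
  .seq (move a aux) (.loop (some aux) Option.isSome
    (.seq (.seq (peekTo aux a) (peekTo aux b)) (.pop (some aux))))

/-- The detour through `aux` reverses the contents twice, so both copies have the original order.
`aux` must start empty, since everything on it is copied. -/
theorem runs_copy {a b : WorkStack V A} (hab : a ≠ b) (ha : a ≠ aux) (hb : b ≠ aux)
    (s : ∀ k, List (Cell (V := V) (A := A) k)) (haux : s (some aux) = []) :
    Runs (copy a b) s (Function.update s (some b) (s (some a) ++ s (some b)))
      (10 * (s (some a)).length + 2) := by
  have h₀ := runs_move ha s
  set s₀ := Function.update (Function.update s (some a) []) (some aux)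
      ((s (some a)).reverse ++ s (some aux)) with hs₀
  have hx : s₀ (some aux) = (s (some a)).reverse := by simp [s₀, haux]
  obtain ⟨s₁, h₁, l, hl, hL, hsa, hsb, hs⟩ := runs_loop (k := some aux)
    (P := .seq (.seq (peekTo aux a) (peekTo aux b)) (.pop (some aux))) (T := 5)
    (L := (s₀ (some aux)).length)
    (fun i s' => ∃ l, s₀ (some aux) = l ++ s' (some aux) ∧ l.length = i ∧
      s' (some a) = l.reverse ++ s₀ (some a) ∧
      s' (some b) = l.reverse ++ s₀ (some b) ∧
      ∀ k, k ≠ some a → k ≠ some b → k ≠ some aux → s' k = s₀ k)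
    (fun i s' ⟨l, h, hi, _⟩ => by rw [h, List.length_append]; omega)
    (fun i s' hi ⟨l, h, hil, hsa, hsb, hs⟩ => by
      refine ⟨_, ((runs_peekTo aux a s').seq (runs_peekTo aux b _)).seq (runs_pop (some aux) _), ?_⟩
      rcases hc : s' (some aux) with _ | ⟨x, r⟩
      · rw [h, hc] at hi; simp at hi; omega
      · refine ⟨l ++ [x], ?_, by simp [hil], ?_, ?_, fun k hka hkb hk => ?_⟩
        · simp [h, hc, ha.symm, hb.symm]
        · simp [hsa, hab, ha]
        · simp [hsb, hab.symm, hb, ha.symm, hc]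
        · simp [hka, hkb, hk, hs k hka hkb hk]) (s := s₀) ⟨[], by simp⟩
  have hl' : s₁ (some aux) = [] := by
    have := congrArg List.length hl
    rw [List.length_append] at this
    exact List.length_eq_zero_iff.1 (by omega)
  have hlr : l = (s (some a)).reverse := by rw [← hx, hl, hl', List.append_nil]
  have : s₁ = Function.update s (some b) (s (some a) ++ s (some b)) := by
    funext k
    by_cases hkb : k = some b
    · subst hkb
      rw [hsb, hlr]
      simp [s₀, hb, hab.symm]
    · by_cases hka : k = some a
      · subst hka
        rw [hsa, hlr]
        simp [s₀, ha, hab]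
      · by_cases hk : k = some aux
        · subst hk
          simp [hkb, haux, hl']
        · rw [hs k hka hkb hk]
          simp [s₀, hka, hkb, hk]
  rw [← this]
  refine (h₀.seq h₁).mono ?_
  rw [hx, List.length_reverse]
  omega

end StackProg

/-! ### Addressing memory cells by unary numbers -/

/-- The position of the address `xs` in a linear memory, in base `N + 1` with digits `x + 1`. -/
def linearAddr (N : ℕ) : List ℕ → ℕ
  | [] => 0
  | x :: xs => x + 1 + (N + 1) * linearAddr N xs

theorem linearAddr_lt {N : ℕ} : ∀ {xs : List ℕ}, (∀ x ∈ xs, x < N) →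
    linearAddr N xs < (N + 1) ^ xs.length
  | [], _ => by simp [linearAddr]
  | x :: xs, h => by
    have h₁ := linearAddr_lt (N := N) (xs := xs) fun y hy => h y (List.mem_cons_of_mem _ hy)
    have h₂ := h x List.mem_cons_self
    rw [linearAddr, List.length_cons, pow_succ]
    nlinarith

/-- The digits `x + 1` are nonzero and smaller than the base `N + 1`. The lowest digit is therefore
a remainder, and addresses of different lengths cannot collide. -/
theorem linearAddr_injective {N : ℕ} : ∀ {xs ys : List ℕ}, (∀ x ∈ xs, x < N) → (∀ y ∈ ys, y < N) →
    linearAddr N xs = linearAddr N ys → xs = ys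
  | [], [], _, _, _ => rfl
  | [], y :: ys, _, _, h => by simp only [linearAddr] at h; omega
  | x :: xs, [], _, _, h => by simp only [linearAddr] at h; omega
  | x :: xs, y :: ys, hx, hy, h => by
    have h₁ := hx x List.mem_cons_self
    have h₂ := hy y List.mem_cons_self
    simp only [linearAddr] at h
    have hm : x + 1 = y + 1 := by
      have := congrArg (· % (N + 1)) h
      simpa [Nat.add_mul_mod_self_left, Nat.mod_eq_of_lt (Nat.succ_lt_succ h₁),
        Nat.mod_eq_of_lt (Nat.succ_lt_succ h₂)] using this
    have hq : linearAddr N xs = linearAddr N ys := by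
      rw [hm] at h
      exact Nat.eq_of_mul_eq_mul_left (Nat.succ_pos N) (Nat.add_left_cancel h)
    rw [linearAddr_injective (fun z hz => hx z (List.mem_cons_of_mem _ hz))
      (fun z hz => hy z (List.mem_cons_of_mem _ hz)) hq, Nat.succ_injective hm]

namespace StackProg

open WorkStack

variable {V A : Type} [DecidableEq V] [DecidableEq A]

/-- Multiply the unary number on the address stack by one more than the size. -/
def scaleAddr : StackProg (Cell (V := V) (A := A)) :=
  .seq (.loop (some addr) Option.isSome
    (.seq (.seq (.pop (some addr)) (.push (some swap) true)) (copy size swap))) (move swap addr)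

/-- Each symbol is traded for one symbol and a copy of the size stack. Addresses are unary, so only
the length of the result matters. -/
theorem runs_scaleAddr (s : ∀ k, List (Cell (V := V) (A := A) k)) (haux : s (some aux) = [])
    (hswap : s (some swap) = []) :
    ∃ l, l.length = (s (some addr)).length * ((s (some size)).length + 1) ∧
      Runs scaleAddr s (Function.update s (some addr) l)
        ((s (some addr)).length * (14 * (s (some size)).length + 9) + 2) := by
  obtain ⟨s₁, h₁, hL, hsw, hs⟩ := runs_loop (k := some addr)
    (P := .seq (.seq (.pop (some addr)) (.push (some swap) true)) (copy size swap))
    (T := 10 * (s (some size)).length + 4) (L := (s (some addr)).length)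
    (fun i s' => (s' (some addr)).length + i = (s (some addr)).length ∧
      (s' (some swap)).length = i * ((s (some size)).length + 1) ∧
      ∀ k, k ≠ some addr → k ≠ some swap → s' k = s k)
    (fun i s' h => h.1)
    (fun i s' hi ⟨h, hsw, hs⟩ => by
      have hsz := hs (some size) (by simp) (by simp)
      refine ⟨_, (((runs_pop (some addr) s').seq (runs_push (some swap) true _)).seq
        (runs_copy (by simp) (by simp) (by simp) _ ?_)).mono ?_, ?_, ?_, fun k hka hkb => ?_⟩
      · simp [hs (some aux), haux]
      · simp [hsz]; omega
      · simp; omega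
      · simp [hsz, hsw]; ring
      · simp [hka, hkb, hs k hka hkb]) (s := s) ⟨by simp, by simp [hswap], fun _ _ _ => rfl⟩
  have hl' : s₁ (some addr) = [] := List.length_eq_zero_iff.1 (by omega)
  refine ⟨(s₁ (some swap)).reverse, by simpa using hsw, ?_⟩
  have h₂ := runs_move (V := V) (A := A) (a := swap) (b := addr) (by simp) s₁
  have : Function.update s (some addr) (s₁ (some swap)).reverse =
      Function.update (Function.update s₁ (some swap) []) (some addr)
      ((s₁ (some swap)).reverse ++ s₁ (some addr)) := by
    funext k
    by_cases hk : k = some addr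
    · subst hk; simp [hl']
    · by_cases hk' : k = some swap
      · subst hk'; simp [hswap]
      · simp [hk, hk', hs k hk hk']
  rw [this]
  refine (h₁.seq h₂).mono ?_
  rw [hsw]
  apply le_of_eq
  ring

/-- Compute on the address stack the position of the address given by loop variables. -/
def addrCode : List V → StackProg (Cell (V := V) (A := A))
  | [] => .skip
  | y :: ys => .seq (addrCode ys) (.seq scaleAddr (.seq (copy (var y) addr)
      (.push (some addr) true)))

/-- A bound for the running time of `addrCode`. -/
def addrCost (N : ℕ) : ℕ → ℕ
  | 0 => 1
  | k + 1 => addrCost N k + ((N + 1) ^ k * (14 * N + 9) + 2 + (10 * N + 2 + 1))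

/-- This is Horner's rule in base `N + 1`, starting from the last coordinate, as in the recursion of
`linearAddr`. -/
theorem runs_addrCode {N : ℕ} (s : ∀ k, List (Cell (V := V) (A := A) k))
    (hsize : (s (some size)).length = N) (haux : s (some aux) = []) (hswap : s (some swap) = [])
    (haddr : s (some addr) = []) (hvar : ∀ v, (s (some (var v))).length < N) :
    ∀ ys : List V, ∃ l, l.length = linearAddr N (ys.map fun v => (s (some (var v))).length) ∧
      Runs (addrCode ys) s (Function.update s (some addr) l) (addrCost N ys.length)
  | [] => ⟨[], rfl, by
      rw [← haddr, Function.update_eq_self]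
      exact runs_skip s⟩
  | y :: ys => by
    obtain ⟨l, hl, h₁⟩ := runs_addrCode s hsize haux hswap haddr hvar ys
    obtain ⟨l', hl', h₂⟩ := runs_scaleAddr (Function.update s (some addr) l) (by simpa) (by simpa)
    have hlt := linearAddr_lt (N := N) (xs := ys.map fun v => (s (some (var v))).length)
      (by simp only [List.mem_map]; rintro _ ⟨v, _, rfl⟩; exact hvar v)
    have h₃ := (runs_copy (a := var y) (b := addr) (by simp) (by simp) (by simp)
      (Function.update (Function.update s (some addr) l) (some addr) l') (by simpa)).seq
      (runs_push (some addr) true _)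
    have hv := hvar y
    refine ⟨true :: (s (some (var y)) ++ l'), ?_, ?_⟩
    · simp only [Function.update_self, ne_eq, reduceCtorEq, not_false_eq_true,
        Function.update_of_ne, Option.some.injEq] at hl'
      rw [hl, hsize] at hl'
      simp only [List.length_cons, List.length_append, hl', List.map_cons, linearAddr]
      ring
    · have h := h₁.seq (h₂.seq h₃)
      simp only [Function.update_idem, Function.update_self, ne_eq, reduceCtorEq,
        not_false_eq_true, Function.update_of_ne, Option.some.injEq] at h
      refine h.mono ?_
      rw [List.length_cons, addrCost, hsize, hl]
      rw [List.length_map] at hlt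
      gcongr

/-- Bring the cell of array `a` with the given address to the top of its stack; the cells above
it are kept on the auxiliary stack. -/
def seek (a : A) (ys : List V) : StackProg (Cell (V := V) (A := A)) :=
  .seq (addrCode ys) (.loop (some addr) Option.isSome
    (.seq (.pop (some addr)) (.seq (peekTo (mem a) aux) (.pop (some (mem a))))))

/-- A bound for the running time of `seek`. -/
def seekCost (N k : ℕ) : ℕ := addrCost N k + ((N + 1) ^ k * 5 + 1)

/-- Cells below the bottom of a stack count as `false`. Moving a missing cell creates a `false`,
which is invisible to `getD`; so memory needs no initialization. -/
theorem getD_reverse_append_tail (M L : List Bool) (i : ℕ) :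
    ((L.headD false :: M).reverse ++ L.tail).getD i false = (M.reverse ++ L).getD i false := by
  cases L with
  | nil =>
    simp only [List.headD_nil, List.reverse_cons, List.tail_nil, List.append_nil]
    rcases lt_or_ge i M.reverse.length with h | h
    · rw [List.getD_append _ _ _ _ h]
    · rw [List.getD_append_right _ _ _ _ h, List.getD_eq_default _ _ h]
      cases hk : i - M.reverse.length <;> simp
  | cons x L => simp

/-- The invariant of the loop is that the reversed auxiliary stack on top of the array stack shows
the old contents of the array. -/
theorem runs_seek {N : ℕ} (s : ∀ k, List (Cell (V := V) (A := A) k))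
    (hsize : (s (some size)).length = N) (haux : s (some aux) = []) (hswap : s (some swap) = [])
    (haddr : s (some addr) = []) (hvar : ∀ v, (s (some (var v))).length < N) (a : A)
    (ys : List V) :
    ∃ M L : List Bool,
      M.length = linearAddr N (ys.map fun v => (s (some (var v))).length) ∧
      (∀ i, (M.reverse ++ L).getD i false = (s (some (mem a))).getD i false) ∧
      Runs (seek a ys) s (Function.update (Function.update s (some aux) M) (some (mem a)) L)
        (seekCost N ys.length) := by
  obtain ⟨l, hl, h₁⟩ := runs_addrCode s hsize haux hswap haddr hvar ys
  have hlt := linearAddr_lt (N := N) (xs := ys.map fun v => (s (some (var v))).length)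
      (by simp only [List.mem_map]; rintro _ ⟨v, _, rfl⟩; exact hvar v)
  obtain ⟨s₁, h₂, hL, hM, hget, hs⟩ := runs_loop (k := some addr)
    (P := .seq (.pop (some addr)) (.seq (peekTo (mem a) aux) (.pop (some (mem a)))))
    (T := 4) (L := l.length)
    (fun i s' => (s' (some addr)).length + i = l.length ∧ (s' (some aux)).length = i ∧
      (∀ j, ((s' (some aux)).reverse ++ s' (some (mem a))).getD j false =
        (s (some (mem a))).getD j false) ∧
      ∀ k, k ≠ some addr → k ≠ some aux → k ≠ some (mem a) → s' k = s k)
    (fun i s' h => h.1)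
    (fun i s' hi ⟨h, hM, hget, hs⟩ => by
      refine ⟨_, (runs_pop (some addr) s').seq ((runs_peekTo (mem a) aux _).seq
        (runs_pop (some (mem a)) _)), ?_, ?_, fun j => ?_, fun k hka hkb hkc => ?_⟩
      · simp; omega
      · simp [hM]
      · rw [← hget]
        refine Eq.trans ?_ (getD_reverse_append_tail _ _ j)
        simp
      · simp [hka, hkb, hkc, hs k hka hkb hkc])
    (s := Function.update s (some addr) l)
    ⟨by simp, by simp [haux], by simp [haux], fun k hk _ _ => by simp [hk]⟩
  have hl' : s₁ (some addr) = [] := List.length_eq_zero_iff.1 (by omega)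
  refine ⟨s₁ (some aux), s₁ (some (mem a)), by rw [hM, hl], hget, ?_⟩
  have : Function.update (Function.update s (some aux) (s₁ (some aux))) (some (mem a))
      (s₁ (some (mem a))) = s₁ := by
    funext k
    by_cases hk : k = some (mem a)
    · subst hk; simp
    · by_cases hk' : k = some aux
      · subst hk'; simp
      · by_cases hk'' : k = some addr
        · subst hk''; simp [haddr, hl']
        · simp [hk, hk', hs k hk'' hk' hk]
  rw [this]
  refine (h₁.seq h₂).mono ?_
  rw [seekCost, hl]
  rw [List.length_map] at hlt
  gcongr

end StackProg

/-! ### Loop programs over arrays of bits -/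

/-- Programs over arrays `A` of bits, addressed by lists of loop variables `V`. All loops run over
`0, …, N - 1` for the same size `N`. -/
inductive BitProg (V A : Type) : Type
  | skip : BitProg V A
  | set (a : A) (xs : List V) (b : Bool) : BitProg V A
  | ite (a : A) (xs : List V) (P Q : BitProg V A) : BitProg V A
  | seq (P Q : BitProg V A) : BitProg V A
  | loop (x : V) (P : BitProg V A) : BitProg V A

namespace BitProg

variable {V A : Type} [DecidableEq V] [DecidableEq A]

/-- Iterate `f 0, …, f (n - 1)`. -/
def iterUpTo {M : Type} (f : ℕ → M → M) (m : M) : ℕ → M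
  | 0 => m
  | n + 1 => f n (iterUpTo f m n)

/-- Change one bit of the memory. -/
def write (m : A → List ℕ → Bool) (a : A) (l : List ℕ) (b : Bool) : A → List ℕ → Bool :=
  fun a' l' => if a' = a ∧ l' = l then b else m a' l'

/-- The memory after running a program with loop bound `N` and values `ρ` of the variables. -/
def eval (N : ℕ) : BitProg V A → (V → ℕ) → (A → List ℕ → Bool) → A → List ℕ → Bool
  | skip, _, m => m
  | set a xs b, ρ, m => write m a (xs.map ρ) b
  | ite a xs P Q, ρ, m => if m a (xs.map ρ) then P.eval N ρ m else Q.eval N ρ m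
  | seq P Q, ρ, m => Q.eval N ρ (P.eval N ρ m)
  | loop x P, ρ, m => iterUpTo (fun i m => P.eval N (Function.update ρ x i) m) m N

/-- The loop variables of a program. -/
def bound : BitProg V A → List V
  | skip => []
  | set _ _ _ => []
  | ite _ _ P Q => P.bound ++ Q.bound
  | seq P Q => P.bound ++ Q.bound
  | loop x P => x :: P.bound

/-- Nested loops use different variables. -/
def WellScoped : BitProg V A → Prop
  | skip => True
  | set _ _ _ => True
  | ite _ _ P Q => P.WellScoped ∧ Q.WellScoped
  | seq P Q => P.WellScoped ∧ Q.WellScoped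
  | loop x P => x ∉ P.bound ∧ P.WellScoped

open StackProg WorkStack

/-- The translation into a program over stacks. -/
def compile : BitProg V A → StackProg (Cell (V := V) (A := A))
  | skip => .skip
  | set a xs b => .seq (seek a xs) (.seq (.pop (some (mem a)))
      (.seq (.push (some (mem a)) b) (move aux (mem a))))
  | ite a xs P Q => .seq (seek a xs) (.ite (some (mem a)) (fun o => o == some true)
      (.seq (move aux (mem a)) P.compile) (.seq (move aux (mem a)) Q.compile))
  | seq P Q => .seq P.compile Q.compile
  | loop x P => .seq (copy size (var x)) (.loop (some (var x)) Option.isSome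
      (.seq (.pop (some (var x))) P.compile))

/-- A bound for the running time of the translation. -/
noncomputable def cost : BitProg V A → Polynomial ℕ
  | skip => 1
  | set _ xs _ => seekPoly xs.length + (4 * (Polynomial.X + 1) ^ xs.length + 3)
  | ite _ xs P Q => seekPoly xs.length + (4 * (Polynomial.X + 1) ^ xs.length + 2 + (P.cost + Q.cost))
  | seq P Q => P.cost + Q.cost
  | loop _ P => 10 * Polynomial.X + 2 + (Polynomial.X * (P.cost + 2) + 1)
where
  addrPoly : ℕ → Polynomial ℕ
    | 0 => 1
    | k + 1 => addrPoly k + ((Polynomial.X + 1) ^ k * (14 * Polynomial.X + 9) + 2 +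
        (10 * Polynomial.X + 2 + 1))
  seekPoly (k : ℕ) : Polynomial ℕ := addrPoly k + ((Polynomial.X + 1) ^ k * 5 + 1)

theorem eval_seekPoly (N k : ℕ) : (cost.seekPoly k).eval N = seekCost N k := by
  have : ∀ k, (cost.addrPoly k).eval N = addrCost N k := by
    intro k
    induction k with
    | zero => simp [cost.addrPoly, addrCost]
    | succ k ih => simp [cost.addrPoly, addrCost, ih]
  simp [cost.seekPoly, seekCost, this]

/-- The stacks represent the size `N` and the values `ρ` of the variables. -/
structure EnvRep (N : ℕ) (ρ : V → ℕ) (s : ∀ k, List (Cell (V := V) (A := A) k)) : Prop where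
  size : (s (some size)).length = N
  addr : s (some addr) = []
  aux : s (some aux) = []
  swap : s (some swap) = []
  var : ∀ v, (s (some (var v))).length + ρ v + 1 = N

/-- The stacks represent the memory `m`. -/
def MemRep (N : ℕ) (m : A → List ℕ → Bool) (s : ∀ k, List (Cell (V := V) (A := A) k)) : Prop :=
  ∀ a xs, (∀ x ∈ xs, x < N) →
    (s (some (mem a))).getD (linearAddr N (xs.map fun x => N - 1 - x)) false = m a xs

/-- Loop variables count up while their stacks are popped down: the value `ρ v` is stored as `N - 1
- ρ v` symbols. This is the complement that appears in the addresses of `MemRep`. -/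
theorem EnvRep.seek {N : ℕ} {ρ : V → ℕ} {s : ∀ k, List (Cell (V := V) (A := A) k)}
    (h : EnvRep N ρ s) {m : A → List ℕ → Bool} (hm : MemRep N m s) (a : A) (ys : List V) :
    ∃ M L : List Bool,
      M.length = linearAddr N ((ys.map ρ).map fun x => N - 1 - x) ∧
      M.length < (N + 1) ^ ys.length ∧
      (∀ i, (M.reverse ++ L).getD i false = (s (some (mem a))).getD i false) ∧
      L.headD false = m a (ys.map ρ) ∧
      Runs (seek a ys) s (Function.update (Function.update s (some .aux) M) (some (mem a)) L)
        (seekCost N ys.length) := by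
  obtain ⟨M, L, hM, hget, hr⟩ := runs_seek s h.size h.aux h.swap h.addr
    (fun v => by have := h.var v; omega) a ys
  have hmap : (ys.map fun v => (s (some (WorkStack.var v))).length) =
      (ys.map ρ).map fun x => N - 1 - x := by
    rw [List.map_map]
    refine List.map_congr_left fun v _ => ?_
    have := h.var v
    simp only [Function.comp]
    omega
  have hlt := linearAddr_lt (N := N) (xs := ys.map fun v => (s (some (WorkStack.var v))).length)
      (by simp only [List.mem_map]; rintro _ ⟨v, _, rfl⟩; have := h.var v; omega)
  rw [List.length_map] at hlt
  refine ⟨M, L, by rw [hM, hmap], by rw [hM]; exact hlt, hget, ?_, hr⟩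
  rw [← hm a (ys.map ρ) (by simp only [List.mem_map]; rintro _ ⟨v, _, rfl⟩; have := h.var v; omega),
    ← hmap, ← hM, ← hget, List.getD_append_right _ _ _ _ (by simp)]
  cases L <;> simp

theorem runs_move_aux {s : ∀ k, List (Cell (V := V) (A := A) k)} (h : s (some aux) = []) (a : A)
    (M L : List Bool) :
    Runs (move aux (mem a)) (Function.update (Function.update s (some aux) M) (some (mem a)) L)
      (Function.update s (some (mem a)) (M.reverse ++ L)) (4 * M.length + 1) := by
  have := runs_move (V := V) (A := A) (a := aux) (b := mem a) (by simp)
    (Function.update (Function.update s (some aux) M) (some (mem a)) L)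
  simp only [Function.update_self, ne_eq, reduceCtorEq, not_false_eq_true,
        Function.update_of_ne, Option.some.injEq] at this
  convert this using 1
  funext k
  by_cases hk : k = some (mem a)
  · subst hk; simp
  · by_cases hk' : k = some aux
    · subst hk'; simp [h]
    · simp [hk, hk']

omit [DecidableEq V] [DecidableEq A] in
theorem EnvRep.congr {N : ℕ} {ρ : V → ℕ} {s s' : ∀ k, List (Cell (V := V) (A := A) k)}
    (h : EnvRep N ρ s) (hs : ∀ k, (∀ a, k ≠ some (mem a)) → s' k = s k) : EnvRep N ρ s' := by
  refine ⟨?_, ?_, ?_, ?_, fun v => ?_⟩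
  · rw [hs _ (by simp), h.size]
  · rw [hs _ (by simp), h.addr]
  · rw [hs _ (by simp), h.aux]
  · rw [hs _ (by simp), h.swap]
  · rw [hs _ (by simp), h.var]

omit [DecidableEq V] [DecidableEq A] in
theorem MemRep.congr {N : ℕ} {m : A → List ℕ → Bool} {s s' : ∀ k, List (Cell (V := V) (A := A) k)}
    (h : MemRep N m s)
    (hs : ∀ a i, (s' (some (mem a))).getD i false = (s (some (mem a))).getD i false) :
    MemRep N m s' := fun a xs hxs => by rw [hs, h a xs hxs]

/-- Overwriting the cell reached by `seek` changes this position only, even if the cell was below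
the bottom of the stack. -/
theorem getD_cons_tail (M L : List Bool) (b : Bool) (i : ℕ) :
    (M.reverse ++ b :: L.tail).getD i false =
      if i = M.length then b else (M.reverse ++ L).getD i false := by
  rcases lt_trichotomy i M.length with h | h | h
  · rw [List.getD_append _ _ _ _ (by simpa), List.getD_append _ _ _ _ (by simpa), if_neg h.ne]
  · rw [if_pos h, List.getD_append_right _ _ _ _ (by simp [h])]
    simp [h]
  · rw [if_neg h.ne', List.getD_append_right _ _ _ _ (by simp [h.le]),
      List.getD_append_right _ _ _ _ (by simp [h.le])]
    obtain ⟨j, hj⟩ : ∃ j, i - M.reverse.length = j + 1 :=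
      ⟨i - M.length - 1, by simp; omega⟩
    rw [hj]
    cases L <;> simp

/-- All stacks except the memory are restored, so the statement composes. An empty variable stack
stands for the value `N - 1`; every loop variable has this value outside its loop, which is why the
stacks of the bound variables must be empty at the start. -/
theorem runs_compile {N : ℕ} : ∀ (P : BitProg V A), P.WellScoped →
    ∀ (ρ : V → ℕ) (m : A → List ℕ → Bool) (s : ∀ k, List (Cell (V := V) (A := A) k)),
    EnvRep N ρ s → MemRep N m s → (∀ x ∈ P.bound, s (some (var x)) = []) →
    ∃ s', Runs P.compile s s' (P.cost.eval N) ∧ MemRep N (P.eval N ρ m) s' ∧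
      ∀ k, (∀ a, k ≠ some (mem a)) → s' k = s k
  | skip, _, ρ, m, s, _, hm, _ => ⟨s, (runs_skip s).mono (by simp [cost]), hm, fun _ _ => rfl⟩
  | set a xs b, _, ρ, m, s, he, hm, _ => by
    obtain ⟨M, L, hM, hlt, hget, hhead, hr⟩ := he.seek hm a xs
    have h := hr.seq ((runs_pop (some (mem a)) _).seq ((runs_push (some (mem a)) b _).seq
      (by
        have := runs_move_aux he.aux a M (b :: L.tail)
        simpa using this)))
    refine ⟨_, h.mono ?_, ?_, fun k hk => ?_⟩
    · simp only [cost, Polynomial.eval_add, Polynomial.eval_mul, Polynomial.eval_pow,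
        Polynomial.eval_X, Polynomial.eval_one, Polynomial.eval_ofNat, eval_seekPoly]
      omega
    · intro a' ys hys
      by_cases ha : a' = a
      · subst ha
        have hvar : ∀ y ∈ (xs.map ρ), y < N := by
          simp only [List.mem_map]; rintro _ ⟨v, _, rfl⟩; have := he.var v; omega
        -- The write hits exactly one represented address, because `x ↦ N - 1 - x` is an involution
        -- on the values below `N` and `linearAddr` is injective.
        have hinj : linearAddr N (ys.map fun x => N - 1 - x) = M.length ↔ ys = xs.map ρ := by
          rw [hM]
          refine ⟨fun h => ?_, fun h => by rw [h]⟩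
          have := linearAddr_injective
            (by simp only [List.mem_map]; rintro _ ⟨y, hy, rfl⟩; have := hys y hy; omega)
            (by simp only [List.mem_map (f := fun x => N - 1 - x)]; rintro _ ⟨y, hy, rfl⟩
                have := hvar y hy; omega) h
          have hinv : ∀ l : List ℕ, (∀ y ∈ l, y < N) →
              (l.map fun x => N - 1 - x).map (fun x => N - 1 - x) = l := by
            intro l hl
            rw [List.map_map]
            conv_rhs => rw [← List.map_id l]
            refine List.map_congr_left fun y hy => ?_
            have := hl y hy
            simp only [Function.comp, id]
            omega
          rw [← hinv ys hys, this, hinv _ hvar]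
        rw [Function.update_self]
        refine (getD_cons_tail M L b _).trans ?_
        simp only [eval, write, hinj, true_and]
        split_ifs
        · rfl
        · rw [hget, hm _ _ hys]
      · simp only [eval, write, ha, false_and, if_false]
        rw [Function.update_of_ne (by simpa using ha), hm a' ys hys]
    · rw [Function.update_of_ne (hk a)]
  | ite a xs P Q, hw, ρ, m, s, he, hm, hb => by
    obtain ⟨M, L, hM, hlt, hget, hhead, hr⟩ := he.seek hm a xs
    set s₁ := Function.update s (some (mem a)) (M.reverse ++ L) with hs₁
    have hs : ∀ k, (∀ a, k ≠ some (mem a)) → s₁ k = s k :=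
      fun k hk => Function.update_of_ne (hk a) _ _
    have he₁ : EnvRep N ρ s₁ := he.congr hs
    have hm₁ : MemRep N m s₁ := hm.congr fun a' i => by
      by_cases ha : a' = a
      · subst ha
        rw [hs₁, Function.update_self]
        exact hget i
      · rw [hs₁, Function.update_of_ne (by simpa using ha)]
    have hmv := runs_move_aux he.aux a M L
    have hc : ((Function.update (Function.update s (some aux) M) (some (mem a)) L
        (some (mem a))).head? == some true) = m a (xs.map ρ) := by
      rw [Function.update_self, ← hhead]
      rcases L with _ | ⟨_ | _, L⟩ <;> rfl
    simp only [WellScoped] at hw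
    simp only [bound, List.mem_append] at hb
    cases hcase : m a (xs.map ρ) with
    | true =>
      obtain ⟨s₂, hr₂, hm₂, hs₂⟩ := runs_compile P hw.1 ρ m s₁ he₁ hm₁
        fun x hx => by rw [hs _ (by simp), hb x (Or.inl hx)]
      refine ⟨s₂, (hr.seq (runs_ite (T := 4 * M.length + 1 + P.cost.eval N) ?_)).mono ?_, by simpa [eval, hcase] using hm₂,
        fun k hk => by rw [hs₂ k hk, hs k hk]⟩
      · rw [hc, hcase, if_pos rfl]
        exact hmv.seq hr₂
      · simp only [cost, Polynomial.eval_add, Polynomial.eval_mul, Polynomial.eval_pow,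
          Polynomial.eval_X, Polynomial.eval_one, Polynomial.eval_ofNat, eval_seekPoly]
        omega
    | false =>
      obtain ⟨s₂, hr₂, hm₂, hs₂⟩ := runs_compile Q hw.2 ρ m s₁ he₁ hm₁
        fun x hx => by rw [hs _ (by simp), hb x (Or.inr hx)]
      refine ⟨s₂, (hr.seq (runs_ite (T := 4 * M.length + 1 + Q.cost.eval N) ?_)).mono ?_, by simpa [eval, hcase] using hm₂,
        fun k hk => by rw [hs₂ k hk, hs k hk]⟩
      · rw [hc, hcase, if_neg (by simp)]
        exact hmv.seq hr₂
      · simp only [cost, Polynomial.eval_add, Polynomial.eval_mul, Polynomial.eval_pow,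
          Polynomial.eval_X, Polynomial.eval_one, Polynomial.eval_ofNat, eval_seekPoly]
        omega
  | seq P Q, hw, ρ, m, s, he, hm, hb => by
    simp only [WellScoped] at hw
    simp only [bound, List.mem_append] at hb
    obtain ⟨s₁, hr₁, hm₁, hs₁⟩ := runs_compile P hw.1 ρ m s he hm fun x hx => hb x (Or.inl hx)
    obtain ⟨s₂, hr₂, hm₂, hs₂⟩ := runs_compile Q hw.2 ρ _ s₁ (he.congr hs₁) hm₁
      fun x hx => by rw [hs₁ _ (by simp), hb x (Or.inr hx)]
    exact ⟨s₂, (hr₁.seq hr₂).mono (by simp [cost]), hm₂, fun k hk => by rw [hs₂ k hk, hs₁ k hk]⟩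
  | loop x P, hw, ρ, m, s, he, hm, hb => by
    simp only [WellScoped] at hw
    simp only [bound, List.mem_cons] at hb
    -- As the stack of `x` is empty, copying the size makes it exactly `N` long. The body runs after
    -- a `pop`, so round `i` sees `N - 1 - i` symbols, which represent the value `i`.
    have hx : s (some (var x)) = [] := hb x (Or.inl rfl)
    have h₀ := runs_copy (a := size) (b := var x) (by simp) (by simp) (by simp) s he.aux
    rw [hx, List.append_nil, he.size] at h₀
    obtain ⟨s₁, hr₁, hl, hm₁, hs₁⟩ := runs_loop (k := some (var x))
      (P := .seq (.pop (some (var x))) P.compile) (T := 1 + P.cost.eval N) (L := N)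
      (fun i s' => (s' (some (var x))).length + i = N ∧
        MemRep N (iterUpTo (fun i m => P.eval N (Function.update ρ x i) m) m i) s' ∧
        ∀ k, (∀ a, k ≠ some (mem a)) → k ≠ some (var x) → s' k = s k)
      (fun i s' h => h.1)
      (fun i s' hi ⟨hl, hm', hs'⟩ => by
        have hs'' : ∀ k, (∀ a, k ≠ some (mem a)) → k ≠ some (var x) →
            Function.update s' (some (var x)) (s' (some (var x))).tail k = s k :=
          fun k hk hk' => by rw [Function.update_of_ne hk', hs' k hk hk']
        obtain ⟨s₂, hr₂, hm₂, hs₂⟩ := runs_compile P hw.2 (Function.update ρ x i) _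
          (Function.update s' (some (var x)) (s' (some (var x))).tail)
          ⟨by rw [hs'' _ (by simp) (by simp), he.size], by rw [hs'' _ (by simp) (by simp), he.addr],
            by rw [hs'' _ (by simp) (by simp), he.aux], by rw [hs'' _ (by simp) (by simp), he.swap],
            fun v => by
              by_cases hv : v = x
              · subst hv
                simp only [Function.update_self, List.length_tail]
                omega
              · rw [hs'' _ (by simp) (by simpa using hv), Function.update_of_ne hv, he.var]⟩
          (hm'.congr fun a j => by rw [Function.update_of_ne (by simp)])
          (fun y hy => by
            rw [hs'' _ (by simp) (by rintro h; simp at h; subst h; exact hw.1 hy),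
              hb y (Or.inr hy)])
        refine ⟨s₂, (runs_pop _ _).seq hr₂, ?_, hm₂, fun k hk hk' => ?_⟩
        · rw [hs₂ _ (by simp), Function.update_self, List.length_tail]
          omega
        · rw [hs₂ k hk, hs'' k hk hk'])
      (s := Function.update s (some (var x)) (s (some size)))
      ⟨by simp [he.size], hm.congr fun a j => by rw [Function.update_of_ne (by simp)],
        fun k _ hk => by rw [Function.update_of_ne hk]⟩
    refine ⟨s₁, (h₀.seq hr₁).mono ?_, hm₁, fun k hk => ?_⟩
    · simp only [cost, Polynomial.eval_add, Polynomial.eval_mul,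
        Polynomial.eval_X, Polynomial.eval_one, Polynomial.eval_ofNat]
      apply le_of_eq
      ring
    · by_cases hk' : k = some (var x)
      · subst hk'
        rw [hx]
        exact List.length_eq_zero_iff.1 (by omega)
      · exact hs₁ k hk hk'

end BitProg

/-! ### Reading the input and returning the answer -/

namespace BitProg

variable {V A : Type} [DecidableEq V] [DecidableEq A]

open StackProg WorkStack

/-- Read the input: its length to the size stack, its bits to the arrays `a₀` and `a₁`. -/
def load (a₀ a₁ : A) : StackProg (Cell (V := V) (A := A)) :=
  .seq (.loop none Option.isSome (.seq (.seq (.push (some size) true)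
    (.seq (.ite none (fun o => (o.map Prod.fst) == some true)
      (.push (some (mem a₀)) true) (.push (some (mem a₀)) false))
      (.ite none (fun o => (o.map Prod.snd) == some true)
      (.push (some (mem a₁)) true) (.push (some (mem a₁)) false)))) (.pop none)))
    (.seq (.push (some (mem a₀)) false) (.push (some (mem a₁)) false))

/-- The memory in which the input is stored in the arrays `a₀` and `a₁`. -/
def inputMem (a₀ a₁ : A) (w : List (Bool × Bool)) : A → List ℕ → Bool := fun a l =>
  match l with
  | [j] => if a = a₀ then (w[j]?.map Prod.fst).getD false
      else if a = a₁ then (w[j]?.map Prod.snd).getD false else false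
  | _ => false

/-- Reading reverses the input, so entry `j` lands at depth `N - 1 - j`, whereas the linear address
of `[j]` is `N - j`. The final `false` pushed on each array makes up the difference; it is the cell
with the empty address. -/
theorem runs_load {a₀ a₁ : A} (h : a₀ ≠ a₁) (w : List (Bool × Bool)) :
    ∃ s : ∀ k, List (Cell (V := V) (A := A) k),
      Runs (load a₀ a₁) (Function.update (fun _ => []) none w) s (8 * w.length + 3) ∧
      (s (some size)).length = w.length ∧ MemRep w.length (inputMem a₀ a₁ w) s ∧
      ∀ k, (∀ a, k ≠ some (mem a)) → k ≠ some size → s k = [] := by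
  obtain ⟨s, hr, _, hw, hsize, h₀, h₁, hs⟩ := runs_loop (k := none) (P := .seq (.seq
      (.push (some (size : WorkStack V A)) true)
      (.seq (.ite none (fun o => (o.map Prod.fst) == some true)
      (.push (some (mem a₀)) true) (.push (some (mem a₀)) false))
      (.ite none (fun o => (o.map Prod.snd) == some true)
      (.push (some (mem a₁)) true) (.push (some (mem a₁)) false)))) (.pop none))
    (T := 7) (L := w.length)
    (fun i (s : ∀ k, List (Cell (V := V) (A := A) k)) => (s none).length + i = w.length ∧
      s none = w.drop i ∧ (s (some size)).length = i ∧
      s (some (mem a₀)) = ((w.take i).map Prod.fst).reverse ∧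
      s (some (mem a₁)) = ((w.take i).map Prod.snd).reverse ∧
      ∀ k, k ≠ none → k ≠ some size → k ≠ some (mem a₀) → k ≠ some (mem a₁) → s k = [])
    (fun i s h => h.1)
    (fun i s hi ⟨hl, hw, hsize, h₀, h₁, hs⟩ => by
      have hc : ∀ (a : A) (f : Bool × Bool → Bool) (s : ∀ k, List (Cell (V := V) (A := A) k)),
          s none = w.drop i → Runs (.ite none (fun o => (o.map f) == some true)
            (.push (some (mem a)) true) (.push (some (mem a)) false)) s
            (Function.update s (some (mem a)) (f w[i] :: s (some (mem a)))) 2 := by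
        intro a f s hs
        apply runs_ite
        obtain ⟨b, hb⟩ : ∃ b : Bool, b = f w[i] := ⟨_, rfl⟩
        rw [hs, List.drop_eq_getElem_cons hi, List.head?_cons, Option.map_some, ← hb]
        clear hb
        cases b
        · exact runs_push (some (mem a)) false s
        · exact runs_push (some (mem a)) true s
      have htake := List.take_succ_eq_append_getElem hi
      refine ⟨_, (((runs_push (some size) true s).seq ((hc a₀ Prod.fst _ ?_).seq
        (hc a₁ Prod.snd _ ?_))).seq (runs_pop none _)).mono (by omega), ?_, ?_, ?_, ?_, ?_,
        fun k hk₁ hk₂ hk₃ hk₄ => ?_⟩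
      · simp [hw]
      · simp [hw]
      · simp; omega
      · simp [hw]
      · simp [hsize]
      · rw [htake, List.map_append, List.reverse_append]
        simp [h₀, h]
      · rw [htake, List.map_append, List.reverse_append]
        simp [h₁, h.symm]
      · simp [hk₁, hk₂, hk₃, hk₄, hs k hk₁ hk₂ hk₃ hk₄])
    (s := Function.update (fun _ => []) none w)
    ⟨by simp, by simp, by simp, by simp, by simp, fun k hk _ _ _ => by simp [hk]⟩
  rw [List.take_length] at h₀ h₁
  have hget : ∀ (f : Bool × Bool → Bool) (xs : List ℕ), (∀ x ∈ xs, x < w.length) →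
      (false :: (w.map f).reverse).getD
        (linearAddr w.length (xs.map fun x => w.length - 1 - x)) false =
      match xs with
      | [j] => (w[j]?.map f).getD false
      | _ => false := by
    intro f xs hxs
    match xs, hxs with
    | [], _ => simp [linearAddr]
    | [j], hj =>
      have hj := hj j (by simp)
      simp only [List.map_cons, List.map_nil, linearAddr, mul_zero, add_zero, List.getD_cons_succ]
      rw [List.getD_eq_getElem?_getD, List.getElem?_reverse (by simp; omega), List.length_map,
        List.getElem?_map, show w.length - 1 - (w.length - 1 - j) = j by omega]
    -- An address with two coordinates is at least `N + 2`, beyond the `N + 1` cells present.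
    | x :: y :: xs, h =>
      apply List.getD_eq_default
      simp only [List.map_cons, linearAddr, List.length_cons, List.length_reverse, List.length_map]
      nlinarith [Nat.zero_le (w.length - 1 - x), Nat.zero_le (w.length - 1 - y),
        Nat.zero_le ((w.length + 1) * linearAddr w.length (xs.map fun x => w.length - 1 - x))]
  have hr' := hr.seq ((runs_push (some (mem a₀)) false s).seq (runs_push (some (mem a₁)) false _))
  refine ⟨_, hr'.mono (by omega), by simp [hsize], ?_, fun k hk hk' => ?_⟩
  · intro a xs hxs
    by_cases ha₁ : a = a₁
    · subst ha₁
      rw [Function.update_self, Function.update_of_ne (by simpa using h.symm), h₁]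
      refine (hget Prod.snd xs hxs).trans ?_
      match xs with
      | [] => rfl
      | [j] => simp [inputMem, h.symm]
      | _ :: _ :: _ => rfl
    · by_cases ha₀ : a = a₀
      · subst ha₀
        rw [Function.update_of_ne (by simpa using h), Function.update_self, h₀]
        refine (hget Prod.fst xs hxs).trans ?_
        match xs with
        | [] => rfl
        | [j] => simp [inputMem]
        | _ :: _ :: _ => rfl
      · rw [Function.update_of_ne (by simpa using ha₁), Function.update_of_ne (by simpa using ha₀),
          hs _ (by simp) (by simp) (by simpa using ha₀) (by simpa using ha₁)]
        match xs with
        | [] => rfl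
        | [j] => simp [inputMem, ha₀, ha₁]
        | _ :: _ :: _ => rfl
  · rw [Function.update_of_ne (hk _), Function.update_of_ne (hk _)]
    by_cases hn : k = none
    · subst hn
      simpa using hw
    · exact hs k hn hk' (hk _) (hk _)

variable [Fintype V] [Fintype A]

/-- Run a program on the input and return the bit it leaves in `o`. -/
noncomputable def decider (P : BitProg V A) (a₀ a₁ o : A) : StackProg (Cell (V := V) (A := A)) :=
  .seq (load a₀ a₁) (.seq P.compile (.ite (some (mem o)) (fun o => o == some true)
    (.seq (clear Finset.univ.toList) (.push (some out) true))
    (.seq (clear Finset.univ.toList) (.push (some out) false))))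

/-- Loop programs over arrays of bits run in polynomial time on Turing machines. -/
theorem exists_machine {P : BitProg V A} (hP : P.WellScoped) {a₀ a₁ : A} (h : a₀ ≠ a₁) (o : A)
    {α : Type} (ea : α → List (Bool × Bool)) (hea : ∀ a, ea a ≠ []) :
    ∃ M : Turing.TM2ComputableInPolyTime ea Computability.encodeBool
      (fun a => P.eval (ea a).length (fun _ => (ea a).length - 1) (inputMem a₀ a₁ (ea a)) o []),
        ∀ k : M.tm.K, Finite (M.tm.Γ k) := by
  have hfin : ∀ k : Option (WorkStack V A), Finite (Cell k) := by
    rintro (_ | k)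
    · exact inferInstanceAs (Finite (Bool × Bool))
    · exact inferInstanceAs (Finite Bool)
  refine StackProg.exists_machine (decider P a₀ a₁ o) none (some out) ea
    (eb := Computability.encodeBool) _ (8 * Polynomial.X + 3 + P.cost +
      ((Finset.univ (α := Option (WorkStack V A))).card : Polynomial ℕ) *
        (2 * (9 * Polynomial.X + 3 + P.cost) + 1) + 3) fun a => ?_
  set w := ea a
  have hw : 0 < w.length := List.length_pos_iff.2 (hea a)
  obtain ⟨s, hr, hsize, hm, hs⟩ := runs_load (V := V) h w
  -- All variable stacks are empty, which encodes the value `w.length - 1`; this is meaningful only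
  -- for a nonempty input.
  have he : EnvRep w.length (fun _ => w.length - 1) s :=
    ⟨hsize, hs _ (by simp) (by simp), hs _ (by simp) (by simp), hs _ (by simp) (by simp),
      fun v => by rw [hs _ (by simp) (by simp)]; simp; omega⟩
  obtain ⟨s₁, hr₁, hm₁, hs₁⟩ := runs_compile P hP _ _ s he hm fun x _ => hs _ (by simp) (by simp)
  obtain ⟨s₂, hr₂, hs₂, _⟩ := runs_clear Finset.univ.toList s₁
  have hs₂ : s₂ = fun _ => [] := funext fun k => hs₂ k (by simp)
  -- The stack lengths, and with them the cost of clearing, are bounded by the length of the input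
  -- plus the time spent so far.
  have hlen : ∀ k, (s₁ k).length ≤ 9 * w.length + 3 + P.cost.eval w.length := by
    intro k
    obtain ⟨t, ht, hr⟩ := hr.seq hr₁
    have := hr.length_le k
    have h0 : (Function.update (fun k => ([] : List (Cell (V := V) (A := A) k))) none w k).length ≤
        w.length := by
      by_cases hk : k = none
      · subst hk; simp
      · simp [hk]
    omega
  have hsum : ((Finset.univ (α := Option (WorkStack V A))).toList.map
      fun k => 2 * (s₁ k).length + 1).sum ≤ (Finset.univ (α := Option (WorkStack V A))).card *
        (2 * (9 * w.length + 3 + P.cost.eval w.length) + 1) := by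
    refine (List.sum_le_card_nsmul _ (2 * (9 * w.length + 3 + P.cost.eval w.length) + 1) ?_).trans ?_
    · simp only [List.mem_map]
      rintro _ ⟨k, _, rfl⟩
      have := hlen k
      omega
    · simp
  have hout := hm₁ o [] (by simp)
  set b := P.eval w.length (fun _ => w.length - 1) (inputMem a₀ a₁ w) o []
  have hpush : ∀ b : Bool, Runs (.push (some (out : WorkStack V A)) b) s₂
      (Function.update (fun _ => []) (some out) (Computability.encodeBool b)) 1 := by
    intro b
    have := runs_push (some (out : WorkStack V A)) b s₂
    rwa [hs₂] at this ⊢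
  have hhead : ((s₁ (some (mem o))).head? == some true) = b := by
    rw [← hout]
    rcases s₁ (some (mem o)) with _ | ⟨_ | _, L⟩ <;> rfl
  refine (hr.seq (hr₁.seq (runs_ite (T := ((Finset.univ (α := Option (WorkStack V A))).toList.map
      fun k => 2 * (s₁ k).length + 1).sum + 1 + 1) ?_))).mono ?_
  · rw [hhead]
    cases b
    · exact hr₂.seq (hpush false)
    · exact hr₂.seq (hpush true)
  · simp only [Polynomial.eval_add, Polynomial.eval_mul, Polynomial.eval_X, Polynomial.eval_one,
      Polynomial.eval_ofNat, Polynomial.eval_natCast, Nat.cast_id]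
    omega

end BitProg

/-! ### Loop invariants and assignments of bit expressions -/

namespace BitProg

section

variable {V A : Type}

/-- Invariant rule for `iterUpTo`. -/
theorem iterUpTo_induction {M : Type} {f : ℕ → M → M} {m : M} {n : ℕ} (I : ℕ → M → Prop)
    (h₀ : I 0 m) (hs : ∀ i < n, ∀ m', I i m' → I (i + 1) (f i m')) : I n (iterUpTo f m n) := by
  suffices H : ∀ i ≤ n, I i (iterUpTo f m i) from H n le_rfl
  intro i
  induction i with
  | zero => exact fun _ => h₀
  | succ i ih => exact fun hi => hs i hi _ (ih (by omega))

/-- Bit expressions: decision diagrams over the bits of the memory. -/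
inductive Expr (V A : Type) : Type
  | const (b : Bool) : Expr V A
  | cond (a : A) (xs : List V) (e₁ e₂ : Expr V A) : Expr V A

/-- The value of a bit expression. -/
def Expr.val (ρ : V → ℕ) (m : A → List ℕ → Bool) : Expr V A → Bool
  | .const b => b
  | .cond a xs e₁ e₂ => if m a (xs.map ρ) then e₁.val ρ m else e₂.val ρ m

/-- The expression that reads a bit. -/
def Expr.read (a : A) (xs : List V) : Expr V A := .cond a xs (.const true) (.const false)

@[simp] theorem Expr.val_read (ρ : V → ℕ) (m : A → List ℕ → Bool) (a : A) (xs : List V) :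
    (Expr.read a xs).val ρ m = m a (xs.map ρ) := by
  simp [Expr.read, Expr.val]

/-- Assign the value of an expression to a bit. -/
def assign (a : A) (xs : List V) : Expr V A → BitProg V A
  | .const b => .set a xs b
  | .cond a' ys e₁ e₂ => .ite a' ys (assign a xs e₁) (assign a xs e₂)

theorem wellScoped_assign [DecidableEq V] [DecidableEq A] (a : A) (xs : List V) (e : Expr V A) :
    (assign a xs e).WellScoped ∧ (assign a xs e).bound = [] := by
  induction e with
  | const b => simp [assign, WellScoped, bound]
  | cond a' ys e₁ e₂ ih₁ ih₂ => simp [assign, WellScoped, bound, ih₁, ih₂]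

variable [DecidableEq V] [DecidableEq A]

theorem eval_assign (N : ℕ) (a : A) (xs : List V) (e : Expr V A) (ρ : V → ℕ)
    (m : A → List ℕ → Bool) : (assign a xs e).eval N ρ m = write m a (xs.map ρ) (e.val ρ m) := by
  induction e with
  | const b => rfl
  | cond a' ys e₁ e₂ ih₁ ih₂ =>
    simp only [assign, eval, Expr.val, ih₁, ih₂]
    split_ifs <;> rfl

theorem write_of_ne (m : A → List ℕ → Bool) {a a' : A} (l l' : List ℕ) (b : Bool) (h : a' ≠ a) :
    write m a l b a' l' = m a' l' := by
  simp [write, h]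

theorem write_same (m : A → List ℕ → Bool) (a : A) (l : List ℕ) (b : Bool) :
    write m a l b a l = b := by
  simp [write]

theorem write_of_ne_addr (m : A → List ℕ → Bool) (a a' : A) {l l' : List ℕ} (b : Bool)
    (h : l' ≠ l) : write m a l b a' l' = m a' l' := by
  simp [write, h]

theorem map_update {x : V} {xs : List V} (h : x ∉ xs) (ρ : V → ℕ) (i : ℕ) :
    xs.map (Function.update ρ x i) = xs.map ρ :=
  List.map_congr_left fun y hy => Function.update_of_ne (by rintro rfl; exact h hy) _ _

end

end BitProg

/-! ### Arithmetic on binary numbers and vectors of numbers -/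

namespace NMQC

/-- Loop variables of the decision procedure. -/
inductive Var : Type
  | k | i | b | j | c
  deriving DecidableEq

instance : Fintype Var :=
  ⟨{.k, .i, .b, .j, .c}, fun x => by cases x <;> decide⟩

/-- Arrays of the decision procedure. -/
inductive Arr : Type
  | value | level | tri | cur | tmp | carry | sum | target | gen | vec | acc | prev | basis
  | filled | accept
  deriving DecidableEq

instance : Fintype Arr :=
  ⟨{.value, .level, .tri, .cur, .tmp, .carry, .sum, .target, .gen, .vec, .acc, .prev, .basis,
    .filled, .accept}, fun x => by cases x <;> decide⟩

namespace Procedure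

open BitProg Var Arr

/-- The number with binary digits `m a (0 :: l), m a (1 :: l), …`. -/
def num (N : ℕ) (m : Arr → List ℕ → Bool) (a : Arr) (l : List ℕ) : BitVec N :=
  BitVec.ofFnLE fun c => m a (c.val :: l)

theorem getLsbD_num {N : ℕ} (m : Arr → List ℕ → Bool) (a : Arr) (l : List ℕ) {c : ℕ} (hc : c < N) :
    (num N m a l).getLsbD c = m a (c :: l) := by
  simp [num, hc]

theorem num_congr {N : ℕ} {m m' : Arr → List ℕ → Bool} {a a' : Arr} {l l' : List ℕ}
    (h : ∀ c < N, m a (c :: l) = m' a' (c :: l')) : num N m a l = num N m' a' l' :=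
  BitVec.eq_of_getLsbD_eq fun c hc => by rw [getLsbD_num _ _ _ hc, getLsbD_num _ _ _ hc, h c hc]

/-- Copy a number. -/
def copyNum (a : Arr) (xs : List Var) (a' : Arr) (ys : List Var) : BitProg Var Arr :=
  .loop c (assign a (c :: xs) (.read a' (c :: ys)))

/-- The head of an address is the index of the digit and the tail names the number, so the frame
condition exempts a whole tail. -/
theorem copyNum_spec {N : ℕ} {a a' : Arr} {xs ys : List Var} (ha : a' ≠ a) (hx : c ∉ xs)
    (hy : c ∉ ys) (ρ : Var → ℕ) (m : Arr → List ℕ → Bool) :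
    num N ((copyNum a xs a' ys).eval N ρ m) a (xs.map ρ) = num N m a' (ys.map ρ) ∧
    ∀ a₂ l, ¬(a₂ = a ∧ l.tail = xs.map ρ) → (copyNum a xs a' ys).eval N ρ m a₂ l = m a₂ l := by
  have h := iterUpTo_induction (n := N) (m := m)
    (f := fun i m => (assign a (c :: xs) (.read a' (c :: ys))).eval N (Function.update ρ c i) m)
    (fun i m' => (∀ i' < i, m' a (i' :: xs.map ρ) = m a' (i' :: ys.map ρ)) ∧
      ∀ a₂ l, ¬(a₂ = a ∧ l.tail = xs.map ρ) → m' a₂ l = m a₂ l)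
    ⟨fun _ h => absurd h (Nat.not_lt_zero _), fun _ _ _ => rfl⟩
    (fun i hi m' ⟨h₁, h₂⟩ => by
      simp only [eval_assign, Expr.val_read, List.map_cons, Function.update_self,
        map_update hx, map_update hy]
      refine ⟨fun i' hi' => ?_, fun a₂ l hl => ?_⟩
      · rcases Nat.lt_succ_iff_lt_or_eq.1 hi' with hlt | rfl
        · rw [write_of_ne_addr _ _ _ _ (by simp; omega), h₁ i' hlt]
        · rw [write_same, h₂ _ _ (by simp [ha])]
      · rw [write, if_neg (by rintro ⟨rfl, rfl⟩; simp at hl), h₂ a₂ l hl])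
  exact ⟨num_congr fun c hc => h.1 c hc, h.2⟩

/-- Add the second number to the first one. -/
def addNum (a : Arr) (xs : List Var) (a' : Arr) (ys : List Var) : BitProg Var Arr :=
  .seq (.set carry [] false) (.loop c (.seq
    (assign sum [] (.cond a (c :: xs)
      (.cond a' (c :: ys) (.cond carry [] (.const true) (.const false))
        (.cond carry [] (.const false) (.const true)))
      (.cond a' (c :: ys) (.cond carry [] (.const false) (.const true))
        (.cond carry [] (.const true) (.const false)))))
    (.seq (assign carry [] (.cond a (c :: xs)
      (.cond a' (c :: ys) (.const true) (.read carry []))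
      (.cond a' (c :: ys) (.read carry []) (.const false))))
      (assign a (c :: xs) (.read sum [])))))

/-- Ripple-carry addition in place, with the last carry dropped, hence modulo `2 ^ N`. The invariant
keeps the digits from `i` on at their old values. The sum bit waits in `sum` because the new carry
still needs the old digit. -/
theorem addNum_spec {N : ℕ} {a a' : Arr} {xs ys : List Var} (ha : a' ≠ a)
    (hac : a ≠ carry ∧ a ≠ sum) (hac' : a' ≠ carry ∧ a' ≠ sum) (hx : c ∉ xs)
    (hy : c ∉ ys) (ρ : Var → ℕ) (m : Arr → List ℕ → Bool) :
    num N ((addNum a xs a' ys).eval N ρ m) a (xs.map ρ) =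
      num N m a (xs.map ρ) + num N m a' (ys.map ρ) ∧
    ∀ a₂ l, a₂ ≠ carry → a₂ ≠ sum → ¬(a₂ = a ∧ l.tail = xs.map ρ) →
      (addNum a xs a' ys).eval N ρ m a₂ l = m a₂ l := by
  set X := num N m a (xs.map ρ)
  set Y := num N m a' (ys.map ρ)
  have h := iterUpTo_induction (n := N) (m := write m carry [] false)
    (f := fun i m => eval N (.seq
    (assign sum [] (.cond a (c :: xs)
      (.cond a' (c :: ys) (.cond carry [] (.const true) (.const false))
        (.cond carry [] (.const false) (.const true)))
      (.cond a' (c :: ys) (.cond carry [] (.const false) (.const true))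
        (.cond carry [] (.const true) (.const false)))))
    (.seq (assign carry [] (.cond a (c :: xs)
      (.cond a' (c :: ys) (.const true) (.read carry []))
      (.cond a' (c :: ys) (.read carry []) (.const false))))
      (assign a (c :: xs) (.read sum [])))) (Function.update ρ c i) m)
    (fun i m' => (∀ i' < i, m' a (i' :: xs.map ρ) = (X + Y).getLsbD i') ∧
      m' carry [] = BitVec.carry i X Y false ∧
      (∀ i', i ≤ i' → m' a (i' :: xs.map ρ) = m a (i' :: xs.map ρ)) ∧
      ∀ a₂ l, a₂ ≠ carry → a₂ ≠ sum → ¬(a₂ = a ∧ l.tail = xs.map ρ) → m' a₂ l = m a₂ l)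
    ⟨fun _ h => absurd h (Nat.not_lt_zero _), by rw [write_same, BitVec.carry_zero],
      fun _ _ => write_of_ne _ _ _ _ hac.1, fun _ _ h _ _ => write_of_ne _ _ _ _ h⟩
    (fun i hi m' ⟨h₁, h₂, h₃, h₄⟩ => by
      have ex : m' a (i :: xs.map ρ) = X.getLsbD i := by
        rw [h₃ i le_rfl]; exact (getLsbD_num _ _ _ hi).symm
      have ey : m' a' (i :: ys.map ρ) = Y.getLsbD i := by
        rw [h₄ _ _ hac'.1 hac'.2 (by simp [ha])]; exact (getLsbD_num _ _ _ hi).symm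
      simp only [eval, eval_assign, Expr.val_read, Expr.val, List.map_cons, List.map_nil,
        Function.update_self, map_update hx, map_update hy, write_same,
        write_of_ne _ _ _ _ hac.2, write_of_ne _ _ _ _ hac'.2, write_of_ne _ _ _ _ hac.1.symm,
        write_of_ne _ _ _ _ (show carry ≠ sum by decide),
        write_of_ne _ _ _ _ (show sum ≠ carry by decide), ex, ey, h₂]
      refine ⟨fun i' hi' => ?_, ?_, fun i' hi' => ?_, fun a₂ l hc hs hl => ?_⟩
      · rcases Nat.lt_succ_iff_lt_or_eq.1 hi' with hlt | rfl
        · rw [write_of_ne_addr _ _ _ _ (by simp; omega), write_of_ne _ _ _ _ hac.1,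
            write_of_ne _ _ _ _ hac.2, h₁ i' hlt]
        · rw [write_same, BitVec.getLsbD_add hi]
          cases X.getLsbD i' <;> cases Y.getLsbD i' <;> cases BitVec.carry i' X Y false <;> rfl
      · rw [BitVec.carry_succ]
        cases X.getLsbD i <;> cases Y.getLsbD i <;> cases BitVec.carry i X Y false <;> rfl
      · rw [write_of_ne_addr _ _ _ _ (by simp; omega), write_of_ne _ _ _ _ hac.1,
            write_of_ne _ _ _ _ hac.2, h₃ i' (by omega)]
      · rw [write, if_neg (by rintro ⟨rfl, rfl⟩; simp at hl), write_of_ne _ _ _ _ hc,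
          write_of_ne _ _ _ _ hs, h₄ a₂ l hc hs hl])
  refine ⟨BitVec.eq_of_getLsbD_eq fun c hc => ?_, h.2.2.2⟩
  rw [getLsbD_num _ _ _ hc]
  exact h.1 c hc

/-- Copy a vector of numbers. -/
def copyVec (a : Arr) (xs : List Var) (a' : Arr) (ys : List Var) : BitProg Var Arr :=
  .loop j (copyNum a (j :: xs) a' (j :: ys))

theorem copyVec_spec {N : ℕ} {a a' : Arr} {xs ys : List Var} (ha : a' ≠ a)
    (hx : c ∉ xs ∧ j ∉ xs) (hy : c ∉ ys ∧ j ∉ ys) (ρ : Var → ℕ) (m : Arr → List ℕ → Bool) :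
    (∀ i < N, num N ((copyVec a xs a' ys).eval N ρ m) a (i :: xs.map ρ) =
      num N m a' (i :: ys.map ρ)) ∧
    ∀ a₂ l, ¬(a₂ = a ∧ l.tail.tail = xs.map ρ) →
      (copyVec a xs a' ys).eval N ρ m a₂ l = m a₂ l := by
  refine iterUpTo_induction (n := N) (m := m)
    (f := fun i m => (copyNum a (j :: xs) a' (j :: ys)).eval N (Function.update ρ j i) m)
    (fun i m' => (∀ i' < i, num N m' a (i' :: xs.map ρ) = num N m a' (i' :: ys.map ρ)) ∧
      ∀ a₂ l, ¬(a₂ = a ∧ l.tail.tail = xs.map ρ) → m' a₂ l = m a₂ l)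
    ⟨fun _ h => absurd h (Nat.not_lt_zero _), fun _ _ _ => rfl⟩
    (fun i hi m' ⟨h₁, h₂⟩ => ?_)
  obtain ⟨s₁, s₂⟩ := copyNum_spec (N := N) (xs := j :: xs) (ys := j :: ys) ha (by simp [hx])
    (by simp [hy]) (Function.update ρ j i) m'
  simp only [List.map_cons, Function.update_self, map_update hx.2, map_update hy.2] at s₁ s₂
  refine ⟨fun i' hi' => ?_, fun a₂ l hl => ?_⟩
  · rcases Nat.lt_succ_iff_lt_or_eq.1 hi' with hlt | rfl
    · rw [← h₁ i' hlt]
      exact num_congr fun c _ => s₂ _ _ (by simp; omega)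
    · rw [s₁]
      exact num_congr fun c _ => h₂ _ _ (by simp [ha])
  · rw [s₂ _ _ (by rintro ⟨rfl, h⟩; simp [h] at hl), h₂ _ _ hl]

/-- Add the second vector to the first one. -/
def addVec (a : Arr) (xs : List Var) (a' : Arr) (ys : List Var) : BitProg Var Arr :=
  .loop j (addNum a (j :: xs) a' (j :: ys))

/-- The sum is formed in place, so the invariant must also record that the coordinates not yet
visited are unchanged. -/
theorem addVec_spec {N : ℕ} {a a' : Arr} {xs ys : List Var} (ha : a' ≠ a)
    (hac : a ≠ carry ∧ a ≠ sum) (hac' : a' ≠ carry ∧ a' ≠ sum)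
    (hx : c ∉ xs ∧ j ∉ xs) (hy : c ∉ ys ∧ j ∉ ys) (ρ : Var → ℕ) (m : Arr → List ℕ → Bool) :
    (∀ i < N, num N ((addVec a xs a' ys).eval N ρ m) a (i :: xs.map ρ) =
      num N m a (i :: xs.map ρ) + num N m a' (i :: ys.map ρ)) ∧
    ∀ a₂ l, a₂ ≠ carry → a₂ ≠ sum → ¬(a₂ = a ∧ l.tail.tail = xs.map ρ) →
      (addVec a xs a' ys).eval N ρ m a₂ l = m a₂ l := by
  have h := iterUpTo_induction (n := N) (m := m)
    (f := fun i m => (addNum a (j :: xs) a' (j :: ys)).eval N (Function.update ρ j i) m)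
    (fun i m' => (∀ i' < i, num N m' a (i' :: xs.map ρ) =
        num N m a (i' :: xs.map ρ) + num N m a' (i' :: ys.map ρ)) ∧
      (∀ i', i ≤ i' → num N m' a (i' :: xs.map ρ) = num N m a (i' :: xs.map ρ)) ∧
      ∀ a₂ l, a₂ ≠ carry → a₂ ≠ sum → ¬(a₂ = a ∧ l.tail.tail = xs.map ρ) → m' a₂ l = m a₂ l)
    ⟨fun _ h => absurd h (Nat.not_lt_zero _), fun _ _ => rfl, fun _ _ _ _ _ => rfl⟩
    (fun i hi m' ⟨h₁, h₂, h₃⟩ => by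
      obtain ⟨s₁, s₂⟩ := addNum_spec (N := N) (xs := j :: xs) (ys := j :: ys) ha hac hac'
        (by simp [hx]) (by simp [hy]) (Function.update ρ j i) m'
      simp only [List.map_cons, Function.update_self, map_update hx.2, map_update hy.2] at s₁ s₂
      refine ⟨fun i' hi' => ?_, fun i' hi' => ?_, fun a₂ l hc hs hl => ?_⟩
      · rcases Nat.lt_succ_iff_lt_or_eq.1 hi' with hlt | rfl
        · rw [← h₁ i' hlt]
          exact num_congr fun c _ => s₂ _ _ hac.1 hac.2 (by simp; omega)
        · rw [s₁, h₂ _ le_rfl]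
          congr 1
          exact num_congr fun c _ => h₃ _ _ hac'.1 hac'.2 (by simp [ha])
      · rw [← h₂ i' (by omega)]
        exact num_congr fun c _ => s₂ _ _ hac.1 hac.2 (by simp; omega)
      · rw [s₂ _ _ hc hs (by rintro ⟨rfl, h⟩; simp [h] at hl), h₃ _ _ hc hs hl])
  exact ⟨h.1, h.2.2⟩

end Procedure

end NMQC

/-! ### Sifting in an abelian group along a filtration with factors of order two -/

namespace Sift

variable {M : Type} [AddCommGroup M]

/-- A descending chain of subgroups with factors of order at most two, all containing `Z`. -/
structure IsFiltration (G : ℕ → AddSubgroup M) (Z : AddSubgroup M) : Prop where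
  anti : ∀ p, G (p + 1) ≤ G p
  add_mem : ∀ p x y, x ∈ G p → x ∉ G (p + 1) → y ∈ G p → y ∉ G (p + 1) → x + y ∈ G (p + 1)
  le : ∀ p, Z ≤ G p

/-- The subgroup generated by `Z` and the table entries from position `q` on. -/
def span (Z : AddSubgroup M) (tbl : ℕ → Option M) (q : ℕ) : AddSubgroup M :=
  AddSubgroup.closure {x | ∃ p, q ≤ p ∧ tbl p = some x} ⊔ Z

variable {G : ℕ → AddSubgroup M} {Z : AddSubgroup M} {tbl : ℕ → Option M}

theorem mem_span {p q : ℕ} {x : M} (h : q ≤ p) (hx : tbl p = some x) : x ∈ span Z tbl q :=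
  AddSubgroup.mem_sup_left (AddSubgroup.subset_closure ⟨p, h, hx⟩)

theorem span_le {q : ℕ} {H : AddSubgroup M} (hZ : Z ≤ H)
    (h : ∀ p x, q ≤ p → tbl p = some x → x ∈ H) : span Z tbl q ≤ H :=
  sup_le ((AddSubgroup.closure_le H).2 fun x ⟨p, hp, hx⟩ => h p x hp hx) hZ

theorem le_span (q : ℕ) : Z ≤ span Z tbl q := le_sup_right

/-- The state while an element is sifted: `w` is its residue before position `q`. -/
structure Partial (G : ℕ → AddSubgroup M) (Z : AddSubgroup M) (tbl : ℕ → Option M) (q : ℕ)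
    (w : M) : Prop where
  entry : ∀ p x, tbl p = some x → x ∈ G p ∧ x ∉ G (p + 1)
  residue : w ∈ G q
  double_lt : ∀ p x, p < q → tbl p = some x →
    x + x ∈ span Z tbl (p + 1) ⊔ AddSubgroup.zmultiples w
  double_ge : ∀ p x, q ≤ p → tbl p = some x → x + x ∈ span Z tbl (p + 1)

/-- A table along which every element of its span can be sifted to `Z`. -/
structure Complete (G : ℕ → AddSubgroup M) (Z : AddSubgroup M) (tbl : ℕ → Option M) : Prop where
  entry : ∀ p x, tbl p = some x → x ∈ G p ∧ x ∉ G (p + 1)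
  double : ∀ p x, tbl p = some x → x + x ∈ span Z tbl (p + 1)

theorem Complete.start (h : Complete G Z tbl) {w : M} (hw : w ∈ G 0) : Partial G Z tbl 0 w :=
  ⟨h.entry, hw, fun _ _ h => absurd h (Nat.not_lt_zero _), fun p x _ => h.double p x⟩

/-- During sifting, the double of an entry before `q` may involve the residue, a debt recorded in
`double_lt`. A residue in `Z` settles it, because every span contains `Z`. -/
theorem Partial.complete {q : ℕ} {w : M} (h : Partial G Z tbl q w) (hw : w ∈ Z) :
    Complete G Z tbl := by
  refine ⟨h.entry, fun p x hx => ?_⟩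
  rcases lt_or_ge p q with hp | hp
  · have : span Z tbl (p + 1) ⊔ AddSubgroup.zmultiples w ≤ span Z tbl (p + 1) :=
      sup_le le_rfl ((AddSubgroup.zmultiples_le).2 (le_span _ hw))
    exact this (h.double_lt p x hp hx)
  · exact h.double_ge p x hp hx

theorem Partial.skip {q : ℕ} {w : M} (h : Partial G Z tbl q w) (hw : w ∈ G (q + 1)) :
    Partial G Z tbl (q + 1) w := by
  refine ⟨h.entry, hw, fun p x hp hx => ?_, fun p x hp => h.double_ge p x (by omega)⟩
  rcases Nat.lt_succ_iff_lt_or_eq.1 hp with hp | rfl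
  · exact h.double_lt p x hp hx
  · exact AddSubgroup.mem_sup_left (h.double_ge p x le_rfl hx)

/-- For `p ≤ q` the entry `x` lies in the span from `p` on, so replacing `w` by `w + x` changes none
of the subgroups generated by such a span and the residue. The factor of order two pushes `w + x`
one step down the chain. -/
theorem Partial.add (hG : IsFiltration G Z) {q : ℕ} {w x : M} (h : Partial G Z tbl q w)
    (hw : w ∉ G (q + 1)) (hx : tbl q = some x) :
    Partial G Z tbl (q + 1) (w + x) ∧
      span Z tbl 0 ⊔ AddSubgroup.zmultiples (w + x) =
        span Z tbl 0 ⊔ AddSubgroup.zmultiples w := by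
  have hxq := h.entry q x hx
  have key : ∀ p ≤ q, span Z tbl p ⊔ AddSubgroup.zmultiples (w + x) =
      span Z tbl p ⊔ AddSubgroup.zmultiples w := by
    intro p hp
    have hxs : x ∈ span Z tbl p := mem_span hp hx
    apply le_antisymm
    · refine sup_le le_sup_left ((AddSubgroup.zmultiples_le).2 ?_)
      exact add_mem (AddSubgroup.mem_sup_right (AddSubgroup.mem_zmultiples w))
        (AddSubgroup.mem_sup_left hxs)
    · refine sup_le le_sup_left ((AddSubgroup.zmultiples_le).2 ?_)
      have := sub_mem (AddSubgroup.mem_sup_right (AddSubgroup.mem_zmultiples (w + x)))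
        (AddSubgroup.mem_sup_left (T := AddSubgroup.zmultiples (w + x)) hxs)
      rwa [add_sub_cancel_right] at this
  refine ⟨⟨h.entry, hG.add_mem q w x h.residue hw hxq.1 hxq.2, fun p y hp hy => ?_,
    fun p y hp => h.double_ge p y (by omega)⟩, key 0 (Nat.zero_le q)⟩
  rcases Nat.lt_succ_iff_lt_or_eq.1 hp with hp | rfl
  · rw [key (p + 1) hp]
    exact h.double_lt p y hp hy
  · exact AddSubgroup.mem_sup_left (h.double_ge p y le_rfl hy)

/-- Debts of earlier entries that involve `w` are paid, since `w` is now an entry at a later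
position. The only new debt is the double of `w` itself, which becomes the residue. The generated
subgroup is unchanged, as `w` stays in it and `w + w` is a multiple of `w`. -/
theorem Partial.place (hG : IsFiltration G Z) {q : ℕ} {w : M} (h : Partial G Z tbl q w)
    (hw : w ∉ G (q + 1)) (hq : tbl q = none) :
    Partial G Z (Function.update tbl q (some w)) (q + 1) (w + w) ∧
      span Z (Function.update tbl q (some w)) 0 ⊔ AddSubgroup.zmultiples (w + w) =
        span Z tbl 0 ⊔ AddSubgroup.zmultiples w := by
  set tbl' := Function.update tbl q (some w) with htbl
  have hq' : tbl' q = some w := Function.update_self ..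
  have hle : ∀ p, span Z tbl p ≤ span Z tbl' p := by
    refine fun p => span_le (le_span p) fun p' x hp' hx => mem_span hp' ?_
    rw [htbl, Function.update_of_ne (by rintro rfl; simp [hq] at hx), hx]
  refine ⟨⟨fun p x hx => ?_, hG.add_mem q w w h.residue hw h.residue hw, fun p x hp hx => ?_,
    fun p x hp hx => ?_⟩, ?_⟩
  · by_cases hpq : p = q
    · subst hpq
      rw [hq', Option.some.injEq] at hx
      exact hx ▸ ⟨h.residue, hw⟩
    · rw [htbl, Function.update_of_ne hpq] at hx
      exact h.entry p x hx
  · rcases Nat.lt_succ_iff_lt_or_eq.1 hp with hp | rfl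
    · rw [htbl, Function.update_of_ne hp.ne] at hx
      refine AddSubgroup.mem_sup_left (sup_le (hle (p + 1)) ?_ (h.double_lt p x hp hx))
      exact (AddSubgroup.zmultiples_le).2 (mem_span hp hq')
    · rw [hq', Option.some.injEq] at hx
      subst hx
      exact AddSubgroup.mem_sup_right (AddSubgroup.mem_zmultiples _)
  · rw [htbl, Function.update_of_ne (by omega)] at hx
    exact hle _ (h.double_ge p x (by omega) hx)
  · apply le_antisymm
    · refine sup_le (span_le (le_sup_of_le_left (le_span 0)) fun p x _ hx => ?_) ?_
      · by_cases hpq : p = q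
        · subst hpq
          rw [hq', Option.some.injEq] at hx
          exact hx ▸ AddSubgroup.mem_sup_right (AddSubgroup.mem_zmultiples _)
        · rw [htbl, Function.update_of_ne hpq] at hx
          exact AddSubgroup.mem_sup_left (mem_span (Nat.zero_le p) hx)
      · have := AddSubgroup.mem_sup_right (S := span Z tbl 0) (AddSubgroup.mem_zmultiples w)
        exact (AddSubgroup.zmultiples_le).2 (add_mem this this)
    · refine sup_le (le_sup_of_le_left (hle 0)) ((AddSubgroup.zmultiples_le).2 ?_)
      exact AddSubgroup.mem_sup_left (mem_span (Nat.zero_le q) hq')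

/-- An element of the span that lies in `G q` is in the span of the entries from `q` on. -/
theorem Complete.mem_span_of_mem (hG : IsFiltration G Z) (h : Complete G Z tbl) {x : M}
    (hx : x ∈ span Z tbl 0) : ∀ q, x ∈ G q → x ∈ span Z tbl q
  | 0, _ => hx
  | q + 1, hq => by
    have ih := h.mem_span_of_mem hG hx q (hG.anti q hq)
    have hanti : ∀ p, q + 1 ≤ p → G p ≤ G (q + 1) := fun p hp =>
      antitone_nat_of_succ_le hG.anti hp
    have hle : span Z tbl (q + 1) ≤ G (q + 1) :=
      span_le (hG.le _) fun p y hp hy => hanti p hp (h.entry p y hy).1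
    cases ht : tbl q with
    | none =>
      refine span_le (le_span _) (fun p y hp hy => mem_span (p := p) ?_ hy) ih
      rcases hp.lt_or_eq with hp | rfl
      · exact hp
      · simp [ht] at hy
    | some t =>
      have ht' := h.entry q t ht
      have : span Z tbl q ≤ span Z tbl (q + 1) ⊔ AddSubgroup.zmultiples t := by
        refine span_le (le_sup_of_le_left (le_span _)) fun p y hp hy => ?_
        rcases hp.lt_or_eq with hp | rfl
        · exact AddSubgroup.mem_sup_left (mem_span hp hy)
        · rw [ht, Option.some.injEq] at hy
          exact hy ▸ AddSubgroup.mem_sup_right (AddSubgroup.mem_zmultiples t)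
      obtain ⟨y, hy, z, hz, rfl⟩ := AddSubgroup.mem_sup.1 (this ih)
      obtain ⟨n, rfl⟩ := AddSubgroup.mem_zmultiples_iff.1 hz
      refine add_mem hy ?_
      have hn : n • t ∈ G (q + 1) := by
        have := sub_mem hq (hle hy)
        rwa [add_sub_cancel_left] at this
      have h2 := h.double q t ht
      -- The multiple `n • t` lies in `G (q + 1)`, and so does `t + t`. An odd `n` would put `t`
      -- there as well, contrary to its position; for even `n` completeness applies to `t + t`.
      rcases Int.even_or_odd n with ⟨k, rfl⟩ | ⟨k, rfl⟩
      · rw [add_smul, ← smul_add]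
        exact zsmul_mem h2 k
      · refine absurd ?_ ht'.2
        have := sub_mem hn (zsmul_mem (hle h2) k)
        rwa [add_smul, mul_comm, mul_smul, two_smul, one_smul, add_sub_cancel_left] at this

/-- The state while membership of `τ` is tested. -/
def Testing (G : ℕ → AddSubgroup M) (Z : AddSubgroup M) (tbl : ℕ → Option M) (τ : M) (q : ℕ)
    (ok : Bool) (w : M) : Prop :=
  if ok then w ∈ G q ∧ w - τ ∈ span Z tbl 0 else τ ∉ span Z tbl 0

/-- If `τ` were in the span, so would be `w`, and then `w` would be a combination of the entries
from `q` on. With slot `q` empty these all lie in `G (q + 1)`. -/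
theorem Testing.reject (hG : IsFiltration G Z) (h : Complete G Z tbl) {τ w : M} {q : ℕ}
    (ht : Testing G Z tbl τ q true w) (hw : w ∉ G (q + 1)) (hq : tbl q = none) :
    τ ∉ span Z tbl 0 := by
  simp only [Testing, if_true] at ht
  intro hτ
  have hwS : w ∈ span Z tbl 0 := by simpa using add_mem ht.2 hτ
  have := h.mem_span_of_mem hG hwS q ht.1
  refine hw (span_le (hG.le _) (fun p y hp hy => ?_) this)
  rcases hp.lt_or_eq with hp | rfl
  · exact antitone_nat_of_succ_le hG.anti hp (h.entry p y hy).1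
  · simp [hq] at hy

theorem Testing.add (hG : IsFiltration G Z) (h : Complete G Z tbl) {τ w x : M} {q : ℕ}
    (ht : Testing G Z tbl τ q true w) (hw : w ∉ G (q + 1)) (hq : tbl q = some x) :
    Testing G Z tbl τ (q + 1) true (w + x) := by
  simp only [Testing, if_true] at ht ⊢
  have hx := h.entry q x hq
  refine ⟨hG.add_mem q w x ht.1 hw hx.1 hx.2, ?_⟩
  rw [add_sub_right_comm]
  exact add_mem ht.2 (mem_span (Nat.zero_le q) hq)

theorem Testing.result {τ w : M} {q : ℕ} {ok : Bool} (ht : Testing G Z tbl τ q ok w)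
    (hq : G q ≤ Z) : ok = true ↔ τ ∈ span Z tbl 0 := by
  cases ok with
  | false => simpa [Testing] using ht
  | true =>
    simp only [Testing, if_true] at ht
    simpa using sub_mem (le_span 0 (hq ht.1)) ht.2

end Sift

/-! ### Sifting vectors of numbers bit by bit -/

namespace NMQC

namespace Procedure

open BitProg Var Arr

/-- The number of zero bits at position `p` of the sweep that are required at coordinate `i`. -/
def depth (N p i : ℕ) : ℕ := min N (p - i * N)

theorem depth_le {N : ℕ} (p i : ℕ) : depth N p i ≤ N := min_le_left _ _

/-- Vectors whose relevant bits before position `p` vanish; coordinate `i` is relevant if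
`lev i = false`. -/
def filtration (N : ℕ) (lev : ℕ → Bool) (p : ℕ) : AddSubgroup (Fin N → BitVec N) where
  carrier := {w | ∀ i : Fin N, lev i = false → 2 ^ depth N p i ∣ (w i).toNat}
  zero_mem' := fun i _ => by simp
  add_mem' := fun {x y} hx hy i hi => by
    rw [Pi.add_apply, BitVec.toNat_add,
      Nat.dvd_mod_iff (pow_dvd_pow 2 (depth_le _ _))]
    exact dvd_add (hx i hi) (hy i hi)
  neg_mem' := fun {x} hx i hi => by
    rw [Pi.neg_apply, BitVec.toNat_neg,
      Nat.dvd_mod_iff (pow_dvd_pow 2 (depth_le _ _))]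
    exact Nat.dvd_sub (pow_dvd_pow 2 (depth_le _ _)) (hx i hi)

/-- Vectors whose relevant coordinates vanish. -/
def irrelevant (N : ℕ) (lev : ℕ → Bool) : AddSubgroup (Fin N → BitVec N) where
  carrier := {w | ∀ i : Fin N, lev i = false → w i = 0}
  zero_mem' := fun i _ => rfl
  add_mem' := fun {x y} hx hy i hi => by simp [hx i hi, hy i hi]
  neg_mem' := fun {x} hx i hi => by simp [hx i hi]

variable {N : ℕ} {lev : ℕ → Bool}

theorem mem_filtration {p : ℕ} {w : Fin N → BitVec N} : w ∈ filtration N lev p ↔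
    ∀ i : Fin N, lev i = false → 2 ^ depth N p i ∣ (w i).toNat := Iff.rfl

/-- Truncated subtraction and the minimum keep `depth` constant except while `p` runs through the
block of `N` positions belonging to coordinate `i`. -/
theorem depth_succ {p i : ℕ} (h : depth N (p + 1) i ≠ depth N p i) :
    i * N ≤ p ∧ p < i * N + N ∧ depth N p i = p - i * N ∧ depth N (p + 1) i = p - i * N + 1 := by
  simp only [depth] at *
  omega

theorem eq_of_block {i i' p : ℕ} (h₁ : i * N ≤ p) (h₂ : p < i * N + N) (h₁' : i' * N ≤ p)
    (h₂' : p < i' * N + N) : i = i' := by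
  rcases lt_trichotomy i i' with h | h | h
  · have := Nat.mul_le_mul_right N (Nat.succ_le_of_lt h)
    rw [Nat.succ_mul] at this
    omega
  · exact h
  · have := Nat.mul_le_mul_right N (Nat.succ_le_of_lt h)
    rw [Nat.succ_mul] at this
    omega

theorem two_pow_succ_dvd_add {e x y : ℕ} (hx : 2 ^ e ∣ x) (hx' : ¬2 ^ (e + 1) ∣ x)
    (hy : 2 ^ e ∣ y) (hy' : ¬2 ^ (e + 1) ∣ y) : 2 ^ (e + 1) ∣ x + y := by
  obtain ⟨x, rfl⟩ := hx
  obtain ⟨y, rfl⟩ := hy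
  have hp : 0 < 2 ^ e := by positivity
  rw [pow_succ, Nat.mul_dvd_mul_iff_left hp] at hx' hy'
  rw [pow_succ, ← mul_add, Nat.mul_dvd_mul_iff_left hp]
  omega

/-- A step from `p` to `p + 1` imposes at most one new condition, on a single bit of a single
coordinate. Two vectors violating it have that bit set and all lower bits of this coordinate zero,
so the bit cancels in their sum. -/
theorem isFiltration : Sift.IsFiltration (filtration N lev) (irrelevant N lev) where
  anti p w hw i hi := (pow_dvd_pow 2 (by simp only [depth]; omega)).trans (hw i hi)
  add_mem p x y hx hx' hy hy' := by
    -- A violation at `p + 1` can only occur at a coordinate whose depth has just grown, and the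
    -- blocks leave just one such coordinate.
    have key : ∀ x : Fin N → BitVec N, x ∈ filtration N lev p → x ∉ filtration N lev (p + 1) →
        ∀ i : Fin N, depth N (p + 1) i ≠ depth N p i → ¬2 ^ depth N (p + 1) i ∣ (x i).toNat := by
      intro x hx hx' i hi
      simp only [mem_filtration, not_forall] at hx'
      obtain ⟨i', hl, h⟩ := hx'
      have hi' : depth N (p + 1) i' ≠ depth N p i' := fun he => h (he ▸ hx i' hl)
      obtain ⟨h₁, h₂, _⟩ := depth_succ hi
      obtain ⟨h₁', h₂', _⟩ := depth_succ hi'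
      rwa [Fin.ext (eq_of_block h₁ h₂ h₁' h₂')]
    intro i hi
    rw [Pi.add_apply, BitVec.toNat_add, Nat.dvd_mod_iff (pow_dvd_pow 2 (depth_le _ _))]
    by_cases he : depth N (p + 1) i = depth N p i
    · rw [he]
      exact dvd_add (hx i hi) (hy i hi)
    · have h₁ := key x hx hx' i he
      have h₂ := key y hy hy' i he
      have h₃ := hx i hi
      have h₄ := hy i hi
      obtain ⟨_, _, e₁, e₂⟩ := depth_succ he
      rw [e₁] at h₃ h₄
      rw [e₂] at h₁ h₂ ⊢
      exact two_pow_succ_dvd_add h₃ h₁ h₄ h₂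
  le p w hw i hi := by rw [hw i hi]; simp

theorem mem_filtration_zero (w : Fin N → BitVec N) : w ∈ filtration N lev 0 := fun i _ => by
  simp [depth]

theorem filtration_top_le : filtration N lev (N * N) ≤ irrelevant N lev := fun w hw i hi => by
  have h := hw i hi
  have : depth N (N * N) i = N := by
    have := Nat.mul_le_mul_right N (Nat.succ_le_of_lt i.isLt)
    rw [Nat.succ_mul] at this
    simp only [depth]
    omega
  rw [this] at h
  exact BitVec.eq_of_toNat_eq (by simpa using Nat.eq_zero_of_dvd_of_lt h (w i).isLt)

/-- Allowed levels impose no condition, so the sweep passes over their blocks without looking at the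
bits. -/
theorem filtration_succ_of_level {i b : ℕ} (hb : b < N) (h : lev i = true) :
    filtration N lev (i * N + b) ≤ filtration N lev (i * N + b + 1) := fun w hw i' hi' => by
  by_cases he : depth N (i * N + b + 1) i' = depth N (i * N + b) i'
  · rw [he]
    exact hw i' hi'
  · obtain ⟨h₁, h₂, _⟩ := depth_succ he
    rw [eq_of_block h₁ h₂ (i' := i) (by omega) (by omega), h] at hi'
    exact absurd hi' (by simp)

theorem testBit_iff {n b : ℕ} (h : 2 ^ b ∣ n) : n.testBit b = true ↔ ¬2 ^ (b + 1) ∣ n := by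
  obtain ⟨k, rfl⟩ := h
  have hp : 0 < 2 ^ b := by positivity
  rw [pow_succ, Nat.mul_dvd_mul_iff_left hp, Nat.testBit_eq_decide_div_mod_eq,
    Nat.mul_div_cancel_left _ hp, decide_eq_true_iff]
  omega

/-- The lower bits of the current coordinate are already zero, so the next bit alone decides. This
turns each case distinction of the abstract sifting into the reading of one bit. -/
theorem notMem_filtration_succ {w : Fin N → BitVec N} {i b : ℕ} (hi : i < N) (hb : b < N)
    (hw : w ∈ filtration N lev (i * N + b)) (h : lev i = false) :
    w ∉ filtration N lev (i * N + b + 1) ↔ (w ⟨i, hi⟩).getLsbD b = true := by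
  have hd : depth N (i * N + b) i = b := by simp only [depth]; omega
  have hd' : depth N (i * N + b + 1) i = b + 1 := by simp only [depth]; omega
  have h₀ := hw ⟨i, hi⟩ h
  rw [hd] at h₀
  rw [BitVec.getLsbD, testBit_iff h₀, not_iff_not]
  refine ⟨fun hm => by simpa [hd'] using hm ⟨i, hi⟩ h, fun hm i' hi' => ?_⟩
  by_cases he : depth N (i * N + b + 1) i' = depth N (i * N + b) i'
  · rw [he]
    exact hw i' hi'
  · obtain ⟨h₁, h₂, _⟩ := depth_succ he
    have : i' = ⟨i, hi⟩ := Fin.ext (eq_of_block h₁ h₂ (i' := i) (by omega) (by omega))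
    subst this
    rwa [hd']

/-- The vector stored in array `a` with address suffix `l`. -/
def vecAt (N : ℕ) (m : Arr → List ℕ → Bool) (a : Arr) (l : List ℕ) : Fin N → BitVec N :=
  fun i => num N m a (i.val :: l)

theorem vecAt_congr {m m' : Arr → List ℕ → Bool} {a a' : Arr} {l l' : List ℕ}
    (h : ∀ c i, m a (c :: i :: l) = m' a' (c :: i :: l')) : vecAt N m a l = vecAt N m' a' l' :=
  funext fun i => num_congr fun c _ => h c i

/-- The table of basis vectors found so far. -/
def table (N : ℕ) (m : Arr → List ℕ → Bool) (p : ℕ) : Option (Fin N → BitVec N) :=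
  if p < N * N ∧ m filled [p % N, p / N] = true then some (vecAt N m basis [p % N, p / N]) else none

theorem position_lt {i b : ℕ} (hi : i < N) (hb : b < N) :
    i * N + b < N * N ∧ (i * N + b) % N = b ∧ (i * N + b) / N = i := by
  refine ⟨?_, ?_, ?_⟩
  · have := Nat.mul_le_mul_right N (Nat.succ_le_of_lt hi)
    rw [Nat.succ_mul] at this
    omega
  · rw [mul_comm, Nat.mul_add_mod, Nat.mod_eq_of_lt hb]
  · rw [mul_comm, Nat.mul_add_div (by omega), Nat.div_eq_of_lt hb, add_zero]

theorem table_position {i b : ℕ} (hi : i < N) (hb : b < N) (m : Arr → List ℕ → Bool) :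
    table N m (i * N + b) = if m filled [b, i] = true then some (vecAt N m basis [b, i]) else none := by
  obtain ⟨h₁, h₂, h₃⟩ := position_lt hi hb
  simp [table, h₁, h₂, h₃]

theorem table_congr {m m' : Arr → List ℕ → Bool} (h₁ : ∀ l, m' filled l = m filled l)
    (h₂ : ∀ l, m' basis l = m basis l) : table N m' = table N m := by
  funext p
  simp only [table, h₁]
  congr 2
  exact vecAt_congr fun c i => h₂ _

theorem table_update {i b : ℕ} (hi : i < N) (hb : b < N) {m m' : Arr → List ℕ → Bool}
    (h₁ : ∀ l, l ≠ [b, i] → m' filled l = m filled l) (h₂ : m' filled [b, i] = true)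
    (h₃ : ∀ l, l.tail.tail ≠ [b, i] → m' basis l = m basis l) :
    table N m' = Function.update (table N m) (i * N + b) (some (vecAt N m' basis [b, i])) := by
  funext p
  by_cases hp : p = i * N + b
  · subst hp
    rw [table_position hi hb, if_pos h₂, Function.update_self]
  · rw [Function.update_of_ne hp]
    have hne : [p % N, p / N] ≠ [b, i] := by
      intro h
      simp only [List.cons.injEq, and_true] at h
      apply hp
      rw [← h.1, ← h.2, mul_comm]
      exact (Nat.div_add_mod p N).symm
    simp only [table, h₁ _ hne]
    congr 2
    exact vecAt_congr fun c i => h₃ _ (by simpa using hne)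

/-- Two nested loops sweep the positions `i * N + b`. -/
theorem sweep_induction {P : BitProg Var Arr} {ρ : Var → ℕ} {m : Arr → List ℕ → Bool}
    (I : ℕ → (Arr → List ℕ → Bool) → Prop) (h₀ : I 0 m)
    (hs : ∀ i' < N, ∀ b' < N, ∀ m', I (i' * N + b') m' → I (i' * N + b' + 1)
      (P.eval N (Function.update (Function.update ρ i i') b b') m')) :
    I (N * N) ((BitProg.loop i (.loop b P)).eval N ρ m) := by
  refine iterUpTo_induction (fun i' => I (i' * N)) (by simpa using h₀) fun i' hi' m' hm' => ?_
  have : (i' + 1) * N = i' * N + N := Nat.succ_mul i' N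
  rw [this]
  exact iterUpTo_induction (fun b' => I (i' * N + b')) hm' fun b' hb' m'' hm'' =>
    hs i' hi' b' hb' m'' hm''

/-- One step of the insertion of a vector into the table. -/
def siftBody : BitProg Var Arr :=
  .ite level [i] .skip (.ite vec [b, i]
    (.seq (.ite filled [b, i] .skip (.seq (copyVec basis [b, i] vec []) (.set filled [b, i] true)))
      (addVec vec [] basis [b, i])) .skip)

/-- The branches are `Partial.skip` (irrelevant coordinate or zero bit), `Partial.add` and
`Partial.place`. The last two share their final addition: once the residue has been copied to the
empty slot, adding the slot to the residue doubles it. -/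
theorem siftBody_spec {i' b' : ℕ} (hi : i' < N) (hb : b' < N) (ρ : Var → ℕ)
    (m : Arr → List ℕ → Bool) (hlev : ∀ i, m level [i] = lev i)
    (hp : Sift.Partial (filtration N lev) (irrelevant N lev) (table N m) (i' * N + b')
      (vecAt N m vec [])) (hρi : ρ i = i') (hρb : ρ b = b') :
    Sift.Partial (filtration N lev) (irrelevant N lev) (table N (siftBody.eval N ρ m))
      (i' * N + b' + 1) (vecAt N (siftBody.eval N ρ m) vec []) ∧
    Sift.span (irrelevant N lev) (table N (siftBody.eval N ρ m)) 0 ⊔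
        AddSubgroup.zmultiples (vecAt N (siftBody.eval N ρ m) vec []) =
      Sift.span (irrelevant N lev) (table N m) 0 ⊔ AddSubgroup.zmultiples (vecAt N m vec []) ∧
    ∀ a, a ≠ vec → a ≠ basis → a ≠ filled → a ≠ carry → a ≠ Arr.sum →
      ∀ l, siftBody.eval N ρ m a l = m a l := by
  simp only [siftBody, eval, List.map_cons, List.map_nil, hρi, hρb, hlev]
  cases hl : lev i' with
  | true =>
    simp only [if_true]
    exact ⟨hp.skip (filtration_succ_of_level hb hl hp.residue), trivial, fun _ _ _ _ _ _ _ => trivial⟩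
  | false =>
    have htest := notMem_filtration_succ hi hb hp.residue hl
    have hbit : (vecAt N m vec [] ⟨i', hi⟩).getLsbD b' = m vec [b', i'] := getLsbD_num _ _ _ hb
    rw [hbit] at htest
    simp only [Bool.false_eq_true, if_false]
    cases hv : m vec [b', i'] with
    | false =>
      simp only [Bool.false_eq_true, if_false]
      refine ⟨hp.skip ?_, trivial, fun _ _ _ _ _ _ _ => trivial⟩
      by_contra h
      rw [htest.1 h] at hv
      exact absurd hv (by simp)
    | true =>
      have hw := htest.2 hv
      simp only [if_true]
      cases hf : m filled [b', i'] with
      | true =>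
        simp only [if_true]
        obtain ⟨s₁, s₂⟩ := addVec_spec (N := N) (a := vec) (a' := basis) (xs := []) (ys := [b, i])
          (by decide) (by decide) (by decide) (by decide) (by decide) ρ m
        simp only [List.map_cons, List.map_nil, hρi, hρb] at s₁ s₂
        set m' := (addVec vec [] basis [b, i]).eval N ρ m
        have ht : table N m (i' * N + b') = some (vecAt N m basis [b', i']) := by
          rw [table_position hi hb, if_pos hf]
        have hv' : vecAt N m' vec [] = vecAt N m vec [] + vecAt N m basis [b', i'] :=
          funext fun i => s₁ i i.isLt
        have htab : table N m' = table N m :=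
          table_congr (fun l => s₂ _ _ (by decide) (by decide) (by simp))
            (fun l => s₂ _ _ (by decide) (by decide) (by simp))
        rw [hv', htab]
        obtain ⟨h₁, h₂⟩ := hp.add isFiltration hw ht
        exact ⟨h₁, h₂, fun a h₁ _ _ h₄ h₅ l => s₂ a l h₄ h₅ (by simp [h₁])⟩
      | false =>
        simp only [Bool.false_eq_true, if_false]
        obtain ⟨r₁, r₂⟩ := copyVec_spec (N := N) (a := basis) (a' := vec) (xs := [b, i]) (ys := [])
          (by decide) (by decide) (by decide) ρ m
        simp only [List.map_cons, List.map_nil, hρi, hρb] at r₁ r₂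
        set m₁ := (copyVec basis [b, i] vec []).eval N ρ m
        set m₂ := write m₁ filled [b', i'] true with hm₂
        obtain ⟨s₁, s₂⟩ := addVec_spec (N := N) (a := vec) (a' := basis) (xs := []) (ys := [b, i])
          (by decide) (by decide) (by decide) (by decide) (by decide) ρ m₂
        simp only [List.map_cons, List.map_nil, hρi, hρb] at s₁ s₂
        set m' := (addVec vec [] basis [b, i]).eval N ρ m₂
        have ht : table N m (i' * N + b') = none := by
          rw [table_position hi hb, if_neg (by simp [hf])]
        have hbas : ∀ l, m' basis l = m₁ basis l := fun l => by
          rw [s₂ _ _ (by decide) (by decide) (by simp), hm₂, write_of_ne _ _ _ _ (by decide)]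
        have hb₂ : vecAt N m₂ basis [b', i'] = vecAt N m vec [] := funext fun i => by
          refine Eq.trans ?_ (r₁ i i.isLt)
          exact num_congr fun c _ => write_of_ne _ _ _ _ (by decide)
        have hv₂ : vecAt N m₂ vec [] = vecAt N m vec [] := vecAt_congr fun c i => by
          rw [hm₂, write_of_ne _ _ _ _ (by decide), r₂ _ _ (by simp)]
        have hv' : vecAt N m' vec [] = vecAt N m vec [] + vecAt N m vec [] := by
          have : vecAt N m' vec [] = vecAt N m₂ vec [] + vecAt N m₂ basis [b', i'] :=
            funext fun i => s₁ i i.isLt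
          rw [this, hv₂, hb₂]
        have hb' : vecAt N m' basis [b', i'] = vecAt N m vec [] := by
          rw [← hb₂]
          exact vecAt_congr fun c i => s₂ _ _ (by decide) (by decide) (by simp)
        have htab := table_update hi hb (m := m) (m' := m')
          (fun l hl => by
            rw [s₂ _ _ (by decide) (by decide) (by simp), hm₂, write_of_ne_addr _ _ _ _ hl,
              r₂ _ _ (by simp)])
          (by rw [s₂ _ _ (by decide) (by decide) (by simp), hm₂, write_same])
          (fun l hl => by rw [hbas, r₂ _ _ (by simp [hl])])
        rw [hv', htab, hb']
        obtain ⟨h₁, h₂⟩ := hp.place isFiltration hw ht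
        refine ⟨h₁, h₂, fun a h₁ h₂ h₃ h₄ h₅ l => ?_⟩
        rw [s₂ a l h₄ h₅ (by simp [h₁]), hm₂, write_of_ne _ _ _ _ h₃, r₂ _ _ (by simp [h₂])]

/-- Insert twice the current generator into the table. -/
def insertGen : BitProg Var Arr :=
  .seq (copyVec vec [] gen []) (.seq (addVec vec [] gen []) (.loop i (.loop b siftBody)))

/-- After all `N * N` positions the residue is in `irrelevant`, so the table is complete again and
the residue can be dropped from the generated subgroup. -/
theorem insertGen_spec (ρ : Var → ℕ) (m : Arr → List ℕ → Bool) (hlev : ∀ i, m level [i] = lev i)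
    (hp : Sift.Complete (filtration N lev) (irrelevant N lev) (table N m)) :
    Sift.Complete (filtration N lev) (irrelevant N lev) (table N (insertGen.eval N ρ m)) ∧
    Sift.span (irrelevant N lev) (table N (insertGen.eval N ρ m)) 0 =
      Sift.span (irrelevant N lev) (table N m) 0 ⊔
        AddSubgroup.zmultiples (vecAt N m gen [] + vecAt N m gen []) ∧
    ∀ a, a ≠ vec → a ≠ basis → a ≠ filled → a ≠ carry → a ≠ Arr.sum →
      ∀ l, insertGen.eval N ρ m a l = m a l := by
  simp only [insertGen]
  simp only [eval.eq_4]
  obtain ⟨r₁, r₂⟩ := copyVec_spec (N := N) (a := vec) (a' := gen) (xs := []) (ys := [])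
    (by decide) (by decide) (by decide) ρ m
  set m₁ := (copyVec vec [] gen []).eval N ρ m
  obtain ⟨s₁, s₂⟩ := addVec_spec (N := N) (a := vec) (a' := gen) (xs := []) (ys := [])
    (by decide) (by decide) (by decide) (by decide) (by decide) ρ m₁
  set m₂ := (addVec vec [] gen []).eval N ρ m₁
  have hv : vecAt N m₂ vec [] = vecAt N m gen [] + vecAt N m gen [] := funext fun i => by
    refine (s₁ i i.isLt).trans ?_
    rw [List.map_nil] at r₁
    rw [List.map_nil, r₁ i i.isLt]
    refine congrArg _ (num_congr fun c _ => r₂ _ _ (by simp))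
  have ha : ∀ a, a ≠ vec → a ≠ carry → a ≠ Arr.sum → ∀ l, m₂ a l = m a l := fun a h₁ h₂ h₃ l => by
    rw [s₂ a l h₂ h₃ (by simp [h₁]), r₂ a l (by simp [h₁])]
  have htab : table N m₂ = table N m := table_congr (ha _ (by decide) (by decide) (by decide))
    (ha _ (by decide) (by decide) (by decide))
  have h := sweep_induction (N := N) (P := siftBody) (ρ := ρ) (m := m₂)
    (fun q m' => Sift.Partial (filtration N lev) (irrelevant N lev) (table N m') q
        (vecAt N m' vec []) ∧
      Sift.span (irrelevant N lev) (table N m') 0 ⊔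
        AddSubgroup.zmultiples (vecAt N m' vec []) =
      Sift.span (irrelevant N lev) (table N m) 0 ⊔
        AddSubgroup.zmultiples (vecAt N m gen [] + vecAt N m gen []) ∧
      ∀ a, a ≠ vec → a ≠ basis → a ≠ filled → a ≠ carry → a ≠ Arr.sum → ∀ l, m' a l = m a l)
    ⟨by rw [htab]; exact hp.start (mem_filtration_zero _), by rw [htab, hv],
      fun a h₁ _ _ h₄ h₅ => ha a h₁ h₄ h₅⟩
    (fun i' hi' b' hb' m' ⟨h₁, h₂, h₃⟩ => by
      obtain ⟨t₁, t₂, t₃⟩ := siftBody_spec hi' hb'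
        (Function.update (Function.update ρ i i') b b') m'
        (fun i => by rw [h₃ _ (by decide) (by decide) (by decide) (by decide) (by decide), hlev])
        h₁ (by simp) (by simp)
      exact ⟨t₁, t₂.trans h₂, fun a k₁ k₂ k₃ k₄ k₅ l => by
        rw [t₃ a k₁ k₂ k₃ k₄ k₅, h₃ a k₁ k₂ k₃ k₄ k₅]⟩)
  set m' := (BitProg.loop i (.loop b siftBody)).eval N ρ m₂
  obtain ⟨h₁, h₂, h₃⟩ := h
  have hz := filtration_top_le h₁.residue
  refine ⟨h₁.complete hz, ?_, h₃⟩
  rw [← h₂]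
  refine (sup_eq_left.2 ((AddSubgroup.zmultiples_le).2 (Sift.le_span 0 hz))).symm

/-- Test whether the target is in the span of the table. -/
def testTarget : BitProg Var Arr :=
  .seq (.set accept [] true) (.loop i (.loop b (.ite level [i] .skip (.ite target [b, i]
    (.ite filled [b, i] (addVec target [] basis [b, i]) (.set accept [] false)) .skip))))

/-- The sweep goes on after a rejection. This is harmless: once the flag is `false`, `Testing` says
nothing about the residue, and the flag is never set again. -/
theorem testTarget_spec (ρ : Var → ℕ) (m : Arr → List ℕ → Bool) (hlev : ∀ i, m level [i] = lev i)
    (hp : Sift.Complete (filtration N lev) (irrelevant N lev) (table N m)) :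
    testTarget.eval N ρ m accept [] = true ↔
      vecAt N m target [] ∈ Sift.span (irrelevant N lev) (table N m) 0 := by
  simp only [testTarget]
  rw [eval.eq_4, eval.eq_2, List.map_nil]
  have h := sweep_induction (N := N) (P := .ite level [i] .skip (.ite target [b, i]
    (.ite filled [b, i] (addVec target [] basis [b, i]) (.set accept [] false)) .skip))
    (ρ := ρ) (m := write m accept [] true)
    (fun q m' => Sift.Testing (filtration N lev) (irrelevant N lev) (table N m)
        (vecAt N m target []) q (m' accept []) (vecAt N m' target []) ∧
      ∀ a, a ≠ accept → a ≠ target → a ≠ carry → a ≠ Arr.sum → ∀ l, m' a l = m a l)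
    ⟨by
      rw [write_same, show vecAt N (write m accept [] true) target [] = vecAt N m target [] from
        vecAt_congr fun c i => write_of_ne _ _ _ _ (by decide)]
      simp only [Sift.Testing, if_true, sub_self]
      exact ⟨mem_filtration_zero _, zero_mem _⟩,
      fun a ha _ _ _ l => write_of_ne _ _ _ _ ha⟩
    (fun i' hi b' hb m' ⟨ht, hm'⟩ => by
      have hlev' : m' level [i'] = lev i' := by
        rw [hm' _ (by decide) (by decide) (by decide) (by decide), hlev]
      have htab : table N m' = table N m :=
        table_congr (hm' _ (by decide) (by decide) (by decide) (by decide))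
          (hm' _ (by decide) (by decide) (by decide) (by decide))
      have hρi : Function.update (Function.update ρ i i') b b' i = i' := by simp
      have hρb : Function.update (Function.update ρ i i') b b' b = b' := by simp
      generalize Function.update (Function.update ρ i i') b b' = ρ' at *
      simp only [eval, List.map_cons, List.map_nil, hρi, hρb, hlev']
      have hskip : (m' accept [] = true → vecAt N m' target [] ∈ filtration N lev (i' * N + b') →
          vecAt N m' target [] ∈ filtration N lev (i' * N + b' + 1)) →
          Sift.Testing (filtration N lev) (irrelevant N lev) (table N m)
            (vecAt N m target []) (i' * N + b' + 1) (m' accept []) (vecAt N m' target []) := by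
        intro h
        cases ha : m' accept [] with
        | true =>
          simp only [ha, Sift.Testing, if_true] at ht ⊢
          exact ⟨h ha ht.1, ht.2⟩
        | false =>
          rw [ha] at ht
          exact ht
      cases hl : lev i' with
      | true =>
        simp only [if_true]
        exact ⟨hskip fun _ h => filtration_succ_of_level hb hl h, hm'⟩
      | false =>
        have hbit : (vecAt N m' target [] ⟨i', hi⟩).getLsbD b' = m' target [b', i'] :=
          getLsbD_num _ _ _ hb
        simp only [Bool.false_eq_true, if_false]
        cases hv : m' target [b', i'] with
        | false =>
          simp only [Bool.false_eq_true, if_false]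
          refine ⟨hskip fun _ h => ?_, hm'⟩
          by_contra hn
          rw [notMem_filtration_succ hi hb h hl, hbit, hv] at hn
          exact absurd hn (by simp)
        | true =>
          simp only [if_true]
          have hw : m' accept [] = true →
              vecAt N m' target [] ∉ filtration N lev (i' * N + b' + 1) := by
            intro ha
            simp only [ha, Sift.Testing, if_true] at ht
            rw [notMem_filtration_succ hi hb ht.1 hl, hbit, hv]
          cases hf : m' filled [b', i'] with
          | true =>
            simp only [if_true]
            obtain ⟨s₁, s₂⟩ := addVec_spec (N := N) (a := target) (a' := basis) (xs := [])
              (ys := [b, i]) (by decide) (by decide) (by decide) (by decide) (by decide) ρ' m'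
            simp only [List.map_cons, List.map_nil, hρi, hρb] at s₁ s₂
            have hv' : vecAt N ((addVec target [] basis [b, i]).eval N ρ' m') target [] =
                vecAt N m' target [] + vecAt N m' basis [b', i'] := funext fun i => s₁ i i.isLt
            refine ⟨?_, fun a h₁ h₂ h₃ h₄ l => by
              rw [s₂ a l h₃ h₄ (by simp [h₂]), hm' a h₁ h₂ h₃ h₄]⟩
            rw [hv', s₂ _ _ (by decide) (by decide) (by simp)]
            have hq : table N m (i' * N + b') = some (vecAt N m' basis [b', i']) := by
              rw [← htab, table_position hi hb, if_pos hf]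
            cases ha : m' accept [] with
            | true =>
              rw [ha] at ht
              exact ht.add isFiltration hp (hw ha) hq
            | false =>
              rw [ha] at ht
              exact ht
          | false =>
            simp only [Bool.false_eq_true, if_false]
            refine ⟨?_, fun a h₁ h₂ h₃ h₄ l => by rw [write_of_ne _ _ _ _ h₁, hm' a h₁ h₂ h₃ h₄]⟩
            rw [write_same]
            have hq : table N m (i' * N + b') = none := by
              rw [← htab, table_position hi hb, if_neg (by simp [hf])]
            simp only [Sift.Testing, Bool.false_eq_true, if_false]
            cases ha : m' accept [] with
            | true =>
              rw [ha] at ht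
              exact ht.reject isFiltration hp (hw ha) hq
            | false =>
              rw [ha] at ht
              simpa [Sift.Testing] using ht)
  exact h.1.result filtration_top_le

end Procedure

end NMQC

/-! ### Computing the target and the generators -/

namespace NMQC

namespace Procedure

open BitProg Var Arr

variable {N : ℕ}

/-- Set the accumulator to the bit `cur`, and clear `cur`. -/
def setAcc : BitProg Var Arr :=
  .loop c (.seq (assign acc [c] (.read cur [])) (.set cur [] false))

/-- The first round clears `cur`, so only the lowest digit can receive a one. For `N = 0` no round
would take place. -/
theorem setAcc_spec (hN : 0 < N) (ρ : Var → ℕ) (m : Arr → List ℕ → Bool) :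
    num N (setAcc.eval N ρ m) acc [] = (if m cur [] = true then 1 else 0) ∧
    setAcc.eval N ρ m cur [] = false ∧
    ∀ a, a ≠ acc → a ≠ cur → ∀ l, setAcc.eval N ρ m a l = m a l := by
  obtain ⟨h₁, h₂, h₃⟩ := iterUpTo_induction (n := N) (m := m)
    (f := fun i m => (BitProg.seq (assign acc [c] (.read cur [])) (.set cur [] false)).eval N
      (Function.update ρ c i) m)
    (fun i m' => (∀ i' < i, m' acc [i'] = (decide (i' = 0) && m cur [])) ∧
      m' cur [] = (decide (i = 0) && m cur []) ∧
      ∀ a, a ≠ acc → a ≠ cur → ∀ l, m' a l = m a l)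
    ⟨fun _ h => absurd h (Nat.not_lt_zero _), by simp, fun _ _ _ _ => rfl⟩
    (fun i hi m' ⟨h₁, h₂, h₃⟩ => by
      simp only [eval, eval_assign, Expr.val_read, List.map_cons, List.map_nil,
        Function.update_self]
      refine ⟨fun i' hi' => ?_, by simp [write_same], fun a h h' l => ?_⟩
      · rw [write_of_ne _ _ _ _ (by decide)]
        rcases Nat.lt_succ_iff_lt_or_eq.1 hi' with hlt | rfl
        · rw [write_of_ne_addr _ _ _ _ (by simp; omega), h₁ i' hlt]
        · rw [write_same, h₂]
      · rw [write_of_ne _ _ _ _ h', write_of_ne _ _ _ _ h, h₃ a h h'])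
  refine ⟨BitVec.eq_of_getLsbD_eq fun c hc => ?_, h₂.trans (by simp [hN.ne']), h₃⟩
  rw [getLsbD_num _ _ _ hc]
  refine (h₁ c hc).trans ?_
  cases m cur []
  · simp
  · have := BitVec.getLsbD_one (w := N) (i := c)
    simp only [if_true, Bool.and_true]
    refine Eq.trans ?_ this.symm
    simp [hN]

/-- Replace the vector `x` in array `a` by `i ↦ cur + ∑_{i' < i} 2 x_{i'}`, and clear `cur`. -/
def doubledSums (a : Arr) : BitProg Var Arr :=
  .seq setAcc (.loop j (.seq (copyNum prev [] a [j]) (.seq (copyNum a [j] acc [])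
    (.seq (addNum acc [] prev []) (addNum acc [] prev [])))))

/-- The running sum `acc` overwrites the coordinate, whose old value is saved in `prev` and then
added twice. -/
theorem doubledSums_spec (hN : 0 < N) {a : Arr} (ha : a ≠ acc ∧ a ≠ prev ∧ a ≠ carry ∧
    a ≠ Arr.sum ∧ a ≠ cur) (ρ : Var → ℕ) (m : Arr → List ℕ → Bool) :
    (∀ i < N, num N ((doubledSums a).eval N ρ m) a [i] =
      (if m cur [] = true then 1 else 0) + ∑ i' ∈ Finset.range i, 2 * num N m a [i']) ∧
    (doubledSums a).eval N ρ m cur [] = false ∧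
    ∀ a', a' ≠ a → a' ≠ acc → a' ≠ prev → a' ≠ carry → a' ≠ Arr.sum → a' ≠ cur →
      ∀ l, (doubledSums a).eval N ρ m a' l = m a' l := by
  simp only [doubledSums]
  rw [eval.eq_4]
  obtain ⟨s₁, s₂, s₃⟩ := setAcc_spec hN ρ m
  set m₀ := setAcc.eval N ρ m
  obtain ⟨-, h₂, -, h₄, h₅⟩ := iterUpTo_induction (n := N) (m := m₀)
    (f := fun i m => (BitProg.seq (copyNum prev [] a [j]) (.seq (copyNum a [j] acc [])
      (.seq (addNum acc [] prev []) (addNum acc [] prev [])))).eval N (Function.update ρ j i) m)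
    (fun i m' => (num N m' acc [] =
        (if m cur [] = true then 1 else 0) + ∑ i' ∈ Finset.range i, 2 * num N m a [i']) ∧
      (∀ i' < i, num N m' a [i'] =
        (if m cur [] = true then 1 else 0) + ∑ i'' ∈ Finset.range i', 2 * num N m a [i'']) ∧
      (∀ i', i ≤ i' → num N m' a [i'] = num N m a [i']) ∧
      m' cur [] = false ∧
      ∀ a', a' ≠ a → a' ≠ acc → a' ≠ prev → a' ≠ carry → a' ≠ Arr.sum → a' ≠ cur →
        ∀ l, m' a' l = m a' l)
    ⟨by simp [s₁], fun _ h => absurd h (Nat.not_lt_zero _),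
      fun _ _ => num_congr fun c _ => s₃ _ ha.1 ha.2.2.2.2 _, s₂,
      fun a' _ h₁ _ _ _ h₂ => s₃ a' h₁ h₂⟩
    (fun i hi m₁ ⟨h₁, h₂, h₃, h₄, h₅⟩ => by
      simp only [eval]
      obtain ⟨p₁, q₁⟩ := copyNum_spec (N := N) (a := prev) (a' := a) (xs := []) (ys := [j])
        ha.2.1 (by decide) (by decide) (Function.update ρ j i) m₁
      set m₂ := (copyNum prev [] a [j]).eval N (Function.update ρ j i) m₁
      obtain ⟨p₂, q₂⟩ := copyNum_spec (N := N) (a := a) (a' := acc) (xs := [j]) (ys := [])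
        ha.1.symm (by decide) (by decide) (Function.update ρ j i) m₂
      set m₃ := (copyNum a [j] acc []).eval N (Function.update ρ j i) m₂
      obtain ⟨p₃, q₃⟩ := addNum_spec (N := N) (a := acc) (a' := prev) (xs := []) (ys := [])
        (by decide) (by decide) (by decide) (by decide) (by decide) (Function.update ρ j i) m₃
      set m₄ := (addNum acc [] prev []).eval N (Function.update ρ j i) m₃
      obtain ⟨p₄, q₄⟩ := addNum_spec (N := N) (a := acc) (a' := prev) (xs := []) (ys := [])
        (by decide) (by decide) (by decide) (by decide) (by decide) (Function.update ρ j i) m₄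
      set m₅ := (addNum acc [] prev []).eval N (Function.update ρ j i) m₄
      simp only [List.map_cons, List.map_nil, Function.update_self] at p₁ q₁ p₂ q₂ p₃ q₃ p₄ q₄
      have hprev₃ : num N m₃ prev [] = num N m a [i] := by
        rw [← h₃ i le_rfl, ← p₁]
        exact num_congr fun c _ => q₂ _ _ (by simp [ha.2.1.symm])
      have hprev₄ : num N m₄ prev [] = num N m a [i] := by
        rw [← hprev₃]
        exact num_congr fun c _ => q₃ _ _ (by decide) (by decide) (by simp)
      have hacc₂ : num N m₂ acc [] = num N m₁ acc [] :=
        num_congr fun c _ => q₁ _ _ (by simp)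
      have hacc₃ : num N m₃ acc [] = num N m₁ acc [] := by
        rw [← hacc₂]
        exact num_congr fun c _ => q₂ _ _ (by simp [ha.1.symm])
      have ha₅ : ∀ l, m₅ a l = m₃ a l := fun l => by
        rw [q₄ _ _ ha.2.2.1 ha.2.2.2.1 (by simp [ha.1]),
          q₃ _ _ ha.2.2.1 ha.2.2.2.1 (by simp [ha.1])]
      have ha₃ : ∀ i', i' ≠ i → num N m₅ a [i'] = num N m₁ a [i'] := fun i' hi' =>
        num_congr fun c _ => by
          rw [ha₅, q₂ _ _ (by simp [hi']), q₁ _ _ (by simp [ha.2.1])]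
      have hfr : ∀ a', a' ≠ a → a' ≠ acc → a' ≠ prev → a' ≠ carry → a' ≠ Arr.sum →
          ∀ l, m₅ a' l = m₁ a' l := fun a' k₁ k₂ k₃ k₄ k₅ l => by
        rw [q₄ _ _ k₄ k₅ (by simp [k₂]), q₃ _ _ k₄ k₅ (by simp [k₂]), q₂ _ _ (by simp [k₁]),
          q₁ _ _ (by simp [k₃])]
      refine ⟨?_, fun i' hi' => ?_, fun i' hi' => ?_, ?_, fun a' k₁ k₂ k₃ k₄ k₅ k₆ l => ?_⟩
      · rw [p₄, p₃, hacc₃, hprev₃, hprev₄, h₁, Finset.sum_range_succ]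
        ring
      · rcases Nat.lt_succ_iff_lt_or_eq.1 hi' with hlt | rfl
        · rw [ha₃ i' (by omega), h₂ i' hlt]
        · rw [← h₁, ← hacc₂, ← p₂]
          exact num_congr fun c _ => ha₅ _
      · rw [ha₃ i' (by omega), h₃ i' (by omega)]
      · rw [hfr _ ha.2.2.2.2.symm (by decide) (by decide) (by decide) (by decide), h₄]
      · rw [hfr a' k₁ k₂ k₃ k₄ k₅, h₅ a' k₁ k₂ k₃ k₄ k₅ k₆])
  exact ⟨h₂, h₄, h₅⟩

/-- The bit as a residue modulo two. -/
def parityOf (b : Bool) : ZMod 2 := if b then 1 else 0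

/-- The sum `∑_{r ≤ p} C(p, r) v_{e - r}` modulo two. -/
def triangleSum (v : ℕ → Bool) (e p : ℕ) : ZMod 2 :=
  ∑ r ∈ Finset.range (p + 1), (p.choose r : ZMod 2) * parityOf (v (e - r))

/-- Pascal's rule. The shift `e + 1 - (r + 1) = e - r` holds for truncated subtraction too, so `p ≤
e` need not be assumed. -/
theorem triangleSum_succ (v : ℕ → Bool) (e p : ℕ) :
    triangleSum v (e + 1) (p + 1) = triangleSum v (e + 1) p + triangleSum v e p := by
  simp only [triangleSum]
  rw [Finset.sum_range_succ' _ (p + 1)]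
  simp only [Nat.choose_succ_succ, Nat.cast_add, add_mul, Finset.sum_add_distrib,
    Nat.choose_zero_right, Nat.add_sub_add_right, Nat.succ_eq_add_one]
  rw [Finset.sum_range_succ' (fun r => (p.choose r : ZMod 2) * parityOf (v (e + 1 - r))) p,
    Finset.sum_range_succ (fun r => (p.choose (r + 1) : ZMod 2) * parityOf (v (e - r))) p]
  simp only [Nat.choose_succ_self, Nat.cast_zero, zero_mul, add_zero, Nat.add_sub_add_right,
    Nat.choose_zero_right]
  ring

/-- Replace the values by their binomial sums modulo two. -/
def triangle : BitProg Var Arr :=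
  .loop k (.seq (assign cur [] (.read value [k])) (.loop i (.seq (assign tmp [] (.read tri [i]))
    (.seq (assign tri [i] (.read cur [])) (assign cur [] (.cond cur []
      (.cond tmp [] (.const false) (.const true)) (.read tmp [])))))))

/-- Round `e` turns the sums ending at `v (e - 1)` into those ending at `v e`: `cur` carries the new
entry from `p` to `p + 1`, and `tmp` saves the old one. The inner loop runs beyond `e`, but nothing
is claimed about the entries there. -/
theorem triangle_spec (ρ : Var → ℕ) (m : Arr → List ℕ → Bool) :
    (∀ p < N, parityOf (triangle.eval N ρ m tri [p]) =
      triangleSum (fun j => m value [j]) (N - 1) p) ∧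
    ∀ a, a ≠ cur → a ≠ tmp → a ≠ tri → ∀ l, triangle.eval N ρ m a l = m a l := by
  set v := fun j => m value [j] with hv
  refine iterUpTo_induction (n := N) (m := m)
    (fun e m' => (∀ p < e, parityOf (m' tri [p]) = triangleSum v (e - 1) p) ∧
      ∀ a, a ≠ cur → a ≠ tmp → a ≠ tri → ∀ l, m' a l = m a l)
    ⟨fun _ h => absurd h (Nat.not_lt_zero _), fun _ _ _ _ _ => rfl⟩
    (fun e he m' ⟨h₁, h₂⟩ => ?_)
  obtain ⟨g₁, -, -, g₂⟩ := iterUpTo_induction (n := N) (m := write m' cur [] (v e))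
    (f := fun i' m => (BitProg.seq (assign tmp [] (.read tri [i]))
    (.seq (assign tri [i] (.read cur [])) (assign cur [] (.cond cur []
      (.cond tmp [] (.const false) (.const true)) (.read tmp []))))).eval N
        (Function.update (Function.update ρ k e) i i') m)
    (fun q m'' => (∀ p < q, p ≤ e → parityOf (m'' tri [p]) = triangleSum v e p) ∧
      (∀ p, q ≤ p → m'' tri [p] = m' tri [p]) ∧
      (q ≤ e → parityOf (m'' cur []) = triangleSum v e q) ∧
      ∀ a, a ≠ cur → a ≠ tmp → a ≠ tri → ∀ l, m'' a l = m a l)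
    ⟨fun _ h => absurd h (Nat.not_lt_zero _), fun _ _ => write_of_ne _ _ _ _ (by decide),
      fun _ => by simp [write_same, triangleSum],
      fun a ha₁ ha₂ ha₃ l => by rw [write_of_ne _ _ _ _ ha₁, h₂ a ha₁ ha₂ ha₃]⟩
    (fun q hq m'' ⟨k₁, k₂, k₃, k₄⟩ => by
      simp only [eval, eval_assign, Expr.val_read, Expr.val, List.map_cons, List.map_nil,
        Function.update_self]
      refine ⟨fun p hp hpe => ?_, fun p hp => ?_, fun hqe => ?_, fun a ha₁ ha₂ ha₃ l => ?_⟩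
      · rw [write_of_ne _ _ _ _ (by decide)]
        rcases Nat.lt_succ_iff_lt_or_eq.1 hp with hlt | rfl
        · rw [write_of_ne_addr _ _ _ _ (by simp; omega), write_of_ne _ _ _ _ (by decide),
            k₁ p hlt hpe]
        · rw [write_same, write_of_ne _ _ _ _ (by decide), k₃ hpe]
      · rw [write_of_ne _ _ _ _ (by decide), write_of_ne_addr _ _ _ _ (by simp; omega),
          write_of_ne _ _ _ _ (by decide), k₂ p (by omega)]
      · obtain ⟨e, rfl⟩ : ∃ e', e = e' + 1 := ⟨e - 1, by omega⟩
        have e₁ := k₃ (by omega)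
        have e₂ := h₁ q (by omega)
        rw [Nat.add_sub_cancel, ← k₂ q le_rfl] at e₂
        rw [write_same, triangleSum_succ, ← e₁, ← e₂]
        simp only [write_same, write_of_ne _ _ _ _ (show cur ≠ tri by decide),
          write_of_ne _ _ _ _ (show cur ≠ tmp by decide),
          write_of_ne _ _ _ _ (show tmp ≠ tri by decide)]
        cases m'' cur [] <;> cases m'' tri [q] <;> decide
      · rw [write_of_ne _ _ _ _ ha₁, write_of_ne _ _ _ _ ha₃, write_of_ne _ _ _ _ ha₂,
          k₄ a ha₁ ha₂ ha₃])
  have hval : m' value [e] = v e := h₂ value (by decide) (by decide) (by decide) _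
  rw [eval.eq_4, eval_assign, Expr.val_read, List.map_cons, List.map_nil, Function.update_self,
    hval]
  exact ⟨fun p hp => g₁ p (by omega) (by omega), g₂⟩

/-- The vector `i ↦ 2^k C(i, k)`. -/
def scaledChoose (N k : ℕ) : Fin N → BitVec N := fun i => ((2 ^ k * (i.val.choose k) : ℕ) : BitVec N)

/-- The hockey-stick identity. By it, `doubledSums` turns column `k` of the matrix `2^k C(i, k)`
into column `k + 1` without any multiplication. -/
theorem sum_scaledChoose (N k i : ℕ) :
    ∑ i' ∈ Finset.range i, 2 * ((2 ^ k * (i'.choose k) : ℕ) : BitVec N) =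
      ((2 ^ (k + 1) * (i.choose (k + 1)) : ℕ) : BitVec N) := by
  induction i with
  | zero => simp
  | succ i ih =>
    rw [Finset.sum_range_succ, ih, Nat.choose_succ_succ]
    push_cast
    ring

/-- Compute the combination of the vectors `i ↦ 2^k C(i, k)` with the coefficients in `tri`. -/
def makeTarget : BitProg Var Arr :=
  .loop k (.seq (assign cur [] (.read tri [k])) (doubledSums target))

/-- A Horner scheme: the bit read in round `r` enters as a multiple of column 0 and is raised by
each of the remaining `N - 1 - r` rounds, so it ends up as the coefficient of column `N - 1 - r`. -/
theorem makeTarget_spec (hN : 0 < N) (ρ : Var → ℕ) (m : Arr → List ℕ → Bool)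
    (h₀ : ∀ l, m target l = false) :
    (∀ i : Fin N, vecAt N (makeTarget.eval N ρ m) target [] i =
      ∑ r ∈ Finset.range N, if m tri [r] = true then scaledChoose N (N - 1 - r) i else 0) ∧
    ∀ a, a ≠ target → a ≠ acc → a ≠ prev → a ≠ carry → a ≠ Arr.sum → a ≠ cur →
      ∀ l, makeTarget.eval N ρ m a l = m a l := by
  obtain ⟨h₁, h₂⟩ := iterUpTo_induction (n := N) (m := m)
    (f := fun q m => (BitProg.seq (assign cur [] (.read tri [k])) (doubledSums target)).eval N
      (Function.update ρ k q) m)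
    (fun q m' => (∀ i < N, num N m' target [i] = ∑ r ∈ Finset.range q,
        if m tri [r] = true then ((2 ^ (q - 1 - r) * (i.choose (q - 1 - r)) : ℕ) : BitVec N)
          else 0) ∧
      ∀ a, a ≠ target → a ≠ acc → a ≠ prev → a ≠ carry → a ≠ Arr.sum → a ≠ cur →
        ∀ l, m' a l = m a l)
    ⟨fun i _ => BitVec.eq_of_getLsbD_eq fun c hc => by
      rw [getLsbD_num _ _ _ hc, h₀]
      simp, fun _ _ _ _ _ _ _ _ => rfl⟩
    (fun q hq m' ⟨h₁, h₂⟩ => by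
      simp only [eval, eval_assign, Expr.val_read, List.map_cons, List.map_nil,
        Function.update_self]
      have htri : m' tri [q] = m tri [q] :=
        h₂ _ (by decide) (by decide) (by decide) (by decide) (by decide) (by decide) _
      obtain ⟨s₁, -, s₃⟩ := doubledSums_spec hN (a := target) (by decide)
        (Function.update ρ k q) (write m' cur [] (m' tri [q]))
      refine ⟨fun i hi => ?_, fun a k₁ k₂ k₃ k₄ k₅ k₆ l => ?_⟩
      · rw [s₁ i hi, write_same, htri, Finset.sum_range_succ, add_comm]
        congr 1
        · have : ∀ i' ∈ Finset.range i, 2 * num N (write m' cur [] (m tri [q])) target [i'] =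
              ∑ r ∈ Finset.range q, if m tri [r] = true then
                2 * ((2 ^ (q - 1 - r) * (i'.choose (q - 1 - r)) : ℕ) : BitVec N) else 0 := by
            intro i' hi'
            have hw : num N (write m' cur [] (m tri [q])) target [i'] = num N m' target [i'] :=
              num_congr fun c _ => write_of_ne _ _ _ _ (by decide)
            rw [hw, h₁ i' (by have := Finset.mem_range.1 hi'; omega), Finset.mul_sum]
            exact Finset.sum_congr rfl fun r _ => by rw [mul_ite, mul_zero]
          rw [Finset.sum_congr rfl this, Finset.sum_comm]
          refine Finset.sum_congr rfl fun r hr => ?_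
          have hr := Finset.mem_range.1 hr
          split_ifs
          · rw [sum_scaledChoose, show q - 1 - r + 1 = q + 1 - 1 - r by omega]
          · simp
        · simp
      · rw [s₃ a k₁ k₂ k₃ k₄ k₅ k₆, write_of_ne _ _ _ _ k₆, h₂ a k₁ k₂ k₃ k₄ k₅ k₆])
  exact ⟨fun i => h₁ i i.isLt, h₂⟩

/-- Insert the vectors `i ↦ 2^(k+1) C(i, k)` into the table. -/
def makeTable : BitProg Var Arr :=
  .seq (.set cur [] true) (.loop k (.seq (doubledSums gen) insertGen))

/-- Starting from the zero vector with `cur` set, the first call of `doubledSums` produces the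
constant vector 1, which is column 0, and clears `cur`. From then on each call produces the next
column. -/
theorem makeTable_spec {lev : ℕ → Bool} (hN : 0 < N) (ρ : Var → ℕ) (m : Arr → List ℕ → Bool)
    (hlev : ∀ i, m level [i] = lev i) (h₀ : ∀ l, m gen l = false) (h₀' : ∀ l, m filled l = false) :
    Sift.Complete (filtration N lev) (irrelevant N lev) (table N (makeTable.eval N ρ m)) ∧
    Sift.span (irrelevant N lev) (table N (makeTable.eval N ρ m)) 0 =
      AddSubgroup.closure {x | ∃ q < N, x = scaledChoose N q + scaledChoose N q} ⊔
        irrelevant N lev ∧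
    (∀ l, makeTable.eval N ρ m target l = m target l) ∧
      ∀ l, makeTable.eval N ρ m level l = m level l := by
  have hnone : ∀ m' : Arr → List ℕ → Bool, (∀ l, m' filled l = false) → ∀ p, table N m' p = none :=
    fun m' h p => if_neg (by simp [h])
  simp only [makeTable]
  rw [eval.eq_4, eval.eq_2, List.map_nil]
  obtain ⟨-, -, h₃, h₄, h₅⟩ := iterUpTo_induction (n := N) (m := write m cur [] true)
    (f := fun q m => (BitProg.seq (doubledSums gen) insertGen).eval N (Function.update ρ k q) m)
    (fun q m' => m' cur [] = decide (q = 0) ∧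
      (∀ i < N, num N m' gen [i] = match q with
        | 0 => 0
        | q + 1 => ((2 ^ q * (i.choose q) : ℕ) : BitVec N)) ∧
      Sift.Complete (filtration N lev) (irrelevant N lev) (table N m') ∧
      Sift.span (irrelevant N lev) (table N m') 0 =
        AddSubgroup.closure {x | ∃ q' < q, x = scaledChoose N q' + scaledChoose N q'} ⊔
          irrelevant N lev ∧
      ((∀ l, m' target l = m target l) ∧ ∀ l, m' level l = m level l))
    ⟨by simp [write_same], fun i _ => BitVec.eq_of_getLsbD_eq fun c hc => by
        rw [getLsbD_num _ _ _ hc, write_of_ne _ _ _ _ (by decide), h₀]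
        simp,
      by
        have := hnone (write m cur [] true) fun l => by
          rw [write_of_ne _ _ _ _ (by decide), h₀']
        exact ⟨fun p x hx => by simp [this] at hx, fun p x hx => by simp [this] at hx⟩,
      by
        have := hnone (write m cur [] true) fun l => by
          rw [write_of_ne _ _ _ _ (by decide), h₀']
        simp [Sift.span, this],
      fun l => write_of_ne _ _ _ _ (by decide), fun l => write_of_ne _ _ _ _ (by decide)⟩
    (fun q hq m' ⟨h₁, h₂, h₃, h₄, h₅, h₆⟩ => by
      rw [eval.eq_4]
      obtain ⟨s₁, s₂, s₃⟩ := doubledSums_spec hN (a := gen) (by decide) (Function.update ρ k q) m'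
      set m₁ := (doubledSums gen).eval N (Function.update ρ k q) m'
      have htab : table N m₁ = table N m' := table_congr
        (s₃ _ (by decide) (by decide) (by decide) (by decide) (by decide) (by decide))
        (s₃ _ (by decide) (by decide) (by decide) (by decide) (by decide) (by decide))
      have hlev₁ : ∀ l, m₁ level l = m level l := fun l => by
        rw [s₃ _ (by decide) (by decide) (by decide) (by decide) (by decide) (by decide), h₆]
      have htar₁ : ∀ l, m₁ target l = m target l := fun l => by
        rw [s₃ _ (by decide) (by decide) (by decide) (by decide) (by decide) (by decide), h₅]
      obtain ⟨t₁, t₂, t₃⟩ := insertGen_spec (N := N) (lev := lev) (Function.update ρ k q) m₁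
        (fun i => by rw [hlev₁, hlev]) (by rwa [htab])
      set m₂ := insertGen.eval N (Function.update ρ k q) m₁
      have hgen : ∀ i < N, num N m₁ gen [i] = ((2 ^ q * (i.choose q) : ℕ) : BitVec N) := by
        intro i hi
        rw [s₁ i hi, h₁]
        rcases q with _ | q
        · rw [Finset.sum_eq_zero fun i' hi' => by
            rw [h₂ i' (by have := Finset.mem_range.1 hi'; omega)]; simp]
          simp
        · rw [← sum_scaledChoose]
          simp only [Nat.add_eq_zero_iff, one_ne_zero, and_false, decide_false, Bool.false_eq_true,
            if_false, zero_add]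
          exact Finset.sum_congr rfl fun i' hi' => by
            rw [h₂ i' (by have := Finset.mem_range.1 hi'; omega)]
      have hvec : vecAt N m₁ gen [] = scaledChoose N q := funext fun i => hgen i i.isLt
      refine ⟨?_, fun i hi => ?_, t₁, ?_, fun l => ?_, fun l => ?_⟩
      · rw [t₃ _ (by decide) (by decide) (by decide) (by decide) (by decide), s₂]
        simp
      · refine Eq.trans (num_congr fun c _ => ?_) (hgen i hi)
        exact t₃ _ (by decide) (by decide) (by decide) (by decide) (by decide) _
      · rw [t₂, htab, h₄, hvec, sup_right_comm, AddSubgroup.zmultiples_eq_closure,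
          ← AddSubgroup.closure_union]
        congr 2
        ext x
        simp only [Set.mem_union, Set.mem_ofPred_eq, Set.mem_singleton_iff, Nat.lt_succ_iff_lt_or_eq]
        constructor
        · rintro (⟨q', h, rfl⟩ | rfl)
          exacts [⟨q', Or.inl h, rfl⟩, ⟨q, Or.inr rfl, rfl⟩]
        · rintro ⟨q', h | rfl, rfl⟩
          exacts [Or.inl ⟨q', h, rfl⟩, Or.inr rfl]
      · rw [t₃ _ (by decide) (by decide) (by decide) (by decide) (by decide), htar₁]
      · rw [t₃ _ (by decide) (by decide) (by decide) (by decide) (by decide), hlev₁])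
  exact ⟨h₃, h₄, h₅⟩

/-- The decision procedure. -/
def main : BitProg Var Arr := .seq triangle (.seq makeTarget (.seq makeTable testTarget))

theorem main_wellScoped : main.WellScoped := by
  simp [main, triangle, makeTarget, makeTable, testTarget, insertGen, siftBody, doubledSums, setAcc,
    copyVec, addVec, copyNum, addNum, WellScoped, bound, wellScoped_assign]

theorem main_spec (hN : 0 < N) (w : List (Bool × Bool)) (ρ : Var → ℕ) :
    main.eval N ρ (inputMem value level w) accept [] = true ↔
      ∃ u : ℕ → Bool, (∀ r < N, parityOf (u r) =
        triangleSum (fun j => (w[j]?.map Prod.fst).getD false) (N - 1) r) ∧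
      (fun i => ∑ r ∈ Finset.range N, if u r = true then scaledChoose N (N - 1 - r) i else 0) ∈
        AddSubgroup.closure {x | ∃ q < N, x = scaledChoose N q + scaledChoose N q} ⊔
          irrelevant N fun i => (w[i]?.map Prod.snd).getD false := by
  set m := inputMem value level w with hm
  have hzero : ∀ a, a ≠ value → a ≠ level → ∀ l, m a l = false := by
    intro a h₁ h₂ l
    rcases l with _ | ⟨x, _ | _⟩ <;> simp [hm, inputMem, h₁, h₂]
  simp only [main]
  rw [eval.eq_4, eval.eq_4, eval.eq_4]
  obtain ⟨a₁, a₂⟩ := triangle_spec (N := N) ρ m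
  set m₁ := triangle.eval N ρ m
  obtain ⟨b₁, b₂⟩ := makeTarget_spec hN ρ m₁ fun l => by
    rw [a₂ _ (by decide) (by decide) (by decide), hzero _ (by decide) (by decide)]
  set m₂ := makeTarget.eval N ρ m₁
  have hrest : ∀ a, a ≠ cur → a ≠ tmp → a ≠ tri → a ≠ target → a ≠ acc → a ≠ prev → a ≠ carry →
      a ≠ Arr.sum → ∀ l, m₂ a l = m a l := fun a h₁ h₂ h₃ h₄ h₅ h₆ h₇ h₈ l => by
    rw [b₂ a h₄ h₅ h₆ h₇ h₈ h₁, a₂ a h₁ h₂ h₃]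
  have hlev : ∀ i, m₂ level [i] = (w[i]?.map Prod.snd).getD false := fun i => by
    rw [hrest _ (by decide) (by decide) (by decide) (by decide) (by decide) (by decide)
      (by decide) (by decide)]
    simp [hm, inputMem]
  obtain ⟨c₁, c₂, c₃, c₄⟩ := makeTable_spec (lev := fun i => (w[i]?.map Prod.snd).getD false)
    hN ρ m₂ hlev
    (fun l => by
      rw [hrest _ (by decide) (by decide) (by decide) (by decide) (by decide) (by decide)
        (by decide) (by decide), hzero _ (by decide) (by decide)])
    (fun l => by
      rw [hrest _ (by decide) (by decide) (by decide) (by decide) (by decide) (by decide)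
        (by decide) (by decide), hzero _ (by decide) (by decide)])
  set m₃ := makeTable.eval N ρ m₂
  rw [testTarget_spec (lev := fun i => (w[i]?.map Prod.snd).getD false) ρ m₃
    (fun i => by rw [c₄, hlev]) c₁, c₂]
  have ht : vecAt N m₃ target [] = fun i => ∑ r ∈ Finset.range N,
      if m₁ tri [r] = true then scaledChoose N (N - 1 - r) i else 0 := by
    rw [← funext b₁]
    exact vecAt_congr fun c i => c₃ _
  -- The parities determine the bits, so any admissible `u` agrees below `N` with the contents of
  -- `tri`.
  have hpar : ∀ b b' : Bool, parityOf b = parityOf b' → b = b' := by decide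
  have hv : (fun j => m value [j]) = fun j => (w[j]?.map Prod.fst).getD false := funext fun j => by
    simp [hm, inputMem]
  rw [hv] at a₁
  rw [ht]
  refine ⟨fun h => ⟨fun r => m₁ tri [r], a₁, h⟩, fun ⟨u, hu, h⟩ => ?_⟩
  convert h using 4 with i r hr
  rw [hpar _ _ ((a₁ r (Finset.mem_range.1 hr)).trans (hu r (Finset.mem_range.1 hr)).symm)]

end Procedure

end NMQC

namespace NMQC

/-! ### The expectation value on GHZ states -/

theorem ghz_eq (k : ℕ) : ghz k = ((1 / Real.sqrt 2 : ℝ) : ℂ) •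
    (Pi.single (fun _ => 0) 1 + Pi.single (fun _ => 1) 1) := by
  funext a
  simp [ghz, Pi.single_apply]

theorem expectation_ghz {k : ℕ} (A : Matrix (Fin k → Fin 2) (Fin k → Fin 2) ℂ) :
    expectation (ghz k) A = (A (fun _ => 0) (fun _ => 0) + A (fun _ => 1) (fun _ => 0) +
      (A (fun _ => 0) (fun _ => 1) + A (fun _ => 1) (fun _ => 1))) / 2 := by
  have hs : star (Pi.single (fun _ => 0) 1 + Pi.single (fun _ => 1) 1 : (Fin k → Fin 2) → ℂ) =
      Pi.single (fun _ => 0) 1 + Pi.single (fun _ => 1) 1 := by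
    funext a
    simp only [Pi.star_apply, Pi.add_apply, Pi.single_apply]
    split_ifs <;> simp
  have hc : ((1 / Real.sqrt 2 : ℝ) : ℂ) * ((1 / Real.sqrt 2 : ℝ) : ℂ) = 1 / 2 := by
    rw [← Complex.ofReal_mul, one_div_mul_one_div, Real.mul_self_sqrt zero_le_two]
    norm_num
  rw [expectation, ghz_eq, star_smul, hs, Matrix.mulVec_smul, dotProduct_smul, smul_dotProduct,
    Matrix.mulVec_add, add_dotProduct, dotProduct_add, dotProduct_add]
  simp only [Matrix.mulVec_single_one, single_one_dotProduct, Matrix.col_apply, smul_eq_mul,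
    Complex.star_def, Complex.conj_ofReal]
  rw [← mul_assoc, hc]
  ring

/-- The diagonal entries of an equatorial observable vanish and its off-diagonal entries are
e^{±iα}. Of the four entries of the tensor product that matter, two are zero and the others are
e^{±i∑α}. At least one qubit is needed, as an empty product of diagonal entries is one. -/
theorem expectation_equatorial {k : ℕ} (hk : 0 < k) (α : Fin k → ℝ) :
    expectation (ghz k) (tensorOp fun i => equatorial (α i)) =
      ((Real.cos (∑ i, α i) : ℝ) : ℂ) := by
  have h₀ : ∀ b : Fin 2, ∏ i : Fin k, equatorial (α i) b b = 0 := by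
    intro b
    refine Finset.prod_eq_zero (Finset.mem_univ (⟨0, hk⟩ : Fin k)) ?_
    fin_cases b <;> simp [equatorial, pauliX, pauliY]
  have h₁ : ∀ i, equatorial (α i) 1 0 = Complex.exp ((α i : ℂ) * Complex.I) := by
    intro i
    simp [equatorial, pauliX, pauliY, Complex.exp_mul_I]
  have h₂ : ∀ i, equatorial (α i) 0 1 = Complex.exp (-(α i : ℂ) * Complex.I) := by
    intro i
    rw [Complex.exp_mul_I, Complex.cos_neg, Complex.sin_neg]
    simp [equatorial, pauliX, pauliY]
  rw [expectation_ghz]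
  simp only [tensorOp, Matrix.of_apply, h₀, h₁, h₂, ← Complex.exp_sum, ← Finset.sum_mul]
  rw [Complex.ofReal_cos, Complex.cos, Complex.ofReal_sum, Finset.sum_neg_distrib]
  ring

/-! ### Symmetric functions and polynomials -/

/-- The Hamming weight. -/
def weight {n : ℕ} (x : Fin n → Bool) : ℕ := (Finset.univ.filter fun l => x l = true).card

theorem weight_le {n : ℕ} (x : Fin n → Bool) : weight x ≤ n :=
  (Finset.card_le_univ _).trans (by simp)

theorem card_prefix {n j : ℕ} (hj : j ≤ n) :
    (Finset.univ.filter fun l : Fin n => l.val < j).card = j := by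
  rw [Fin.card_filter_val_lt, min_eq_right hj]

/-- A bijection from the first |x| positions onto the support of `x` extends to a permutation of all
positions. -/
theorem IsSymmetricFun.apply_eq {n : ℕ} {f : (Fin n → Bool) → Bool} (hf : IsSymmetricFun f)
    (x : Fin n → Bool) : f x = valueVector f ⟨weight x, Nat.lt_succ_of_le (weight_le x)⟩ := by
  have hcard : Fintype.card {l : Fin n // l.val < weight x} =
      Fintype.card {l : Fin n // x l = true} := by
    rw [Fintype.card_subtype, card_prefix (weight_le x), Fintype.card_subtype, weight]
  let e := (Fintype.equivOfCardEq hcard).extendSubtype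
  rw [← hf e x, valueVector]
  congr 1
  funext l
  by_cases hl : l.val < weight x
  · simpa [hl] using (Fintype.equivOfCardEq hcard).extendSubtype_mem l hl
  · simpa [hl] using (Fintype.equivOfCardEq hcard).extendSubtype_not_mem l hl

theorem weight_prefix {n j : ℕ} (hj : j ≤ n) :
    weight (fun l : Fin n => decide (l.val < j)) = j := by
  simp only [weight, decide_eq_true_eq]
  exact card_prefix hj

/-- The entries of the Krawtchouk matrix as a function of natural numbers. -/
def krawtchoukNat (n i j : ℕ) : ℤ :=
  ∑ k ∈ Finset.range (j + 1), (-1 : ℤ) ^ k * (i.choose k : ℤ) * ((n - i).choose (j - k) : ℤ)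

theorem krawtchouk_apply (n : ℕ) (i j : Fin (n + 1)) : krawtchouk n i j = krawtchoukNat n i j := rfl

/-- The homogeneous generating function of a row. The general coefficient ring allows polynomials to
be substituted for `a` and `b`. -/
theorem sum_krawtchoukNat {R : Type*} [CommRing R] {n i : ℕ} (hi : i ≤ n) (a b : R) :
    ∑ j ∈ Finset.range (n + 1), (krawtchoukNat n i j : R) * (b ^ j * a ^ (n - j)) =
      (a - b) ^ i * (a + b) ^ (n - i) := by
  set F : ℕ → ℕ → R := fun k l => (-1) ^ k * (i.choose k : R) * ((n - i).choose l : R) *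
    (b ^ (k + l) * a ^ (n - (k + l))) with hF
  have h₁ : ∀ j ∈ Finset.range (n + 1), (krawtchoukNat n i j : R) * (b ^ j * a ^ (n - j)) =
      ∑ k ∈ Finset.range (j + 1), F k (j - k) := by
    intro j _
    rw [krawtchoukNat, Int.cast_sum, Finset.sum_mul]
    refine Finset.sum_congr rfl fun k hk => ?_
    simp only [hF]
    rw [show k + (j - k) = j by have := Finset.mem_range.1 hk; omega]
    push_cast
    ring
  rw [Finset.sum_congr rfl h₁, Finset.sum_range_diag_flip]
  have h₂ : (a - b) ^ i * (a + b) ^ (n - i) =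
      ∑ k ∈ Finset.range (i + 1), ∑ l ∈ Finset.range (n - i + 1), F k l := by
    rw [sub_eq_neg_add, add_comm a b, add_pow, add_pow, Finset.sum_mul_sum]
    refine Finset.sum_congr rfl fun k hk => Finset.sum_congr rfl fun l hl => ?_
    have hk := Finset.mem_range.1 hk
    have hl := Finset.mem_range.1 hl
    simp only [hF]
    rw [neg_pow, show n - (k + l) = (i - k) + (n - i - l) by omega, pow_add, pow_add]
    ring
  rw [h₂]
  symm
  refine Finset.sum_subset_zero_on_sdiff (Finset.range_mono (by omega)) (fun k hk => ?_)
    (fun k hk => ?_)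
  · have : i < k := by simpa using (Finset.mem_sdiff.1 hk).2
    exact Finset.sum_eq_zero fun l _ => by simp [hF, Nat.choose_eq_zero_of_lt this]
  · have hk := Finset.mem_range.1 hk
    refine Finset.sum_subset (Finset.range_mono (by omega)) fun l _ hl => ?_
    have : n - i < l := by simpa using hl
    simp [hF, Nat.choose_eq_zero_of_lt this]

theorem generating_krawtchoukNat {n i : ℕ} (hi : i ≤ n) :
    ∑ j ∈ Finset.range (n + 1), Polynomial.C (krawtchoukNat n i j) * Polynomial.X ^ j =
      (1 - Polynomial.X) ^ i * (1 + Polynomial.X) ^ (n - i) := by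
  rw [← sum_krawtchoukNat hi]
  simp

theorem coeff_sum_C_mul_X_pow {n j : ℕ} (hj : j ≤ n) (c : ℕ → ℤ) :
    (∑ j ∈ Finset.range (n + 1), Polynomial.C (c j) * Polynomial.X ^ j).coeff j = c j := by
  rw [Polynomial.finsetSum_coeff]
  simp only [Polynomial.coeff_C_mul_X_pow]
  rw [Finset.sum_ite_eq, if_pos (by simp; omega)]

/-- With a = 1 + X and b = 1 - X the generating function becomes (2X)^i 2^{n-i} = 2^n X^i, while
each term on the left contains the generating function of row j. Comparing coefficients of X^l gives
the entry of the product. -/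
theorem krawtchouk_mul_self (n : ℕ) : krawtchouk n * krawtchouk n = (2 ^ n : ℤ) • 1 := by
  ext i l
  have hi : i.val ≤ n := Nat.le_of_lt_succ i.isLt
  have hl : l.val ≤ n := Nat.le_of_lt_succ l.isLt
  rw [Matrix.mul_apply]
  simp only [krawtchouk_apply]
  rw [Fin.sum_univ_eq_sum_range
    (fun j => krawtchoukNat n i j * krawtchoukNat n j l) (n + 1)]
  have h := sum_krawtchoukNat hi (1 + Polynomial.X : Polynomial ℤ) (1 - Polynomial.X)
  have h₁ : ∀ j ∈ Finset.range (n + 1), ((krawtchoukNat n i j : ℤ) : Polynomial ℤ) *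
      ((1 - Polynomial.X) ^ j * (1 + Polynomial.X) ^ (n - j)) =
      Polynomial.C (krawtchoukNat n i j) * ∑ l ∈ Finset.range (n + 1),
        Polynomial.C (krawtchoukNat n j l) * Polynomial.X ^ l := fun j hj => by
    rw [generating_krawtchoukNat (Nat.le_of_lt_succ (Finset.mem_range.1 hj))]
    simp
  rw [Finset.sum_congr rfl h₁] at h
  have h₂ := congrArg (fun p => Polynomial.coeff p l) h
  simp only [Polynomial.finsetSum_coeff, Polynomial.coeff_C_mul] at h₂
  have h₃ : ∀ j, ∑ l' ∈ Finset.range (n + 1),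
      krawtchoukNat n j l' * (Polynomial.X ^ l' : Polynomial ℤ).coeff l = krawtchoukNat n j l := by
    intro j
    have := coeff_sum_C_mul_X_pow hl (krawtchoukNat n j)
    simpa only [Polynomial.finsetSum_coeff, Polynomial.coeff_C_mul] using this
  simp only [h₃] at h₂
  rw [h₂, show (1 + Polynomial.X - (1 - Polynomial.X) : Polynomial ℤ) = 2 * Polynomial.X by ring,
    show (1 + Polynomial.X + (1 - Polynomial.X) : Polynomial ℤ) = 2 by ring, mul_pow, mul_right_comm,
    ← pow_add, Nat.add_sub_cancel' hi,
    show (2 ^ n : Polynomial ℤ) = Polynomial.C (2 ^ n) by simp,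
    Polynomial.coeff_C_mul_X_pow, Matrix.smul_apply, Matrix.one_apply]
  by_cases hil : i = l
  · simp [hil]
  · have : l.val ≠ i.val := fun h => hil (Fin.ext h.symm)
    simp [hil, this]

theorem one_sub_parity {n : ℕ} (S : Finset (Fin n)) (x : Fin n → Bool) :
    (1 - 2 * ((parity S x).toNat : ℤ)) = ∏ l ∈ S, if x l = true then -1 else 1 := by
  rw [Finset.prod_ite, Finset.prod_const_one, mul_one, Finset.prod_const, parity]
  rcases Nat.even_or_odd (S.filter fun l => x l = true).card with h | h
  · simp [h.neg_one_pow, Nat.not_odd_iff_even.2 h]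
  · simp [h.neg_one_pow, h]

/-- Over the sets of size `j`, the signs sum up to the entry of the Krawtchouk matrix. -/
theorem sum_signs {n : ℕ} (x : Fin n → Bool) {j : ℕ} (hj : j ≤ n) :
    ∑ S ∈ (Finset.univ : Finset (Finset (Fin n))).filter (fun S => S.card = j),
      (1 - 2 * ((parity S x).toNat : ℤ)) = krawtchoukNat n (weight x) j := by
  rw [← coeff_sum_C_mul_X_pow hj (krawtchoukNat n (weight x)),
    generating_krawtchoukNat (weight_le x)]
  -- The sum of signs over the sets of size `j` is the elementary symmetric function of the single
  -- signs, a coefficient of ∏ (1 ± X).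
  have h : ∏ l : Fin n, (1 + Polynomial.C (if x l = true then (-1 : ℤ) else 1) * Polynomial.X) =
      (1 - Polynomial.X) ^ weight x * (1 + Polynomial.X) ^ (n - weight x) := by
    have : ∀ l : Fin n, (1 + Polynomial.C (if x l = true then (-1 : ℤ) else 1) * Polynomial.X) =
        if x l = true then 1 - Polynomial.X else 1 + Polynomial.X := by
      intro l
      split_ifs <;> simp [sub_eq_add_neg]
    rw [Finset.prod_congr rfl fun l _ => this l, Finset.prod_ite, Finset.prod_const,
      Finset.prod_const, weight]
    congr 2
    rw [Finset.filter_not, Finset.card_sdiff_of_subset (Finset.filter_subset _ _)]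
    simp
  rw [← h, Finset.prod_one_add, Polynomial.finsetSum_coeff, Finset.powerset_univ,
    Finset.sum_filter]
  refine Finset.sum_congr rfl fun S _ => ?_
  rw [Finset.prod_mul_distrib, Finset.prod_const, ← map_prod, Polynomial.coeff_C_mul_X_pow,
    one_sub_parity]
  simp only [eq_comm]

/-- The value of a symmetric polynomial at an input. -/
theorem polyEval_symmetric {n : ℕ} (d : Fin (n + 1) → ℝ) {c : Finset (Fin n) → ℝ}
    (hc : ∀ S (j : Fin (n + 1)), S.card = j.val → c S = d j) (x : Fin n → Bool) :
    polyEval c x = Real.pi * ∑ j : Fin (n + 1), (krawtchoukNat n (weight x) j : ℝ) * d j := by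
  rw [polyEval]
  congr 1
  rw [← Finset.sum_fiberwise (Finset.univ : Finset (Finset (Fin n)))
    (fun S => (⟨S.card, Nat.lt_succ_of_le (by simpa using Finset.card_le_univ S)⟩ : Fin (n + 1)))]
  refine Finset.sum_congr rfl fun j _ => ?_
  rw [← sum_signs x (Nat.le_of_lt_succ j.isLt), Int.cast_sum, Finset.sum_mul]
  refine Finset.sum_congr ?_ fun S hS => ?_
  · ext S
    simp [Fin.ext_iff]
  · rw [hc S j (by simpa using hS)]
    push_cast
    ring

theorem cos_eq_neg_one_pow_iff (t : ℝ) (b : Bool) :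
    ((Real.cos t : ℝ) : ℂ) = (-1 : ℂ) ^ b.toNat ↔
      ∃ h : ℤ, t = Real.pi * ((b.toNat : ℝ) + 2 * h) := by
  have h : ((Real.cos t : ℝ) : ℂ) = (-1 : ℂ) ^ b.toNat ↔ Real.cos t = (-1 : ℝ) ^ b.toNat := by
    rw [← Complex.ofReal_inj]
    simp
  rw [h]
  cases b
  · rw [Bool.toNat_false, pow_zero, Real.cos_eq_one_iff]
    refine exists_congr fun h => ⟨fun e => by rw [← e]; push_cast; ring, fun e => ?_⟩
    rw [e]
    push_cast
    ring
  · rw [Bool.toNat_true, pow_one, Real.cos_eq_neg_one_iff]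
    refine exists_congr fun h => ⟨fun e => by rw [← e]; push_cast; ring, fun e => ?_⟩
    rw [e]
    push_cast
    ring

theorem Assignment.computes_iff {n : ℕ} (A : Assignment n) (f : (Fin n → Bool) → Bool) :
    A.Computes f ↔ ∀ x, ∃ h : ℤ, ∑ i, A.angle x i = Real.pi * (((f x).toNat : ℝ) + 2 * h) :=
  forall_congr' fun x => by
    rw [expectation_equatorial A.k_pos]
    exact cos_eq_neg_one_pow_iff _ _

/-- Every polynomial is the total angle of an assignment. -/
theorem exists_assignment {n : ℕ} (c : Finset (Fin n) → ℝ) :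
    ∃ A : Assignment n, ∀ x, ∑ i, A.angle x i = polyEval c x := by
  let e := (Fintype.equivFin (Finset (Fin n))).symm
  -- The qubit of S reads the parity of S and has the angle π c_S - 2π c_S s. There is always a
  -- qubit, since even for n = 0 the empty set is a subset.
  refine ⟨⟨_, Fintype.card_pos, e, fun _ => false, fun i => Real.pi * c (e i),
    fun i => -2 * Real.pi * c (e i)⟩, fun x => ?_⟩
  rw [polyEval, Finset.mul_sum, ← Equiv.sum_comp e]
  refine Finset.sum_congr rfl fun i _ => ?_
  simp only [Assignment.angle, Assignment.setting, Bool.false_xor]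
  ring

theorem polyComputes_iff {n : ℕ} (c : Finset (Fin n) → ℝ) (f : (Fin n → Bool) → Bool) :
    PolyComputes c f ↔ ∀ x, ∃ h : ℤ, polyEval c x = Real.pi * (((f x).toNat : ℝ) + 2 * h) := by
  constructor
  · rintro ⟨A, hA, hf⟩ x
    rw [← hA]
    exact (A.computes_iff f).1 hf x
  · intro h
    obtain ⟨A, hA⟩ := exists_assignment c
    exact ⟨A, hA, (A.computes_iff f).2 fun x => by rw [hA]; exact h x⟩

/-- The deterministic computations correspond to the integer vectors in the kernel of the
Krawtchouk submatrix that reduce to the value vector modulo two. -/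
theorem Instance.solvable_iff (I : Instance) : I.Solvable ↔ ∃ h : Fin (I.n + 1) → ℤ,
    ∀ i ∉ I.T, ∑ j, krawtchouk I.n i j * (I.intVector j + 2 * h j) = 0 := by
  have hinv : ∀ (d : Fin (I.n + 1) → ℝ) (i : Fin (I.n + 1)),
      ∑ j, (krawtchouk I.n i j : ℝ) * ∑ l, (krawtchouk I.n j l : ℝ) * d l = 2 ^ I.n * d i := by
    intro d i
    have h := congrArg (fun M : Matrix (Fin (I.n + 1)) (Fin (I.n + 1)) ℤ =>
      ((M.map (Int.cast : ℤ → ℝ)) *ᵥ d) i) (krawtchouk_mul_self I.n)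
    simp only [Matrix.mulVec, dotProduct, Matrix.map_apply, Matrix.mul_apply, Matrix.smul_apply,
      Matrix.one_apply, smul_eq_mul, mul_ite, mul_one, mul_zero] at h
    simp only [Int.cast_ite, Int.cast_pow, Int.cast_ofNat, Int.cast_zero, ite_mul, zero_mul,
      Finset.sum_ite_eq, Finset.mem_univ, if_true] at h
    rw [← h]
    simp only [Int.cast_sum, Int.cast_mul, Finset.mul_sum, Finset.sum_mul]
    rw [Finset.sum_comm]
    exact Finset.sum_congr rfl fun l _ => Finset.sum_congr rfl fun j _ => by ring
  constructor
  · rintro ⟨c, hsym, hsup, hc⟩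
    rw [polyComputes_iff] at hc
    -- The coefficient of a level is read off at the set of the first `j` positions, and below the
    -- integer `h j` at the input with the first `j` bits set, which serves for all inputs of its
    -- weight.
    set d : Fin (I.n + 1) → ℝ := fun j => c (Finset.univ.filter fun l : Fin I.n => l.val < j.val)
      with hd
    have hcard : ∀ j : Fin (I.n + 1),
        (Finset.univ.filter fun l : Fin I.n => l.val < j.val).card = j.val := fun j =>
      card_prefix (Nat.le_of_lt_succ j.isLt)
    choose h hh using fun j : Fin (I.n + 1) => hc fun l => decide (l.val < j.val)
    refine ⟨h, fun i hi => ?_⟩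
    have key : ∀ j, ∑ l, (krawtchouk I.n j l : ℝ) * d l = (I.intVector j : ℝ) + 2 * h j := by
      intro j
      have := hh j
      rw [polyEval_symmetric d (fun S j hS => hsym _ _ (by rw [hS, hcard])),
        weight_prefix (Nat.le_of_lt_succ j.isLt)] at this
      have := mul_left_cancel₀ Real.pi_ne_zero this
      simp only [krawtchouk_apply]
      rw [this, Instance.intVector, valueVector]
      simp
    have h0 : d i = 0 := by
      by_contra hne
      obtain ⟨i', hi', he⟩ := hsup _ hne
      rw [hcard] at he
      exact hi (Fin.ext he ▸ hi')
    have := hinv d i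
    simp only [key, h0, mul_zero] at this
    exact_mod_cast this
  · rintro ⟨h, hh⟩
    -- The inverse transform of the prescribed values; it vanishes at the forbidden levels by
    -- hypothesis.
    set d : Fin (I.n + 1) → ℝ := fun i =>
      (∑ j, (krawtchouk I.n i j : ℝ) * ((I.intVector j : ℝ) + 2 * h j)) / 2 ^ I.n with hd
    have hlt : ∀ S : Finset (Fin I.n), S.card < I.n + 1 := fun S =>
      Nat.lt_succ_of_le (by simpa using Finset.card_le_univ S)
    refine ⟨fun S => d ⟨S.card, hlt S⟩, fun S S' hS => by simp only [hS], fun S hS => ?_,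
      (polyComputes_iff _ _).2 fun x => ?_⟩
    · by_contra hne
      push Not at hne
      refine hS ?_
      have h0 := hh ⟨S.card, hlt S⟩ fun hm => hne _ hm rfl
      have h0' : (∑ j, (krawtchouk I.n ⟨S.card, hlt S⟩ j : ℝ) *
          ((I.intVector j : ℝ) + 2 * h j)) = 0 := by exact_mod_cast h0
      simp only [hd, h0', zero_div]
    · refine ⟨h ⟨weight x, Nat.lt_succ_of_le (weight_le x)⟩, ?_⟩
      rw [polyEval_symmetric d fun S j hS => by congr 1; exact Fin.ext hS]
      congr 1
      have := hinv (fun j => (I.intVector j : ℝ) + 2 * h j)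
        ⟨weight x, Nat.lt_succ_of_le (weight_le x)⟩
      simp only [hd, ← krawtchouk_apply I.n ⟨weight x, Nat.lt_succ_of_le (weight_le x)⟩]
      have hp : (2 : ℝ) ^ I.n ≠ 0 := by positivity
      rw [Finset.sum_congr rfl fun j _ => (mul_div_assoc _ _ _).symm, ← Finset.sum_div, this,
        mul_div_cancel_left₀ _ hp, I.symm.apply_eq x]
      simp [Instance.intVector]

theorem Instance.solvable_iff_mulVec (I : Instance) : I.Solvable ↔ ∃ h : Fin (I.n + 1) → ℤ,
    I.subKrawtchouk.mulVec I.intVector = -(I.subKrawtchouk.mulVec (fun j => 2 * h j)) := by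
  rw [I.solvable_iff]
  refine exists_congr fun h => ?_
  rw [eq_neg_iff_add_eq_zero, ← Matrix.mulVec_add, funext_iff]
  exact ⟨fun h' i => h' i.1 i.2, fun h' i hi => h' ⟨i, hi⟩⟩

/-- A linear system in diagonal form. -/
theorem exists_mulVec_diagonal {α β : Type*} [Fintype α] [DecidableEq α] [Fintype β] [DecidableEq β]
    {K D : Matrix α β ℤ} {U : Matrix α α ℤ} {V : Matrix β β ℤ} (e : α ↪ β) (hU : IsUnit U.det)
    (hV : IsUnit V.det) (hD : U * K * V = D) (hdiag : ∀ i j, j ≠ e i → D i j = 0) (v : β → ℤ) :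
    (∃ h : β → ℤ, K.mulVec v = -(K.mulVec fun j => 2 * h j)) ↔
      ∀ i, 2 * D i (e i) ∣ U.mulVec (K.mulVec v) i := by
  have hD' : ∀ (g : β → ℤ) i, (D *ᵥ g) i = D i (e i) * g (e i) := fun g i => by
    rw [Matrix.mulVec, dotProduct, Finset.sum_eq_single (e i)]
    · intro j _ hj
      rw [hdiag i j hj, zero_mul]
    · simp
  have hUV : ∀ g : β → ℤ, U *ᵥ (K *ᵥ (V *ᵥ g)) = D *ᵥ g := fun g => by
    rw [Matrix.mulVec_mulVec, Matrix.mulVec_mulVec, hD]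
  constructor
  · rintro ⟨h, hh⟩ i
    have hVV : V *ᵥ (V⁻¹ *ᵥ fun j => 2 * h j) = fun j => 2 * h j := by
      rw [Matrix.mulVec_mulVec, Matrix.mul_nonsing_inv _ hV, Matrix.one_mulVec]
    have h2 : (V⁻¹ *ᵥ fun j => 2 * h j) = fun j => 2 * (V⁻¹ *ᵥ h) j := by
      have : (fun j => 2 * h j) = (2 : ℤ) • h := rfl
      rw [this, Matrix.mulVec_smul]
      rfl
    rw [hh, Matrix.mulVec_neg, ← hVV, hUV, Pi.neg_apply, hD', h2]
    exact ⟨-(V⁻¹ *ᵥ h) (e i), by ring⟩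
  · intro hdvd
    choose q hq using hdvd
    -- Solve `D g = -q`-scaled row by row: row `i` involves only the variable `e i`, injectivity of
    -- `e` makes the choices independent, and all other variables may be zero.
    let g : β → ℤ := fun j => if hj : ∃ i, e i = j then -q hj.choose else 0
    have hg : ∀ i, g (e i) = -q i := fun i => by
      have hex : ∃ i', e i' = e i := ⟨i, rfl⟩
      simp only [g, dif_pos hex, e.injective hex.choose_spec]
    refine ⟨V *ᵥ g, ?_⟩
    have h2 : (fun j => 2 * (V *ᵥ g) j) = V *ᵥ fun j => 2 * g j := by
      have : (fun j => 2 * g j) = (2 : ℤ) • g := rfl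
      rw [this, Matrix.mulVec_smul]
      rfl
    have hinj : ∀ a b : α → ℤ, U *ᵥ a = U *ᵥ b → a = b := fun a b hab => by
      have := congrArg (U⁻¹ *ᵥ ·) hab
      simpa only [Matrix.mulVec_mulVec, Matrix.nonsing_inv_mul _ hU, Matrix.one_mulVec] using this
    apply hinj
    rw [h2, Matrix.mulVec_neg, hUV]
    funext i
    rw [hq, Pi.neg_apply, hD', hg]
    ring

end NMQC

namespace NMQC

/-! ### From the Krawtchouk matrix to a lattice modulo a power of two -/

/-- Write 1 - X = -2X + (1 + X) in (1 - X)^i (1 + X)^{n-i} and expand: the powers of two split off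
together with C(i, k), and the rest no longer depends on `i`. -/
theorem krawtchoukNat_eq {n i j : ℕ} (hi : i ≤ n) (hj : j ≤ n) : krawtchoukNat n i j =
    ∑ k ∈ Finset.range (n + 1),
      (2 ^ k * i.choose k : ℤ) * ((-1) ^ k * ((n - k).choose (n - j) : ℤ)) := by
  rw [← coeff_sum_C_mul_X_pow hj (krawtchoukNat n i), generating_krawtchoukNat hi,
    show (1 - Polynomial.X : Polynomial ℤ) = -2 * Polynomial.X + (1 + Polynomial.X) by ring,
    add_pow, Finset.sum_mul, Polynomial.finsetSum_coeff]
  have h : ∀ k ∈ Finset.range (i + 1),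
      ((-2 * Polynomial.X) ^ k * (1 + Polynomial.X) ^ (i - k) * (i.choose k : Polynomial ℤ) *
        (1 + Polynomial.X) ^ (n - i)).coeff j =
      (2 ^ k * i.choose k : ℤ) * ((-1) ^ k * ((n - k).choose (n - j) : ℤ)) := by
    intro k hk
    have hk := Nat.le_of_lt_succ (Finset.mem_range.1 hk)
    rw [show ((-2 * Polynomial.X) ^ k * (1 + Polynomial.X) ^ (i - k) * (i.choose k : Polynomial ℤ) *
        (1 + Polynomial.X) ^ (n - i)) = Polynomial.C ((2 ^ k * i.choose k : ℤ) * (-1) ^ k) *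
          (Polynomial.X ^ k * (1 + Polynomial.X) ^ (n - k)) by
      rw [show n - k = (i - k) + (n - i) by omega, pow_add, mul_pow, neg_pow]
      simp
      ring, Polynomial.coeff_C_mul, Polynomial.coeff_X_pow_mul', mul_assoc]
    congr 2
    split_ifs with hkj
    · rw [Polynomial.coeff_one_add_X_pow, Nat.choose_symm_of_eq_add]
      omega
    · rw [Nat.choose_eq_zero_of_lt (by omega), Nat.cast_zero]
  rw [Finset.sum_congr rfl h]
  refine Finset.sum_subset (Finset.range_mono (by omega)) fun k _ hk => ?_
  rw [Nat.choose_eq_zero_of_lt (by simpa using hk)]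
  simp

/-- The matrix of the numbers `2^k C(i, k)`. -/
def chooseMatrix (N : ℕ) : Matrix (Fin N) (Fin N) ℤ :=
  Matrix.of fun i k => 2 ^ k.val * (i.val.choose k : ℤ)

/-- The matrix of the numbers `(-1)^k C(n - k, n - j)`. -/
def pascalMatrix (n : ℕ) : Matrix (Fin (n + 1)) (Fin (n + 1)) ℤ :=
  Matrix.of fun k j => (-1) ^ k.val * ((n - k.val).choose (n - j.val) : ℤ)

theorem krawtchouk_eq_mul (n : ℕ) : krawtchouk n = chooseMatrix (n + 1) * pascalMatrix n := by
  ext i j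
  rw [krawtchouk_apply, krawtchoukNat_eq (Nat.le_of_lt_succ i.isLt) (Nat.le_of_lt_succ j.isLt),
    Matrix.mul_apply, Finset.sum_range]
  rfl

/-- The matrix is upper triangular with diagonal entries ±1. -/
theorem isUnit_det_pascalMatrix (n : ℕ) : IsUnit (pascalMatrix n).det := by
  have h : (pascalMatrix n).BlockTriangular id := fun k j hjk => by
    have hjk : j.val < k.val := hjk
    rw [pascalMatrix, Matrix.of_apply, Nat.choose_eq_zero_of_lt (by omega)]
    simp
  rw [Matrix.det_of_isUpperTriangular h]
  refine IsUnit.prod_univ_iff.2 fun k => ?_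
  rw [pascalMatrix, Matrix.of_apply, Nat.choose_self]
  simpa using (isUnit_one.neg : IsUnit (-1 : ℤ)).pow k.val

/-- A vector in the kernel of some rows of `K` can be corrected from a vector that these rows map
to multiples of the square of `K`. -/
theorem exists_kernel_iff {ι : Type*} [Fintype ι] [DecidableEq ι] {K B W : Matrix ι ι ℤ} {c : ℤ}
    (hK : K * K = c • 1) (hB : K = B * W) (hW : IsUnit W.det) (E : ι → Prop) {v u : ι → ℤ}
    (hu : ∀ k, (2 : ℤ) ∣ (W *ᵥ v) k - u k) :
    (∃ h : ι → ℤ, ∀ i, E i → (K *ᵥ (v + (2 : ℤ) • h)) i = 0) ↔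
      ∃ y : ι → ℤ, ∀ i, E i → 2 * c ∣ (B *ᵥ (u + (2 : ℤ) • y)) i := by
  choose t ht using hu
  have ht : W *ᵥ v = u + (2 : ℤ) • t := funext fun k => by
    simp only [Pi.add_apply, Pi.smul_apply, smul_eq_mul, ← ht]
    ring
  constructor
  · rintro ⟨h, hh⟩
    refine ⟨t + W *ᵥ h, fun i hi => ?_⟩
    have : u + (2 : ℤ) • (t + W *ᵥ h) = W *ᵥ (v + (2 : ℤ) • h) := by
      rw [Matrix.mulVec_add, Matrix.mulVec_smul, ht, smul_add, add_assoc]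
    rw [this, Matrix.mulVec_mulVec, ← hB, hh i hi]
    exact dvd_zero _
  · rintro ⟨y, hy⟩
    choose r hr using hy
    classical
    -- The quotients are known only for the rows in `E`; any values would do elsewhere.
    let r' : ι → ℤ := fun i => if hi : E i then r i hi else 0
    have hW' : W *ᵥ (v + (2 : ℤ) • (W⁻¹ *ᵥ (y - t))) = u + (2 : ℤ) • y := by
      rw [Matrix.mulVec_add, Matrix.mulVec_smul, Matrix.mulVec_mulVec, Matrix.mul_nonsing_inv _ hW,
        Matrix.one_mulVec, ht, smul_sub]
      abel
    -- Without the last term, `K` yields `B (u + 2y)`, which on `E` equals `2c r`. As `K * K = c`,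
    -- subtracting `K r'` from `h` removes exactly this remainder.
    refine ⟨W⁻¹ *ᵥ (y - t) - K *ᵥ r', fun i hi => ?_⟩
    have : v + (2 : ℤ) • (W⁻¹ *ᵥ (y - t) - K *ᵥ r') =
        v + (2 : ℤ) • (W⁻¹ *ᵥ (y - t)) - (2 : ℤ) • (K *ᵥ r') := by
      rw [smul_sub, add_sub_assoc]
    rw [this, Matrix.mulVec_sub, Matrix.mulVec_smul, Matrix.mulVec_mulVec, hK,
      Matrix.smul_mulVec, Matrix.one_mulVec, Pi.sub_apply]
    nth_rw 1 [hB]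
    rw [← Matrix.mulVec_mulVec, hW', hr i hi]
    simp only [Pi.smul_apply, smul_eq_mul, r', dif_pos hi]
    ring

theorem intCast_bitVec_eq_zero_iff {N : ℕ} (z : ℤ) : (z : BitVec N) = 0 ↔ 2 ^ N ∣ z := by
  rw [← BitVec.toInt_inj, BitVec.toInt_intCast]
  have := Int.dvd_iff_bmod_eq_zero (a := 2 ^ N) (b := z)
  push_cast at this
  rw [this]
  simp

namespace Procedure

open Arr

theorem scaledChoose_eq {N : ℕ} (k i : Fin N) :
    scaledChoose N k i = ((chooseMatrix N i k : ℤ) : BitVec N) := by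
  simp [scaledChoose, chooseMatrix]

theorem mem_closure_iff {N : ℕ} (g : Fin N → BitVec N) :
    g ∈ AddSubgroup.closure {x | ∃ q < N, x = scaledChoose N q + scaledChoose N q} ↔
      ∃ y : Fin N → ℤ, ∀ i, g i = (((chooseMatrix N *ᵥ ((2 : ℤ) • y)) i : ℤ) : BitVec N) := by
  constructor
  · intro hg
    induction hg using AddSubgroup.closure_induction with
    | mem x hx =>
      obtain ⟨q, hq, rfl⟩ := hx
      refine ⟨Pi.single ⟨q, hq⟩ 1, fun i => ?_⟩
      rw [Matrix.mulVec_smul, Matrix.mulVec_single_one]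
      simp only [Pi.smul_apply, Matrix.col_apply, smul_eq_mul, Int.cast_mul, Pi.add_apply]
      rw [← scaledChoose_eq, Int.cast_ofNat, two_mul]
    | zero => exact ⟨0, fun i => by simp⟩
    | add a b _ _ ha hb =>
      obtain ⟨y, hy⟩ := ha
      obtain ⟨z, hz⟩ := hb
      exact ⟨y + z, fun i => by
        rw [smul_add, Matrix.mulVec_add, Pi.add_apply, Pi.add_apply, Int.cast_add, hy, hz]⟩
    | neg a _ ha =>
      obtain ⟨y, hy⟩ := ha
      exact ⟨-y, fun i => by
        rw [smul_neg, Matrix.mulVec_neg, Pi.neg_apply, Pi.neg_apply, Int.cast_neg, hy]⟩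
  · rintro ⟨y, hy⟩
    have : g = ∑ k : Fin N, y k • (scaledChoose N k + scaledChoose N k) := by
      funext i
      rw [hy, Finset.sum_apply, Matrix.mulVec, dotProduct, Int.cast_sum]
      refine Finset.sum_congr rfl fun k _ => ?_
      simp only [Pi.smul_apply, Pi.add_apply, scaledChoose_eq, zsmul_eq_mul, smul_eq_mul,
        Int.cast_mul, Int.cast_ofNat]
      ring
    rw [this]
    exact AddSubgroup.sum_mem _ fun k _ =>
      AddSubgroup.zsmul_mem _ (AddSubgroup.subset_closure (by exact ⟨k, k.isLt, rfl⟩)) _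

/-- Adding `irrelevant` restricts the comparison to the coordinates with `lev i = false`. The
reflection `r ↦ N - 1 - r` matches the order in which the Horner scheme consumes the bits. -/
theorem mem_closure_sup_irrelevant_iff {N : ℕ} (lev u : ℕ → Bool) :
    (fun i => ∑ r ∈ Finset.range N, if u r = true then scaledChoose N (N - 1 - r) i else 0) ∈
        AddSubgroup.closure {x | ∃ q < N, x = scaledChoose N q + scaledChoose N q} ⊔
          irrelevant N lev ↔
      ∃ y : Fin N → ℤ, ∀ i : Fin N, lev i = false → 2 ^ N ∣
        (chooseMatrix N *ᵥ ((fun k : Fin N => ((u (N - 1 - k)).toNat : ℤ)) + (2 : ℤ) • y)) i := by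
  have ht : ∀ i : Fin N,
      (∑ r ∈ Finset.range N, if u r = true then scaledChoose N (N - 1 - r) i else 0) =
        (((chooseMatrix N *ᵥ fun k : Fin N => ((u (N - 1 - k)).toNat : ℤ)) i : ℤ) : BitVec N) := by
    intro i
    rw [← Finset.sum_range_reflect, Finset.sum_range, Matrix.mulVec, dotProduct, Int.cast_sum]
    refine Finset.sum_congr rfl fun k _ => ?_
    have hk := k.isLt
    rw [show N - 1 - (N - 1 - k.val) = k by omega, scaledChoose_eq]
    cases u (N - 1 - k) <;> simp
  rw [AddSubgroup.mem_sup]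
  constructor
  · rintro ⟨g, hg, w, hw, h⟩
    obtain ⟨y, hy⟩ := (mem_closure_iff g).1 hg
    refine ⟨-y, fun i hi => ?_⟩
    have hi' := congrFun h i
    rw [Pi.add_apply, hw i hi, add_zero, ht, hy] at hi'
    rw [← intCast_bitVec_eq_zero_iff, smul_neg, Matrix.mulVec_add, Matrix.mulVec_neg, Pi.add_apply,
      Pi.neg_apply, Int.cast_add, Int.cast_neg, ← hi', add_neg_cancel]
  · rintro ⟨y, hy⟩
    refine ⟨fun i => (((chooseMatrix N *ᵥ ((2 : ℤ) • -y)) i : ℤ) : BitVec N),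
      (mem_closure_iff _).2 ⟨-y, fun i => rfl⟩, _, fun i hi => ?_, add_sub_cancel _ _⟩
    have := (intCast_bitVec_eq_zero_iff _).2 (hy i hi)
    rw [Matrix.mulVec_add, Pi.add_apply, Int.cast_add] at this
    rw [Pi.sub_apply, ht, smul_neg, Matrix.mulVec_neg, Pi.neg_apply, Int.cast_neg, sub_neg_eq_add]
    exact this

theorem parityOf_eq_cast (b : Bool) : parityOf b = ((b.toNat : ℤ) : ZMod 2) := by
  cases b <;> rfl

theorem exists_parityOf (z : ZMod 2) : ∃ b, parityOf b = z := by
  revert z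
  decide

/-- Modulo two the signs of `pascalMatrix` disappear; the substitution `j = n - r` then gives the
binomial sum with `p = n - k`. -/
theorem triangleSum_eq_mulVec {n : ℕ} (v : ℕ → Bool) (k : Fin (n + 1)) :
    triangleSum v n (n - k) =
      (((pascalMatrix n *ᵥ fun j : Fin (n + 1) => ((v j).toNat : ℤ)) k : ℤ) : ZMod 2) := by
  have hneg : (-1 : ZMod 2) = 1 := by decide
  have h : ∀ j : Fin (n + 1), ((pascalMatrix n k j * ((v j).toNat : ℤ) : ℤ) : ZMod 2) =
      ((n - k.val).choose (n - j.val) : ZMod 2) * parityOf (v j) := fun j => by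
    rw [parityOf_eq_cast]
    simp [pascalMatrix, hneg]
  rw [Matrix.mulVec, dotProduct, Int.cast_sum, Finset.sum_congr rfl fun j _ => h j,
    Fin.sum_univ_eq_sum_range
      (fun j => ((n - k.val).choose (n - j) : ZMod 2) * parityOf (v j)) (n + 1),
    ← Finset.sum_range_reflect, triangleSum]
  have hr : ∀ r ∈ Finset.range (n + 1),
      ((n - k.val).choose (n - (n + 1 - 1 - r)) : ZMod 2) * parityOf (v (n + 1 - 1 - r)) =
        ((n - k.val).choose r : ZMod 2) * parityOf (v (n - r)) := fun r hr => by
    have := Finset.mem_range.1 hr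
    rw [Nat.add_sub_cancel, show n - (n - r) = r by omega]
  rw [Finset.sum_congr rfl hr]
  refine Finset.sum_subset (Finset.range_mono (by omega)) fun r _ hr => ?_
  rw [Nat.choose_eq_zero_of_lt (by simpa using hr)]
  simp

theorem main_eq_true_iff (I : Instance) (ρ : Var → ℕ) :
    main.eval (I.n + 1) ρ (BitProg.inputMem value level I.encode) accept [] = true ↔
      I.Solvable := by
  have hv : ∀ j : Fin (I.n + 1),
      ((I.encode[j.val]?.map Prod.fst).getD false) = valueVector I.f j := fun j => by
    rw [Instance.encode, List.getElem?_ofFn, dif_pos j.isLt]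
    rfl
  have hl : ∀ j : Fin (I.n + 1),
      ((I.encode[j.val]?.map Prod.snd).getD false) = false ↔ j ∉ I.T := fun j => by
    rw [Instance.encode, List.getElem?_ofFn, dif_pos j.isLt]
    simp
  rw [main_spec (Nat.add_one_pos I.n), I.solvable_iff, Nat.add_sub_cancel]
  set v : ℕ → Bool := fun j => (I.encode[j]?.map Prod.fst).getD false
  set lev : ℕ → Bool := fun j => (I.encode[j]?.map Prod.snd).getD false
  have key : ∀ u : ℕ → Bool, (∀ r < I.n + 1, parityOf (u r) = triangleSum v I.n r) →
      ((fun i => ∑ r ∈ Finset.range (I.n + 1),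
          if u r = true then scaledChoose (I.n + 1) (I.n - r) i else 0) ∈
        AddSubgroup.closure
          {x | ∃ q < I.n + 1, x = scaledChoose (I.n + 1) q + scaledChoose (I.n + 1) q} ⊔
          irrelevant (I.n + 1) lev ↔
        ∃ h : Fin (I.n + 1) → ℤ,
          ∀ i ∉ I.T, ∑ j, krawtchouk I.n i j * (I.intVector j + 2 * h j) = 0) := by
    intro u hu
    have h₁ := mem_closure_sup_irrelevant_iff (N := I.n + 1) lev u
    rw [Nat.add_sub_cancel] at h₁
    rw [h₁]
    have h₂ := exists_kernel_iff (krawtchouk_mul_self I.n) (krawtchouk_eq_mul I.n)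
      (isUnit_det_pascalMatrix I.n) (fun i => i ∉ I.T) (v := I.intVector)
      (u := fun k => ((u (I.n - k)).toNat : ℤ)) fun k => by
        rw [← Nat.cast_two, ← ZMod.intCast_zmod_eq_zero_iff_dvd, Int.cast_sub, sub_eq_zero,
          ← parityOf_eq_cast, hu _ (by omega), triangleSum_eq_mulVec]
        simp only [v, hv]
        rfl
    -- The modulus `2 * 2 ^ n` equals `2 ^ (n + 1)`, which explains the word length `N = n + 1`, the
    -- same as the length of the input.
    rw [← pow_succ'] at h₂
    simp only [lev, hl]
    exact h₂.symm
  constructor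
  · rintro ⟨u, hu, h⟩
    exact (key u hu).1 h
  · intro h
    choose u hu using fun r => exists_parityOf (triangleSum v I.n r)
    exact ⟨u, fun r _ => hu r, (key u fun r _ => hu r).2 h⟩

end Procedure

theorem Instance.length_encode (I : Instance) : I.encode.length = I.n + 1 := List.length_ofFn

theorem Instance.encode_ne_nil (I : Instance) : I.encode ≠ [] := fun h => by
  have := I.length_encode
  simp [h] at this

end NMQC

theorem lemma7 :
    -- a Turing machine with finite alphabets decides the problem in polynomial time
    (∃ answer : NMQC.Instance → Bool,
      (∀ I : NMQC.Instance, answer I = true ↔ I.Solvable) ∧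
      ∃ M : Turing.TM2ComputableInPolyTime NMQC.Instance.encode Computability.encodeBool answer,
        ∀ k : M.tm.K, Finite (M.tm.Γ k)) ∧
    -- the problem is a linear Diophantine system in the Krawtchouk submatrix
    (∀ I : NMQC.Instance,
      I.Solvable ↔ ∃ h : Fin (I.n + 1) → ℤ,
        I.subKrawtchouk.mulVec I.intVector = -(I.subKrawtchouk.mulVec (fun j => 2 * h j))) ∧
    -- the system is decided by any diagonal form of that submatrix, such as the Smith normal form
    (∀ (I : NMQC.Instance)
      (U : Matrix {i : Fin (I.n + 1) // i ∉ I.T} {i : Fin (I.n + 1) // i ∉ I.T} ℤ)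
      (V : Matrix (Fin (I.n + 1)) (Fin (I.n + 1)) ℤ)
      (D : Matrix {i : Fin (I.n + 1) // i ∉ I.T} (Fin (I.n + 1)) ℤ)
      (e : {i : Fin (I.n + 1) // i ∉ I.T} ↪ Fin (I.n + 1)),
      IsUnit U.det → IsUnit V.det → U * I.subKrawtchouk * V = D →
      (∀ i j, j ≠ e i → D i j = 0) →
      (I.Solvable ↔
        ∀ i, 2 * D i (e i) ∣ U.mulVec (I.subKrawtchouk.mulVec I.intVector) i)) := by
  -- The answer function is left open and unified with the bit that the machine leaves in `accept`.
  refine ⟨⟨_, fun I => ?_, BitProg.exists_machine NMQC.Procedure.main_wellScoped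
    (by decide : NMQC.Arr.value ≠ NMQC.Arr.level) NMQC.Arr.accept NMQC.Instance.encode
    NMQC.Instance.encode_ne_nil⟩, NMQC.Instance.solvable_iff_mulVec,
    fun I U V D e hU hV hD hdiag => ?_⟩
  · rw [I.length_encode]
    exact NMQC.Procedure.main_eq_true_iff I _
  · rw [I.solvable_iff_mulVec]
    exact NMQC.exists_mulVec_diagonal e hU hV hD hdiag _
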